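/- A \emph{Chinese character} is a finite uni-trivalent graph (loops and multiple edges allowed) in which every connected component has at least one univalent vertex, with a cyclic order of the (half-)edges at each trivalent vertex. Univalent vertices are called \emph{external}. An \emph{$l$-marked} Chinese character has its external vertices colored by $1,\dots,l$. Let $\mathcal B_l$ be the $\mathbb Q$-vector space spanned by (homeomorphism classes of) $l$-marked Chinese characters modulo antisymmetry (reversing the cyclic order at one trivalent vertex changes the sign) and the Jacobi (IHX) relation. A \emph{Chinese character diagram on $l$ strings} is a Chinese character whose external vertices are placed at distinct points of $l$ ordered oriented lines (strings); let $\mathcal P_l$ be the $\mathbb Q$-vector space spanned by (homeomorphism classes of) these diagrams modulo the STU relation. Let $\mathcal B_l^{\mathbb Z}$ and $\mathcal P_l^{\mathbb Z}$ be the subgroups of integer linear combinations of marked Chinese characters and of diagrams, respectively. A marked Chinese character is \emph{non-degenerate} if every color occurs on it, and a diagram is \emph{non-degenerate} if every string carries an external vertex. Let $\mathcal F_l\subset\mathcal B_l$ be the subspace spanned by the non-degenerate $l$-marked Chinese characters whose graph is connected, and $\mathcal F_l^{\mathbb Z}$ the group of their integer linear combinations; let $\mathcal Q_l\subset\mathcal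 P_l$ and $\mathcal Q_l^{\mathbb Z}$ be defined in the same way from the non-degenerate diagrams on $l$ strings whose graph is connected. An element $x$ \emph{has denominator $N$} with respect to a lattice $V^{\mathbb Z}$ if $Nx\in V^{\mathbb Z}$. \textbf{Proposition.} Let $l\ge 0$. There is a (unique) linear map $\chi:\mathcal B_l\to\mathcal P_l$ which sends every $l$-marked Chinese character $\xi$ with $k_i$ external vertices of color $i$ to $\frac1{k_1!\cdots k_l!}$ times the sum of the $k_1!\cdots k_l!$ diagrams obtained by placing, for each $i$, the external vertices of color $i$ on the $i$-th string in all possible orders. It is an isomorphism, and: (a) If $\xi$ is an $l$-marked Chinese character with $m$ external vertices, then $\chi(\xi)$ has denominator $m!$ with respect to $\mathcal P_l^{\mathbb Z}$. If $D$ is a Chinese character diagram on $l$ strings with $m$ external vertices, then $\chi^{-1}(D)$ has denominator $m!$ with respect to $\mathcal B_l^{\mathbb Z}$. (b) Let $l\ge2$. If $\xi$ is an $l$-marked Chinese character with $m$ external vertices whose class lies in $\mathcal F_l$ (for example, a connected non-degenerate one), then $\chi(\xi)$ has denominator $[(m-1)!]^2$ with respect to $\mathcal Q_l^{\mathbb Z}$.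 If $D$ is a Chinese character diagram with $m$ external vertices whose class lies in $\mathcal Q_l$ (for example, a connected non-degenerate one), then $\chi^{-1}(D)$ has denominator $[(m-1)!]^2$ with respect to $\mathcal F_l^{\mathbb Z}$. (For $m=0$, which can only occur here for a class equal to $0$, $(m-1)!$ is read as $1$.) -/

import Mathlib

open scoped Nat

noncomputable section

/-- A Chinese character: a finite vertex-oriented uni-trivalent graph each of whose connected
components contains a univalent vertex, encoded by its half-edges. The vertices are the cycles of
`rot`, which sends a half-edge to the next one in the cyclic order at its vertex; by `rot_rot_rot`
each cycle has length 1 (univalent, or external, vertices) or 3 (trivalent, or internal, vertices).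
The edges are the pairs `{h, opp h}`. Loops and multiple edges are allowed. -/
structure ChineseCharacter where
  H : Type
  finite_H : Finite H
  rot : Equiv.Perm H
  opp : Equiv.Perm H
  rot_rot_rot : ∀ h, rot (rot (rot h)) = h
  opp_opp : ∀ h, opp (opp h) = h
  opp_ne : ∀ h, opp h ≠ h
  exists_external : ∀ h, ∃ g,
    Relation.EqvGen (fun x y => y = rot x ∨ y = opp x) h g ∧ rot g = g

namespace ChineseCharacter

/-- The external (univalent) vertices. -/
abbrev External (G : ChineseCharacter) : Type := {h : G.H // G.rot h = h}

def numExternal (G : ChineseCharacter) : ℕ := Nat.card G.External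

/-- The graph is nonempty and any two half-edges lie in the same component. -/
def IsConnected (G : ChineseCharacter) : Prop :=
  Nonempty G.H ∧
    ∀ x y : G.H, Relation.EqvGen (fun u v => v = G.rot u ∨ v = G.opp u) x y

end ChineseCharacter

/-- An `n`-marked Chinese character: the external vertices are coloured by `n` colours. -/
structure MarkedCharacter (n : ℕ) extends ChineseCharacter where
  color : toChineseCharacter.External → Fin n

namespace MarkedCharacter

variable {n : ℕ}

/-- Each colour occurs (that is, `ε_i ξ = 0` for all `i`). -/
def IsNondegenerate (ξ : MarkedCharacter n) : Prop := ∀ i, ∃ h, ξ.color h = i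

/-- The number of external vertices of colour `i`. -/
def numColor (ξ : MarkedCharacter n) (i : Fin n) : ℕ := Nat.card {h // ξ.color h = i}

/-- `ξ'` is, up to a homeomorphism, obtained from `ξ` by detaching the half-edges from the vertices
and attaching `ρ h` where `h` was attached; the edges and the colours stay. It is used for `ρ = 1`,
where it says that `ξ` and `ξ'` are homeomorphic, and for `ρ` moving only half-edges at
trivalent vertices. -/
def Reattach (ξ : MarkedCharacter n) (ρ : Equiv.Perm ξ.H) (ξ' : MarkedCharacter n) : Prop :=
  ∃ e : ξ.H ≃ ξ'.H,
    (∀ h, ξ'.opp (e h) = e (ξ.opp h)) ∧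
    (∀ h, ξ'.rot (e (ρ h)) = e (ρ (ξ.rot h))) ∧
    ∀ (h : ξ.External) (h' : ξ'.External), e h.1 = h'.1 → ξ'.color h' = ξ.color h

open Classical in
/-- The relations that define `𝓑 n`. In `antisymm` the cyclic order `(a, b, c)` at one trivalent
vertex is replaced by `(a, c, b)`. In `jacobi` an edge `{a, a'}` joins two distinct trivalent
vertices `(a, b, c)` and `(a', d, e)`, and `(b, c, d)` is permuted cyclically; modulo `antisymm`
this is the relation `ξ₁ = ξ₂ + ξ₃` (IHX). -/
inductive Rel : (MarkedCharacter n →₀ ℚ) → Prop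
  | homeo (ξ ξ' : MarkedCharacter n) (h : ξ.Reattach 1 ξ') :
      Rel (Finsupp.single ξ 1 - Finsupp.single ξ' 1)
  | antisymm (ξ₁ ξ₂ : MarkedCharacter n) (a : ξ₁.H) (ha : ξ₁.rot a ≠ a)
      (h : ξ₁.Reattach (Equiv.swap (ξ₁.rot a) (ξ₁.rot (ξ₁.rot a))) ξ₂) :
      Rel (Finsupp.single ξ₁ 1 + Finsupp.single ξ₂ 1)
  | jacobi (ξ₁ ξ₂ ξ₃ : MarkedCharacter n) (a b c d : ξ₁.H)
      (hb : b = ξ₁.rot a) (hc : c = ξ₁.rot b) (hd : d = ξ₁.rot (ξ₁.opp a))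
      (ha : b ≠ a) (ha' : d ≠ ξ₁.opp a)
      (hab : ξ₁.opp a ≠ b) (hac : ξ₁.opp a ≠ c)
      (h₂ : ξ₁.Reattach (Equiv.swap b c * Equiv.swap c d) ξ₂)
      (h₃ : ξ₁.Reattach (Equiv.swap b c * Equiv.swap c d)⁻¹ ξ₃) :
      Rel (Finsupp.single ξ₁ 1 + Finsupp.single ξ₂ 1 + Finsupp.single ξ₃ 1)

end MarkedCharacter

/-- A Chinese character diagram supported on `n` ordered oriented strings: `strand i` lists the
external vertices that lie on the `i`-th string, in the order given by its orientation. -/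
structure CharacterDiagram (n : ℕ) extends ChineseCharacter where
  strand : Fin n → List H
  nodup : ∀ i, (strand i).Nodup
  disjoint : ∀ i j h, h ∈ strand i → h ∈ strand j → i = j
  mem_iff : ∀ h, (∃ i, h ∈ strand i) ↔ rot h = h

namespace CharacterDiagram

variable {n : ℕ}

/-- Each string carries an external vertex (that is, `ε_i D = 0` for all `i`). -/
def IsNondegenerate (D : CharacterDiagram n) : Prop := ∀ i, D.strand i ≠ []

/-- `D` and `D'` are homeomorphic. -/
def Homeo (D D' : CharacterDiagram n) : Prop :=
  ∃ e : D.H ≃ D'.H,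
    (∀ h, D'.opp (e h) = e (D.opp h)) ∧
    (∀ h, D'.rot (e h) = e (D.rot h)) ∧
    ∀ i, D'.strand i = (D.strand i).map e

/-- `S`, `T`, `U` are as in the relation `S = T - U` (STU). In `T` the external vertices `b`, `c`
are consecutive in this order on the string `i`; `U` differs from `T` in their order. In `S` they
are replaced by one external vertex `s` on the string, joined by an edge `{s, a}` to a new trivalent
vertex with the cyclic order `(a, c, b)`. Here `s = g (Sum.inr false)` and
`a = g (Sum.inr true)`. -/
def STU (S T U : CharacterDiagram n) : Prop :=
  ∃ (f : T.H ≃ U.H) (g : T.H ⊕ Bool ≃ S.H) (i : Fin n) (L R : List T.H) (b c : T.H),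
    T.strand i = L ++ b :: c :: R ∧
    -- the diagram `U`
    (∀ h, U.opp (f h) = f (T.opp h)) ∧
    (∀ h, U.rot (f h) = f (T.rot h)) ∧
    U.strand i = (L ++ c :: b :: R).map f ∧
    (∀ j, j ≠ i → U.strand j = (T.strand j).map f) ∧
    -- the diagram `S`
    (∀ h, S.opp (g (Sum.inl h)) = g (Sum.inl (T.opp h))) ∧
    S.opp (g (Sum.inr false)) = g (Sum.inr true) ∧
    (∀ h, h ≠ b → h ≠ c → S.rot (g (Sum.inl h)) = g (Sum.inl (T.rot h))) ∧
    S.rot (g (Sum.inr false)) = g (Sum.inr false) ∧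
    S.rot (g (Sum.inr true)) = g (Sum.inl c) ∧
    S.rot (g (Sum.inl c)) = g (Sum.inl b) ∧
    S.rot (g (Sum.inl b)) = g (Sum.inr true) ∧
    S.strand i = L.map (fun h => g (Sum.inl h)) ++
      g (Sum.inr false) :: R.map (fun h => g (Sum.inl h)) ∧
    (∀ j, j ≠ i → S.strand j = (T.strand j).map (fun h => g (Sum.inl h)))

/-- The relations that define `𝓟 n`. -/
inductive Rel : (CharacterDiagram n →₀ ℚ) → Prop
  | homeo (D D' : CharacterDiagram n) (h : D.Homeo D') :
      Rel (Finsupp.single D 1 - Finsupp.single D' 1)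
  | stu (S T U : CharacterDiagram n) (h : STU S T U) :
      Rel (Finsupp.single S 1 - Finsupp.single T 1 + Finsupp.single U 1)

end CharacterDiagram

/-- The space `𝓑_n` of `n`-marked Chinese characters modulo antisymmetry and Jacobi. -/
abbrev SpaceB (n : ℕ) : Type 1 :=
  (MarkedCharacter n →₀ ℚ) ⧸ Submodule.span ℚ {x | MarkedCharacter.Rel (n := n) x}

/-- The space `𝓟_n` of Chinese character diagrams on `n` strings modulo STU. -/
abbrev SpaceP (n : ℕ) : Type 1 :=
  (CharacterDiagram n →₀ ℚ) ⧸ Submodule.span ℚ {x | CharacterDiagram.Rel (n := n) x}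

/-- The class of a marked Chinese character in `𝓑_n`. -/
def MarkedCharacter.toB {n : ℕ} (ξ : MarkedCharacter n) : SpaceB n :=
  Submodule.Quotient.mk (Finsupp.single ξ 1)

/-- The class of a Chinese character diagram in `𝓟_n`. -/
def CharacterDiagram.toP {n : ℕ} (D : CharacterDiagram n) : SpaceP n :=
  Submodule.Quotient.mk (Finsupp.single D 1)

/-- The integral lattice of `𝓑_n`. -/
def latticeB (n : ℕ) : Submodule ℤ (SpaceB n) :=
  Submodule.span ℤ (Set.range MarkedCharacter.toB)

/-- The integral lattice of `𝓟_n`. -/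
def latticeP (n : ℕ) : Submodule ℤ (SpaceP n) :=
  Submodule.span ℤ (Set.range CharacterDiagram.toP)

/-- The subspace `𝓕_n` of `𝓑_n` spanned by connected non-degenerate Chinese characters. -/
def spaceF (n : ℕ) : Submodule ℚ (SpaceB n) :=
  Submodule.span ℚ
    {x | ∃ ξ : MarkedCharacter n, ξ.IsConnected ∧ ξ.IsNondegenerate ∧ ξ.toB = x}

/-- The integral lattice of `𝓕_n`. -/
def latticeF (n : ℕ) : Submodule ℤ (SpaceB n) :=
  Submodule.span ℤ
    {x | ∃ ξ : MarkedCharacter n, ξ.IsConnected ∧ ξ.IsNondegenerate ∧ ξ.toB = x}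

/-- The subspace `𝓠_n` of `𝓟_n` spanned by g-connected non-degenerate diagrams. -/
def spaceQ (n : ℕ) : Submodule ℚ (SpaceP n) :=
  Submodule.span ℚ
    {x | ∃ D : CharacterDiagram n, D.IsConnected ∧ D.IsNondegenerate ∧ D.toP = x}

/-- The integral lattice of `𝓠_n`. -/
def latticeQ (n : ℕ) : Submodule ℤ (SpaceP n) :=
  Submodule.span ℤ
    {x | ∃ D : CharacterDiagram n, D.IsConnected ∧ D.IsNondegenerate ∧ D.toP = x}

/-- `x` has denominator `N` with respect to the lattice `L`. -/
def HasDenominator {V : Type*} [AddCommGroup V] (L : Submodule ℤ V) (N : ℕ) (x : V) : Prop :=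
  N • x ∈ L

namespace MarkedCharacter

variable {n : ℕ}

/-- The ways to put, for each `i`, the external vertices of colour `i` on the `i`-th string. -/
def Arrangement (ξ : MarkedCharacter n) : Type :=
  {s : Fin n → List ξ.H //
    ∀ i, (s i).Nodup ∧ ∀ h, h ∈ s i ↔ ∃ hh : ξ.rot h = h, ξ.color ⟨h, hh⟩ = i}

instance (ξ : MarkedCharacter n) : Finite ξ.Arrangement := by
  classical
  have := ξ.finite_H
  have := Fintype.ofFinite ξ.H
  let F : ξ.Arrangement → (Fin n → {l : List ξ.H // l.Nodup}) :=
    fun s i => ⟨s.1 i, (s.2 i).1⟩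
  refine Finite.of_injective F fun s t h => Subtype.ext (funext fun i => ?_)
  exact congrArg Subtype.val (congrFun h i)

instance (ξ : MarkedCharacter n) : Fintype ξ.Arrangement := Fintype.ofFinite _

/-- The diagram obtained by putting the external vertices on the strings. -/
def arrange (ξ : MarkedCharacter n) (s : ξ.Arrangement) : CharacterDiagram n where
  toChineseCharacter := ξ.toChineseCharacter
  strand := s.1
  nodup i := (s.2 i).1
  disjoint i j h hi hj := by
    obtain ⟨_, h1⟩ := ((s.2 i).2 h).1 hi
    obtain ⟨_, h2⟩ := ((s.2 j).2 h).1 hj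
    exact h1.symm.trans h2
  mem_iff h := by
    constructor
    · rintro ⟨i, hi⟩
      exact (((s.2 i).2 h).1 hi).1
    · intro hh
      exact ⟨ξ.color ⟨h, hh⟩, ((s.2 _).2 h).2 ⟨hh, rfl⟩⟩

/-- The average `(1 / (k₁! ⋯ kₙ!)) ∑ D` over the `k₁! ⋯ kₙ!` ways to put the external vertices
on the strings. -/
def average (ξ : MarkedCharacter n) : SpaceP n :=
  (∏ i, ((ξ.numColor i)! : ℚ))⁻¹ • ∑ s : ξ.Arrangement, (ξ.arrange s).toP

end MarkedCharacter

/-- `χ : 𝓑_n → 𝓟_n` is the linear map whose value at the class of each Chinese character `ξ` is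
`ξ.average`. There is at most one such map, since these classes span `𝓑_n`. -/
def IsChi {n : ℕ} (χ : SpaceB n →ₗ[ℚ] SpaceP n) : Prop :=
  ∀ ξ : MarkedCharacter n, χ ξ.toB = ξ.average

end

/-! The statement is a Poincaré–Birkhoff–Witt theorem for diagrams. Joining two legs by a trivalent
vertex is a Lie bracket, antisymmetry and IHX are its axioms, and STU says that the bracket is the
commutator of neighbouring legs on a string. So `symmetrization` is the analogue of the
symmetrization map from a symmetric algebra to an enveloping algebra.

It is well defined because antisymmetry and IHX hold for diagrams: a trivalent vertex next to a leg
can be resolved by STU, and after enough resolutions the relations become identities between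
commutators (`toP_add_toP`, `IsJacobi.toP_eq_zero`, `respectsB_average`). It is onto by induction on
the number of legs, since reordering the legs of a diagram changes it by diagrams with fewer legs
(`toP_mem_range`).

The inverse is written down explicitly. In an enveloping algebra, a product of elements of the Lie
algebra is a sum over set partitions, in which each block contributes the first Eulerian idempotent
of its letters; with a base letter `b` kept in front, the idempotent is a sum of left-normed
brackets of `b`, with the coefficient `(-1)^q p! q! / (p + q + 1)!` for `p` ascents and `q`
descents. `GlueSystem.total` implements this formula for legs labelled injectively. Two identities
for the coefficients suffice. By `eulerCoeff_sub`, turning an ascent into a descent costs the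
coefficient of the word with one letter less; with the Jacobi identity this gives STU
(`total_sub_total_swapPos`). By `sum_eulerCoeff_rotate`, the coefficients cancel over the rotations
of a word; so in an average over all orders only the term without brackets remains
(`sum_colorPerms_total`), which makes `desymm` a left inverse (`desymm_average`). The same
cancellation shows that the choice of the base letters is irrelevant, and this is proved together
with the interchange rule by one induction (`baseIndep_and_swap`).

Both maps have denominator `∏ kᵢ!`. For the symmetrization this is its definition; for the inverse,
`(p + q + 1)!` clears a coefficient and products of factorials divide factorials of sums
(`factorial_smul_word_mem`). This number divides `m!`, and if there are at least two colours and all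
occur it divides `[(m - 1)!]²` (`prod_factorial_dvd_sq`). For classes in `𝓕` and `𝓠` represented by
a bad character or diagram, the projection `projF`, which kills disconnected or degenerate
characters, shows that the class vanishes or moves the integral expression into the smaller lattice.
-/

noncomputable section

/-! ### Counting ascents and descents, and the Eulerian coefficients -/

open Classical in
/-- The number of consecutive pairs of entries of a list that satisfy `r`. -/
def consecCount (r : ℕ → ℕ → Prop) : List ℕ → ℕ
  | [] => 0
  | [_] => 0
  | x :: y :: l => (if r x y then 1 else 0) + consecCount r (y :: l)

open Classical in
theorem consecCount_eq_sum (r : ℕ → ℕ → Prop) (l : List ℕ) :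
    consecCount r l =
      ∑ i ∈ Finset.range (l.length - 1), if r (l.getD i 0) (l.getD (i + 1) 0) then 1 else 0 := by
  induction l with
  | nil => simp [consecCount]
  | cons x l ih =>
    cases l with
    | nil => simp [consecCount]
    | cons y l =>
      rw [consecCount, ih]
      simp only [List.length_cons, Nat.add_sub_cancel]
      rw [Finset.sum_range_succ', add_comm]
      simp only [List.getD_cons_succ, List.getD_cons_zero]

/-- The number of ascents of a list. -/
abbrev asc (l : List ℕ) : ℕ := consecCount (· < ·) l

/-- The number of descents of a list. -/
abbrev des (l : List ℕ) : ℕ := consecCount (fun x y => ¬ x < y) l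

/-- The coefficient in the first Eulerian idempotent of a permutation with `p` ascents and `q`
descents. -/
def eulerCoeff (p q : ℕ) : ℚ := (-1) ^ q * (p ! * q ! : ℚ) / ((p + q + 1)! : ℚ)

theorem eulerCoeff_zero : eulerCoeff 0 0 = 1 := by simp [eulerCoeff]

/-- This is the beta integral identity for `x ^ p * (1 - x) ^ q`, up to signs. It carries the STU
relation: two neighbouring letters in either order amount to a single letter. -/
theorem eulerCoeff_sub (p q : ℕ) :
    eulerCoeff (p + 1) q - eulerCoeff p (q + 1) = eulerCoeff p q := by
  unfold eulerCoeff
  have h1 : p + 1 + q + 1 = (p + q + 1) + 1 := by ring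
  have h2 : p + (q + 1) + 1 = (p + q + 1) + 1 := by ring
  rw [h1, h2, Nat.factorial_succ (p + q + 1), Nat.factorial_succ p, Nat.factorial_succ q, pow_succ]
  have : ((p + q + 1)! : ℚ) ≠ 0 := by positivity
  have : ((p : ℚ) + q + 1 + 1) ≠ 0 := by positivity
  push_cast
  field_simp
  ring

/-- A cyclic word with `p + 1` cyclic ascents and `q + 1` cyclic descents can be cut open at an
ascent in `p + 1` ways and at a descent in `q + 1` ways; the two contributions cancel. -/
theorem eulerCoeff_rotate (p q : ℕ) :
    ((p : ℚ) + 1) * eulerCoeff p (q + 1) + ((q : ℚ) + 1) * eulerCoeff (p + 1) q = 0 := by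
  unfold eulerCoeff
  have h1 : p + 1 + q + 1 = (p + q + 1) + 1 := by ring
  have h2 : p + (q + 1) + 1 = (p + q + 1) + 1 := by ring
  rw [h1, h2, Nat.factorial_succ (p + q + 1), Nat.factorial_succ p, Nat.factorial_succ q, pow_succ]
  have : ((p + q + 1)! : ℚ) ≠ 0 := by positivity
  have : ((p : ℚ) + q + 1 + 1) ≠ 0 := by positivity
  push_cast
  field_simp
  ring

theorem factorial_mul_eulerCoeff (p q : ℕ) :
    ((p + q + 1)! : ℚ) * eulerCoeff p q = (-1) ^ q * (p ! * q ! : ℚ) := by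
  unfold eulerCoeff
  have : ((p + q + 1)! : ℚ) ≠ 0 := by positivity
  field_simp

theorem sum_range_periodic_add {M : Type*} [AddCommMonoid M] {k : ℕ} (s : ℕ → M)
    (hs : ∀ i, s (i + k) = s i) (j : ℕ) :
    ∑ i ∈ Finset.range k, s (j + i) = ∑ i ∈ Finset.range k, s i := by
  induction j with
  | zero => simp
  | succ j ih =>
    rw [← ih]
    cases k with
    | zero => simp
    | succ k =>
      rw [Finset.sum_range_succ, Finset.sum_range_succ']
      have h : s (j + 1 + k) = s (j + 0) := by
        rw [add_zero, ← hs j]; congr 1; ring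
      rw [h]
      congr 1
      exact Finset.sum_congr rfl fun i _ => by congr 1; ring

/-- Each rotation loses exactly one of the cyclic ascents and descents, so `eulerCoeff_rotate`
applies as soon as both kinds occur, which is guaranteed by two distinct entries. -/
theorem sum_eulerCoeff_rotate (l : List ℕ) (hl : l.Nodup) (h2 : 2 ≤ l.length) :
    ∑ j ∈ Finset.range l.length,
      eulerCoeff (asc (l.rotate j)) (des (l.rotate j)) = 0 := by
  classical
  obtain ⟨k, hk⟩ : ∃ k, l.length = k + 1 := ⟨l.length - 1, by omega⟩
  -- The list is continued periodically, so that all its rotations are windows of one sequence. `P`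
  -- and `D` below are the numbers of cyclic ascents and descents, and `s (k + j)`, `t (k + j)`
  -- record which kind is lost by the `j`-th rotation.
  let a : ℕ → ℕ := fun i => l.getD (i % (k + 1)) 0
  have hper : ∀ i, a (i + (k + 1)) = a i := fun i => by simp [a]
  have hrot : ∀ j i, i < k + 1 → (l.rotate j).getD i 0 = a (j + i) := by
    intro j i hi
    have h1 : i < (l.rotate j).length := by simpa [hk] using hi
    have h3 : (j + i) % (k + 1) < l.length := by rw [hk]; exact Nat.mod_lt _ (by omega)
    simp only [a]
    rw [List.getD_eq_getElem _ _ h1, List.getD_eq_getElem _ _ h3, List.getElem_rotate]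
    congr 1
    rw [hk, add_comm]
  let s : ℕ → ℕ := fun i => if a i < a (i + 1) then 1 else 0
  let t : ℕ → ℕ := fun i => if ¬ a i < a (i + 1) then 1 else 0
  have hst : ∀ i, s i + t i = 1 := fun i => by simp only [s, t]; split_ifs <;> rfl
  have hsper : ∀ i, s (i + (k + 1)) = s i := fun i => by
    simp only [s]; rw [hper, show i + (k + 1) + 1 = i + 1 + (k + 1) by ring, hper]
  have htper : ∀ i, t (i + (k + 1)) = t i := fun i => by
    simp only [t]; rw [hper, show i + (k + 1) + 1 = i + 1 + (k + 1) by ring, hper]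
  have hasc : ∀ j, asc (l.rotate j) = ∑ i ∈ Finset.range k, s (j + i) := by
    intro j
    rw [asc, consecCount_eq_sum]
    simp only [List.length_rotate, hk, Nat.add_sub_cancel]
    refine Finset.sum_congr rfl fun i hi => ?_
    have := Finset.mem_range.1 hi
    rw [hrot j i (by omega), hrot j (i + 1) (by omega)]
    simp only [s, add_assoc]; congr
  have hdes : ∀ j, des (l.rotate j) = ∑ i ∈ Finset.range k, t (j + i) := by
    intro j
    rw [des, consecCount_eq_sum]
    simp only [List.length_rotate, hk, Nat.add_sub_cancel]
    refine Finset.sum_congr rfl fun i hi => ?_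
    have := Finset.mem_range.1 hi
    rw [hrot j i (by omega), hrot j (i + 1) (by omega)]
    simp only [t, add_assoc]; congr
  set P := ∑ i ∈ Finset.range (k + 1), s i with hP
  set D := ∑ i ∈ Finset.range (k + 1), t i with hD
  have hP' : ∀ j, asc (l.rotate j) + s (k + j) = P := fun j => by
    rw [hasc, hP, ← sum_range_periodic_add s hsper j, Finset.sum_range_succ, add_comm k j]
  have hD' : ∀ j, des (l.rotate j) + t (k + j) = D := fun j => by
    rw [hdes, hD, ← sum_range_periodic_add t htper j, Finset.sum_range_succ, add_comm k j]
  have ha01 : a 0 ≠ a 1 := by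
    simp only [a]
    rw [Nat.zero_mod, Nat.mod_eq_of_lt (by omega), List.getD_eq_getElem _ _ (by omega),
      List.getD_eq_getElem _ _ (by omega)]
    intro h
    exact absurd ((hl.getElem_inj_iff).1 h) (by omega)
  have hak : a (k + 1) = a 0 := by simpa using hper 0
  -- Without a cyclic ascent the periodic sequence would be antitone, hence constant, contrary to
  -- `ha01`. Without a cyclic descent it would be strictly increasing and periodic.
  have hPpos : P ≠ 0 := by
    intro h0
    have h1 : ∀ i, a (i + 1) ≤ a i := by
      intro i
      have h2 : ∀ i < k + 1, s i = 0 := fun i hi =>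
        Finset.sum_eq_zero_iff.1 (hP ▸ h0 : _ = 0) i (Finset.mem_range.2 hi)
      have h3 : s i = 0 := by
        have : s i = s (i % (k + 1)) := (Function.Periodic.map_mod_nat hsper i).symm
        rw [this]; exact h2 _ (Nat.mod_lt _ (by omega))
      by_contra hlt
      simp only [s] at h3
      rw [if_pos (by omega)] at h3
      omega
    have hanti : Antitone a := antitone_nat_of_succ_le h1
    have h4 := hanti (show 1 ≤ k + 1 by omega)
    have h5 := hanti (show 0 ≤ 1 by omega)
    omega
  have hDpos : D ≠ 0 := by
    intro h0
    have h1 : ∀ i, a i < a (i + 1) := by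
      intro i
      have h2 : ∀ i < k + 1, t i = 0 := fun i hi =>
        Finset.sum_eq_zero_iff.1 (hD ▸ h0 : _ = 0) i (Finset.mem_range.2 hi)
      have h3 : t i = 0 := by
        have : t i = t (i % (k + 1)) := (Function.Periodic.map_mod_nat htper i).symm
        rw [this]; exact h2 _ (Nat.mod_lt _ (by omega))
      by_contra hlt
      simp only [t] at h3
      rw [if_pos hlt] at h3
      omega
    have h4 := strictMono_nat_of_lt_succ h1 (show 0 < k + 1 by omega)
    omega
  have hterm : ∀ j, eulerCoeff (asc (l.rotate j)) (des (l.rotate j)) =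
      (s (k + j) : ℚ) * eulerCoeff (P - 1) D + (t (k + j) : ℚ) * eulerCoeff P (D - 1) := by
    intro j
    have h1 := hP' j
    have h2 := hD' j
    have h3 := hst (k + j)
    rcases Nat.eq_zero_or_pos (s (k + j)) with h | h
    · rw [h] at h1 h3
      rw [h, show t (k + j) = 1 by omega, show asc (l.rotate j) = P by omega,
        show des (l.rotate j) = D - 1 by omega]
      simp
    · rw [show t (k + j) = 0 by omega, show s (k + j) = 1 by omega,
        show asc (l.rotate j) = P - 1 by omega, show des (l.rotate j) = D by omega]
      simp
  rw [hk, Finset.sum_congr rfl fun j _ => hterm j, Finset.sum_add_distrib, ← Finset.sum_mul,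
    ← Finset.sum_mul, ← Nat.cast_sum, ← Nat.cast_sum, sum_range_periodic_add s hsper,
    sum_range_periodic_add t htper, ← hP, ← hD]
  obtain ⟨p, hp⟩ := Nat.exists_eq_succ_of_ne_zero hPpos
  obtain ⟨q, hq⟩ := Nat.exists_eq_succ_of_ne_zero hDpos
  rw [hp, hq]
  have := eulerCoeff_rotate p q
  push_cast
  simpa using this

/-! ### Systems of gluing operators -/

/-- A linear model of graphs with labelled legs: `glue b c` joins the legs labelled `b` and `c` by a
trivalent vertex whose third edge ends in a new leg labelled `b`, and `out` forgets the labels but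
remembers the colours. -/
structure GlueSystem (Λ C V B : Type*) [DecidableEq Λ] [AddCommGroup V] [Module ℚ V]
    [AddCommGroup B] [Module ℚ B] where
  glue : Λ → Λ → V →ₗ[ℚ] V
  relabel : Λ → Λ → V →ₗ[ℚ] V
  out : V →ₗ[ℚ] B
  color : Λ → C
  jacobi : ∀ b c d, b ≠ c → b ≠ d → c ≠ d → ∀ x,
    glue b d (glue b c x) - glue b c (glue b d x) = glue b c (glue c d x)
  comm : ∀ b c d e, b ≠ c → b ≠ d → b ≠ e → c ≠ d → c ≠ e → d ≠ e → ∀ x,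
    glue b c (glue d e x) = glue d e (glue b c x)
  antisymm : ∀ b c, b ≠ c → ∀ x, glue c b x = - relabel b c (glue b c x)
  relabel_glue : ∀ c d x y, c ≠ d → x ≠ y → ∀ v,
    relabel c d (glue x y v) = glue (Equiv.swap c d x) (Equiv.swap c d y) (relabel c d v)
  out_relabel : ∀ c d, c ≠ d → color c = color d → ∀ v, out (relabel c d v) = out v

namespace GlueSystem

variable {Λ C V B : Type*} [DecidableEq Λ] [AddCommGroup V] [Module ℚ V]
    [AddCommGroup B] [Module ℚ B] (𝔤 : GlueSystem Λ C V B) (pos : Λ → ℕ)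

open Classical in
/-- Auxiliary to `word` and `total`, with a bound for the depth of the recursion. -/
def wordAux : ℕ → Λ → ℕ → ℕ → ℕ → Finset Λ → V →ₗ[ℚ] B
  | 0, _, _, p, q, _ => eulerCoeff p q • 𝔤.out
  | n + 1, b, v, p, q, S => eulerCoeff p q •
      (if h : S.Nonempty then
        wordAux n h.choose (pos h.choose) 0 0 (S.erase h.choose) else 𝔤.out) +
      ∑ c ∈ S with 𝔤.color c = 𝔤.color b,
        wordAux n b (pos c) (if v < pos c then p + 1 else p) (if v < pos c then q else q + 1)
          (S.erase c) ∘ₗ 𝔤.glue b c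

/-- The part of the inverse symmetrization in which a bracket with the base leg `b` is under
construction: it has `p` ascents and `q` descents so far, and its last entry was at position `v`;
the legs in `S` are still to be used. -/
def word (b : Λ) (v p q : ℕ) (S : Finset Λ) : V →ₗ[ℚ] B := 𝔤.wordAux pos S.card b v p q S

/-- The inverse symmetrization of the legs in `S`, ordered by `pos`, where the bracket that contains
`b` is formed first and has `b` as its base. -/
def totalAt (b : Λ) (S : Finset Λ) : V →ₗ[ℚ] B := 𝔤.word pos b (pos b) 0 0 (S.erase b)

open Classical in
/-- The inverse symmetrization of the legs in `S`, ordered by `pos`. -/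
def total (S : Finset Λ) : V →ₗ[ℚ] B :=
  if h : S.Nonempty then 𝔤.totalAt pos h.choose S else 𝔤.out

theorem total_empty : 𝔤.total pos ∅ = 𝔤.out := by simp [total]

theorem exists_total_eq {S : Finset Λ} (h : S.Nonempty) :
    ∃ b ∈ S, ∀ pos, 𝔤.total pos S = 𝔤.totalAt pos b S :=
  ⟨h.choose, h.choose_spec, fun pos => by rw [total, dif_pos h]⟩

open Classical in
-- The recursion without its depth bound. Every step uses up one letter, so the bound `S.card` is
-- exact at every level: either the bracket is closed and a new base is chosen in `S`, or it is
-- continued by a letter `c` of the same colour.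
theorem word_apply (b : Λ) (v p q : ℕ) (S : Finset Λ) (x : V) :
    𝔤.word pos b v p q S x = eulerCoeff p q • 𝔤.total pos S x +
      ∑ c ∈ S with 𝔤.color c = 𝔤.color b,
        𝔤.word pos b (pos c) (if v < pos c then p + 1 else p) (if v < pos c then q else q + 1)
          (S.erase c) (𝔤.glue b c x) := by
  rcases S.eq_empty_or_nonempty with rfl | hS
  · simp [word, wordAux, total]
  · obtain ⟨n, hn⟩ : ∃ n, S.card = n + 1 := ⟨S.card - 1, by have := hS.card_pos; omega⟩
    have hc : ∀ c ∈ S, (S.erase c).card = n := fun c hc => by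
      rw [Finset.card_erase_of_mem hc]; omega
    rw [word, hn, wordAux]
    simp only [LinearMap.add_apply, LinearMap.smul_apply, LinearMap.sum_apply,
      LinearMap.comp_apply, dif_pos hS, total, totalAt, word]
    rw [hc _ hS.choose_spec]
    congr 1
    refine Finset.sum_congr rfl fun c hcS => ?_
    rw [hc c (Finset.mem_filter.1 hcS).1]

/-- Ascents and descents only accumulate, so `eulerCoeff_sub` passes from the coefficients to whole
words, one letter at a time. -/
theorem word_sub (b : Λ) (v p q : ℕ) (S : Finset Λ) (x : V) :
    𝔤.word pos b v (p + 1) q S x - 𝔤.word pos b v p (q + 1) S x = 𝔤.word pos b v p q S x := by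
  classical
  induction S using Finset.strongInduction generalizing v p q x with
  | H S ih =>
    rw [word_apply, word_apply, word_apply, add_sub_add_comm, ← sub_smul, eulerCoeff_sub,
      ← Finset.sum_sub_distrib]
    congr 1
    refine Finset.sum_congr rfl fun c hc => ?_
    have := Finset.erase_ssubset (Finset.mem_filter.1 hc).1
    split_ifs
    · exact ih _ this _ _ _ _
    · exact ih _ this _ _ _ _

variable {pos}

/-- Two positionings agree on the order of the legs of equal colour in `S`. -/
def SameOrder (pos pos' : Λ → ℕ) (S : Finset Λ) : Prop :=
  ∀ x ∈ S, ∀ y ∈ S, 𝔤.color x = 𝔤.color y → (pos x < pos y ↔ pos' x < pos' y)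

variable {𝔤}

theorem SameOrder.mono {pos' : Λ → ℕ} {S S' : Finset Λ} (h : 𝔤.SameOrder pos pos' S)
    (hS : S' ⊆ S) : 𝔤.SameOrder pos pos' S' :=
  fun x hx y hy => h x (hS hx) y (hS hy)

/-- Positions enter only through comparisons between legs of equal colour, because a bracket never
mixes colours. -/
theorem word_total_congr {pos' : Λ → ℕ} (S : Finset Λ) (h : 𝔤.SameOrder pos pos' S) :
    𝔤.total pos S = 𝔤.total pos' S ∧ ∀ (b : Λ) (v v' p q : ℕ),
      (∀ x ∈ S, 𝔤.color x = 𝔤.color b → (v < pos x ↔ v' < pos' x)) →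
      𝔤.word pos b v p q S = 𝔤.word pos' b v' p q S := by
  classical
  induction S using Finset.strongInduction with
  | H S ih =>
    have hT : 𝔤.total pos S = 𝔤.total pos' S := by
      rcases S.eq_empty_or_nonempty with rfl | hS
      · simp [total]
      · obtain ⟨b, hb, hbS⟩ := 𝔤.exists_total_eq hS
        rw [hbS, hbS, totalAt, totalAt]
        exact (ih _ (Finset.erase_ssubset hb) (h.mono (Finset.erase_subset _ _))).2 _ _ _ _ _
          fun x hx hxb => h b hb x (Finset.mem_of_mem_erase hx) hxb.symm
    refine ⟨hT, fun b v v' p q hv => ?_⟩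
    ext x
    rw [word_apply, word_apply, hT]
    congr 1
    refine Finset.sum_congr rfl fun c hc => ?_
    obtain ⟨hcS, hcb⟩ := Finset.mem_filter.1 hc
    simp only [hv c hcS hcb]
    rw [(ih _ (Finset.erase_ssubset hcS) (h.mono (Finset.erase_subset _ _))).2 _ _ (pos' c)]
    exact fun y hy hyb => h c hcS y (Finset.mem_of_mem_erase hy) (hcb.trans hyb.symm)

theorem total_congr {pos' : Λ → ℕ} {S : Finset Λ} (h : 𝔤.SameOrder pos pos' S) :
    𝔤.total pos S = 𝔤.total pos' S := (word_total_congr S h).1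

theorem word_congr {pos' : Λ → ℕ} {S : Finset Λ} (h : 𝔤.SameOrder pos pos' S) {b : Λ}
    {v v' p q : ℕ} (hv : ∀ x ∈ S, 𝔤.color x = 𝔤.color b → (v < pos x ↔ v' < pos' x)) :
    𝔤.word pos b v p q S = 𝔤.word pos' b v' p q S := (word_total_congr S h).2 _ _ _ _ _ hv

theorem totalAt_congr {pos' : Λ → ℕ} {S : Finset Λ} (h : 𝔤.SameOrder pos pos' S) {b : Λ}
    (hb : b ∈ S) : 𝔤.totalAt pos b S = 𝔤.totalAt pos' b S :=
  word_congr (h.mono (Finset.erase_subset _ _)) fun x hx hxb =>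
    h b hb x (Finset.mem_of_mem_erase hx) hxb.symm

/-! ### The sum over all orders -/

open Classical in
/-- A sum over all words of distinct letters of the colour of `b` in `S`. -/
def wordSum {M : Type*} [AddCommMonoid M] (𝔤 : GlueSystem Λ C V B) (b : Λ) :
    ℕ → Finset Λ → (List Λ → Finset Λ → M) → M
  | 0, S, f => f [] S
  | n + 1, S, f => f [] S +
      ∑ c ∈ S with 𝔤.color c = 𝔤.color b,
        wordSum 𝔤 b n (S.erase c) fun w R => f (c :: w) R

theorem sum_wordSum {M ι : Type*} [AddCommMonoid M] (s : Finset ι) (b : Λ) (n : ℕ)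
    (S : Finset Λ) (f : ι → List Λ → Finset Λ → M) :
    ∑ i ∈ s, wordSum 𝔤 b n S (f i) = wordSum 𝔤 b n S fun w R => ∑ i ∈ s, f i w R := by
  classical
  induction n generalizing S f with
  | zero => rfl
  | succ n ih =>
    simp only [wordSum, Finset.sum_add_distrib]
    congr 1
    rw [Finset.sum_comm]
    exact Finset.sum_congr rfl fun c _ => ih _ _

/-- `w` is a word of distinct letters of the colour of `b`, and `R` consists of the other letters
of `S`. -/
def IsWord (𝔤 : GlueSystem Λ C V B) (b : Λ) (S : Finset Λ) (w : List Λ) (R : Finset Λ) : Prop :=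
  w.Nodup ∧ (∀ x ∈ w, x ∈ S ∧ 𝔤.color x = 𝔤.color b) ∧ R ⊆ S ∧ ∀ x ∈ w, x ∉ R

theorem wordSum_eq_zero {M : Type*} [AddCommMonoid M] {b : Λ} {n : ℕ}
    {S : Finset Λ} {f : List Λ → Finset Λ → M} (h : ∀ w R, 𝔤.IsWord b S w R → f w R = 0) :
    wordSum 𝔤 b n S f = 0 := by
  classical
  induction n generalizing S f with
  | zero => exact h _ _ ⟨List.nodup_nil, by simp, subset_rfl, by simp⟩
  | succ n ih =>
    simp only [wordSum]
    rw [h _ _ ⟨List.nodup_nil, by simp, subset_rfl, by simp⟩, zero_add]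
    refine Finset.sum_eq_zero fun c hc => ih fun w R hw => h _ _ ?_
    obtain ⟨h1, h2, h3, h4⟩ := hw
    obtain ⟨hc1, hc2⟩ := Finset.mem_filter.1 hc
    refine ⟨List.nodup_cons.2 ⟨fun hcw => ?_, h1⟩, ?_, h3.trans (Finset.erase_subset _ _), ?_⟩
    · exact (Finset.mem_erase.1 (h2 c hcw).1).1 rfl
    · rintro x hx
      rcases List.mem_cons.1 hx with rfl | hx
      · exact ⟨hc1, hc2⟩
      · exact ⟨Finset.mem_of_mem_erase (h2 x hx).1, (h2 x hx).2⟩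
    · rintro x hx
      rcases List.mem_cons.1 hx with rfl | hx
      · exact fun hR => (Finset.mem_erase.1 (h3 hR)).1 rfl
      · exact h4 x hx

theorem wordSum_eq {M : Type*} [AddCommMonoid M] {b : Λ} {n : ℕ}
    {S : Finset Λ} {f : List Λ → Finset Λ → M}
    (h : ∀ w R, w ≠ [] → 𝔤.IsWord b S w R → f w R = 0) : wordSum 𝔤 b n S f = f [] S := by
  classical
  cases n with
  | zero => rfl
  | succ n =>
    have : wordSum 𝔤 b (n + 1) S f = f [] S +
        wordSum 𝔤 b (n + 1) S fun w R => if w = [] then 0 else f w R := by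
      simp [wordSum]
    rw [this, wordSum_eq_zero, add_zero]
    intro w R hw
    split_ifs with h0
    · rfl
    · exact h w R h0 hw

/-- The iterated bracket of the base leg `b` with the letters of a word. -/
def comb (𝔤 : GlueSystem Λ C V B) (b : Λ) : List Λ → V →ₗ[ℚ] V
  | [] => LinearMap.id
  | c :: w => comb 𝔤 b w ∘ₗ 𝔤.glue b c

/-- The form of `word` in which the coefficient is seen as a function of the whole bracket. It is
needed for the rotation argument, which moves the base as well. -/
theorem word_eq_wordSum (b : Λ) (v p q : ℕ) (S : Finset Λ) (x : V) :
    𝔤.word pos b v p q S x = wordSum 𝔤 b S.card S fun w R =>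
      eulerCoeff (p + asc (v :: w.map pos)) (q + des (v :: w.map pos)) •
        𝔤.total pos R (comb 𝔤 b w x) := by
  classical
  induction hn : S.card generalizing S v p q x with
  | zero =>
    obtain rfl := Finset.card_eq_zero.1 hn
    rw [word_apply]
    simp [wordSum, comb, consecCount]
  | succ n ih =>
    rw [word_apply]
    simp only [wordSum, comb, consecCount, List.map_nil, add_zero, LinearMap.id_apply]
    congr 1
    refine Finset.sum_congr rfl fun c hc => ?_
    have hcS := (Finset.mem_filter.1 hc).1
    rw [ih _ _ _ _ _ (by rw [Finset.card_erase_of_mem hcS]; omega)]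
    simp only [List.map_cons, consecCount, LinearMap.comp_apply]
    congr 1
    funext w R
    simp only [asc, des]
    congr 2 <;> split_ifs <;> omega

/-- Legs of equal colour have different positions. -/
def InjOnColors (𝔤 : GlueSystem Λ C V B) (pos : Λ → ℕ) : Prop :=
  ∀ x y, 𝔤.color x = 𝔤.color y → pos x = pos y → x = y

variable [Fintype Λ]

open Classical in
/-- The permutations of the labels that preserve the colours. -/
def colorPerms (𝔤 : GlueSystem Λ C V B) : Finset (Equiv.Perm Λ) :=
  Finset.univ.filter fun σ => ∀ x, 𝔤.color (σ x) = 𝔤.color x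

theorem mem_colorPerms {σ : Equiv.Perm Λ} :
    σ ∈ 𝔤.colorPerms ↔ ∀ x, 𝔤.color (σ x) = 𝔤.color x := by simp [colorPerms]

theorem sum_colorPerms_mul {M : Type*} [AddCommMonoid M] (f : Equiv.Perm Λ → M)
    {τ : Equiv.Perm Λ} (hτ : τ ∈ 𝔤.colorPerms) :
    ∑ σ ∈ 𝔤.colorPerms, f (σ * τ) = ∑ σ ∈ 𝔤.colorPerms, f σ := by
  refine Finset.sum_bij (fun σ _ => σ * τ) ?_ ?_ ?_ ?_
  · intro σ hσ
    rw [mem_colorPerms] at *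
    intro x
    rw [Equiv.Perm.mul_apply, hσ, hτ]
  · intro σ _ σ' _ h
    exact mul_right_cancel h
  · intro σ hσ
    refine ⟨σ * τ⁻¹, ?_, by simp⟩
    rw [mem_colorPerms] at *
    intro x
    rw [Equiv.Perm.mul_apply, hσ, ← hτ (τ⁻¹ x)]; simp
  · intros; rfl

/-- The cyclic permutation of the letters of `b :: w` preserves colours and fixes the letters of
`R`. So the sum can be averaged over its powers, and each of these averages is zero by
`sum_eulerCoeff_rotate`. -/
theorem sum_colorPerms_eulerCoeff (hpos : 𝔤.InjOnColors pos) {b : Λ} {S : Finset Λ} (hb : b ∉ S)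
    {w : List Λ} {R : Finset Λ} (hw0 : w ≠ []) (hw : 𝔤.IsWord b S w R) (y : V) :
    ∑ σ ∈ 𝔤.colorPerms, eulerCoeff (asc ((b :: w).map (pos ∘ σ))) (des ((b :: w).map (pos ∘ σ))) •
        𝔤.total (pos ∘ σ) R y = 0 := by
  classical
  obtain ⟨h1, h2, h3, h4⟩ := hw
  set u := b :: w with hu
  have hun : u.Nodup := List.nodup_cons.2 ⟨fun hbw => hb (h2 b hbw).1, h1⟩
  have huc : ∀ x ∈ u, 𝔤.color x = 𝔤.color b := by
    intro x hx
    rcases List.mem_cons.1 hx with rfl | hx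
    · rfl
    · exact (h2 x hx).2
  have huR : ∀ x ∈ R, x ∉ u := by
    intro x hx hxu
    rcases List.mem_cons.1 hxu with rfl | hxu
    · exact hb (h3 hx)
    · exact h4 x hxu hx
  have hlen : 2 ≤ u.length := by
    have := List.length_pos_iff.2 hw0
    simp only [hu, List.length_cons]; omega
  have hmap : ∀ j, u.map (u.formPerm ^ j : Equiv.Perm Λ) = u.rotate j := by
    intro j
    refine List.ext_getElem (by simp) fun i hi hi' => ?_
    rw [List.getElem_map, List.getElem_rotate, List.formPerm_pow_apply_getElem _ hun]
  have hmemK : ∀ j, (u.formPerm ^ j : Equiv.Perm Λ) ∈ 𝔤.colorPerms := by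
    intro j
    have h : u.formPerm ∈ 𝔤.colorPerms := by
      rw [mem_colorPerms]
      intro x
      by_cases hx : x ∈ u
      · rw [huc x hx, huc _ ((List.formPerm_mem_iff_mem).2 hx)]
      · rw [List.formPerm_apply_of_notMem hx]
    induction j with
    | zero => rw [mem_colorPerms]; simp
    | succ j ih =>
      rw [mem_colorPerms] at *
      intro x
      rw [pow_succ, Equiv.Perm.mul_apply, ih, h]
  set F : Equiv.Perm Λ → B := fun σ =>
    eulerCoeff (asc (u.map (pos ∘ σ))) (des (u.map (pos ∘ σ))) • 𝔤.total (pos ∘ σ) R y with hF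
  have hfix : ∀ j, ∀ x ∈ R, (u.formPerm ^ j : Equiv.Perm Λ) x = x := by
    intro j x hx
    exact Equiv.Perm.pow_apply_eq_self_of_apply_eq_self
      (List.formPerm_apply_of_notMem (huR x hx)) j
  have hFj : ∀ j σ, F (σ * u.formPerm ^ j) =
      eulerCoeff (asc ((u.map (pos ∘ σ)).rotate j)) (des ((u.map (pos ∘ σ)).rotate j)) •
        𝔤.total (pos ∘ σ) R y := by
    intro j σ
    have e1 : u.map (pos ∘ ⇑(σ * u.formPerm ^ j)) = (u.map (pos ∘ σ)).rotate j := by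
      rw [← List.map_rotate, ← hmap j, List.map_map]; rfl
    have e2 : 𝔤.total (pos ∘ ⇑(σ * u.formPerm ^ j)) R = 𝔤.total (pos ∘ σ) R := by
      refine total_congr fun x hx z hz _ => ?_
      simp only [Function.comp_apply, Equiv.Perm.mul_apply, hfix j x hx, hfix j z hz]
    simp only [hF, e1, e2]
  -- For fixed `σ` the sum over `j` is a sum over rotations. For fixed `j` the sum over `σ` is only
  -- reindexed, so the left side is also `u.length` times the sum in question.
  have hsum : ∑ j ∈ Finset.range u.length, ∑ σ ∈ 𝔤.colorPerms, F (σ * u.formPerm ^ j) = 0 := by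
    rw [Finset.sum_comm]
    refine Finset.sum_eq_zero fun σ hσ => ?_
    simp only [hFj]
    rw [← Finset.sum_smul]
    have hnd : (u.map (pos ∘ σ)).Nodup := by
      refine (List.nodup_map_iff_inj_on hun).2 fun x hx z hz hxz => ?_
      rw [mem_colorPerms] at hσ
      have := hpos (σ x) (σ z) (by rw [hσ, hσ, huc x hx, huc z hz]) hxz
      exact σ.injective this
    have := sum_eulerCoeff_rotate _ hnd (by simpa using hlen)
    rw [List.length_map] at this
    rw [this, zero_smul]
  simp only [sum_colorPerms_mul F (hmemK _), Finset.sum_const, Finset.card_range] at hsum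
  have hne : (u.length : ℚ) ≠ 0 := by
    have : u.length ≠ 0 := by omega
    exact_mod_cast this
  rw [← Nat.cast_smul_eq_nsmul ℚ] at hsum
  exact (smul_eq_zero.1 hsum).resolve_left hne

/-- All terms with a non-empty bracket cancel in the average over the orders. The remaining term has
the coefficient `eulerCoeff 0 0 = 1`, and induction removes the base. The value is the same for
every base, which later decides independence of the base. -/
theorem sum_colorPerms_total (hpos : 𝔤.InjOnColors pos) (S : Finset Λ) (x : V) :
    ∑ σ ∈ 𝔤.colorPerms, 𝔤.total (pos ∘ σ) S x = 𝔤.colorPerms.card • 𝔤.out x ∧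
    ∀ b ∈ S, ∑ σ ∈ 𝔤.colorPerms, 𝔤.totalAt (pos ∘ σ) b S x = 𝔤.colorPerms.card • 𝔤.out x := by
  induction S using Finset.strongInduction generalizing x with
  | H S ih =>
    have hAt : ∀ b ∈ S, ∑ σ ∈ 𝔤.colorPerms, 𝔤.totalAt (pos ∘ σ) b S x =
        𝔤.colorPerms.card • 𝔤.out x := by
      intro b hb
      rw [← (ih _ (Finset.erase_ssubset hb) x).1]
      simp only [totalAt, word_eq_wordSum]
      rw [sum_wordSum, wordSum_eq]
      · simp [comb, consecCount, eulerCoeff_zero]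
      · intro w R hw0 hw
        have := sum_colorPerms_eulerCoeff hpos (Finset.notMem_erase b S) hw0 hw (comb 𝔤 b w x)
        simpa using this
    refine ⟨?_, hAt⟩
    rcases S.eq_empty_or_nonempty with rfl | hS
    · simp [total_empty]
    · obtain ⟨b, hb, hbS⟩ := 𝔤.exists_total_eq hS
      simp only [hbS]
      exact hAt b hb

end GlueSystem

namespace GlueSystem

variable {Λ C V B : Type*} [DecidableEq Λ] [AddCommGroup V] [Module ℚ V]
    [AddCommGroup B] [Module ℚ B] {𝔤 : GlueSystem Λ C V B} {pos : Λ → ℕ}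

/-! ### Interchanging two adjacent legs -/

/-- `c` comes before `d`, and no other leg of the same colour in `S` lies between them. -/
structure Consecutive (𝔤 : GlueSystem Λ C V B) (pos : Λ → ℕ) (S : Finset Λ) (c d : Λ) : Prop where
  lt : pos c < pos d
  color_eq : 𝔤.color c = 𝔤.color d
  lt_iff : ∀ x ∈ S, 𝔤.color x = 𝔤.color c → x ≠ c → x ≠ d → (pos x < pos c ↔ pos x < pos d)
  gt_iff : ∀ x ∈ S, 𝔤.color x = 𝔤.color c → x ≠ c → x ≠ d → (pos c < pos x ↔ pos d < pos x)

theorem Consecutive.ne {S : Finset Λ} {c d : Λ} (h : 𝔤.Consecutive pos S c d) : c ≠ d := by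
  rintro rfl
  exact lt_irrefl _ h.lt

theorem Consecutive.mono {S S' : Finset Λ} {c d : Λ} (h : 𝔤.Consecutive pos S c d) (hS : S' ⊆ S) :
    𝔤.Consecutive pos S' c d :=
  ⟨h.lt, h.color_eq, fun x hx => h.lt_iff x (hS hx), fun x hx => h.gt_iff x (hS hx)⟩

/-- The positions after the interchange of `c` and `d`. -/
abbrev swapPos (pos : Λ → ℕ) (c d : Λ) : Λ → ℕ := pos ∘ Equiv.swap c d

theorem swapPos_left (c d : Λ) : swapPos pos c d c = pos d := by simp [swapPos]

theorem swapPos_right (c d : Λ) : swapPos pos c d d = pos c := by simp [swapPos]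

theorem swapPos_of_ne {c d x : Λ} (hc : x ≠ c) (hd : x ≠ d) : swapPos pos c d x = pos x := by
  simp [swapPos, Equiv.swap_apply_of_ne_of_ne hc hd]

theorem Consecutive.sameOrder_left {S : Finset Λ} {c d : Λ} (h : 𝔤.Consecutive pos S c d) :
    𝔤.SameOrder pos (swapPos pos c d) (S.erase c) := by
  intro x hx y hy hxy
  obtain ⟨hxc, hxS⟩ := Finset.mem_erase.1 hx
  obtain ⟨hyc, hyS⟩ := Finset.mem_erase.1 hy
  by_cases hxd : x = d
  · subst hxd
    by_cases hyd : y = x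
    · subst hyd; simp
    · rw [swapPos_right, swapPos_of_ne hyc hyd]
      exact (h.gt_iff y hyS (hxy.symm.trans h.color_eq.symm) hyc hyd).symm
  · rw [swapPos_of_ne hxc hxd]
    by_cases hyd : y = d
    · subst hyd
      rw [swapPos_right]
      exact (h.lt_iff x hxS (hxy.trans h.color_eq.symm) hxc hxd).symm
    · rw [swapPos_of_ne hyc hyd]

theorem Consecutive.sameOrder_right {S : Finset Λ} {c d : Λ} (h : 𝔤.Consecutive pos S c d) :
    𝔤.SameOrder pos (swapPos pos c d) (S.erase d) := by
  intro x hx y hy hxy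
  obtain ⟨hxd, hxS⟩ := Finset.mem_erase.1 hx
  obtain ⟨hyd, hyS⟩ := Finset.mem_erase.1 hy
  by_cases hxc : x = c
  · subst hxc
    by_cases hyc : y = x
    · subst hyc; simp
    · rw [swapPos_left, swapPos_of_ne hyc hyd]
      exact h.gt_iff y hyS hxy.symm hyc hyd
  · rw [swapPos_of_ne hxc hxd]
    by_cases hyc : y = c
    · subst hyc
      rw [swapPos_left]
      exact h.lt_iff x hxS hxy hxc hxd
    · rw [swapPos_of_ne hyc hyd]

theorem InjOnColors.swapPos (hpos : 𝔤.InjOnColors pos) {c d : Λ} (h : 𝔤.color c = 𝔤.color d) :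
    𝔤.InjOnColors (swapPos pos c d) := by
  intro x y hxy h'
  have hcol : ∀ x, 𝔤.color (Equiv.swap c d x) = 𝔤.color x := by
    intro x
    rw [Equiv.swap_apply_def]
    split_ifs with h1 h2
    · rw [h1, h]
    · rw [h2, h]
    · rfl
  exact (Equiv.swap c d).injective (hpos _ _ (by rw [hcol, hcol, hxy]) h')

/-- Two words that only differ by the place of their next letter `d`. -/
theorem word_sub_word {pos' : Λ → ℕ} {R : Finset Λ} {b d : Λ} {u u' p q : ℕ} (hd : d ∈ R)
    (hdb : 𝔤.color d = 𝔤.color b) (hR : 𝔤.SameOrder pos pos' R) (hu : u < pos d)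
    (hu' : ¬ u' < pos' d)
    (he : ∀ e ∈ R, e ≠ d → 𝔤.color e = 𝔤.color b → (u < pos e ↔ u' < pos' e)) (y : V) :
    𝔤.word pos b u p q R y - 𝔤.word pos' b u' p q R y =
      𝔤.word pos b (pos d) p q (R.erase d) (𝔤.glue b d y) := by
  classical
  have hF : d ∈ R.filter fun c => 𝔤.color c = 𝔤.color b := Finset.mem_filter.2 ⟨hd, hdb⟩
  -- The terms with an empty continuation or a next letter other than `d` agree. The next letter `d`
  -- is an ascent on one side and a descent on the other, and `word_sub` merges these two terms.
  rw [word_apply, word_apply, total_congr hR, add_sub_add_left_eq_sub,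
    ← Finset.add_sum_erase _ _ hF, ← Finset.add_sum_erase _ _ hF]
  have hrest : ∀ e ∈ R, e ≠ d → 𝔤.color e = 𝔤.color b → ∀ p q,
      𝔤.word pos b (pos e) p q (R.erase e) = 𝔤.word pos' b (pos' e) p q (R.erase e) := by
    intro e he hed heb p q
    refine word_congr (hR.mono (Finset.erase_subset _ _)) fun x hx hxb => ?_
    exact hR e he x (Finset.mem_of_mem_erase hx) (heb.trans hxb.symm)
  rw [Finset.sum_congr rfl (g := fun c => (𝔤.word pos' b (pos' c) (if u' < pos' c then p + 1 else p)
    (if u' < pos' c then q else q + 1) (R.erase c)) ((𝔤.glue b c) y))]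
  · rw [add_sub_add_right_eq_sub, if_pos hu, if_pos hu, if_neg hu', if_neg hu',
      ← word_congr (hR.mono (Finset.erase_subset _ _)) (v := pos d), word_sub]
    intro x hx hxb
    exact hR d hd x (Finset.mem_of_mem_erase hx) (hdb.trans hxb.symm)
  · intro e heF
    obtain ⟨hed, heF⟩ := Finset.mem_erase.1 heF
    obtain ⟨heR, heb⟩ := Finset.mem_filter.1 heF
    simp only [he e heR hed heb]
    rw [hrest e heR hed heb]

/-- The interchange rule for `total` on `S`. -/
def SwapTotal (𝔤 : GlueSystem Λ C V B) (S : Finset Λ) : Prop :=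
  ∀ pos c d, 𝔤.InjOnColors pos → c ∈ S → d ∈ S → 𝔤.Consecutive pos S c d → ∀ x,
    𝔤.total pos S x - 𝔤.total (swapPos pos c d) S x = 𝔤.total pos (S.erase d) (𝔤.glue c d x)

/-- The interchange rule for `word` on `S`. -/
def SwapWord (𝔤 : GlueSystem Λ C V B) (S : Finset Λ) : Prop :=
  ∀ pos b v p q c d, 𝔤.InjOnColors pos → b ∉ S → c ∈ S → d ∈ S → 𝔤.Consecutive pos S c d →
    (𝔤.color c = 𝔤.color b → (v < pos c ↔ v < pos d)) → ∀ x,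
    𝔤.word pos b v p q S x - 𝔤.word (swapPos pos c d) b v p q S x =
      𝔤.word pos b v p q (S.erase d) (𝔤.glue c d x)

/-- `totalAt` does not depend on the base. -/
def BaseIndep (𝔤 : GlueSystem Λ C V B) (S : Finset Λ) : Prop :=
  ∀ pos, 𝔤.InjOnColors pos → ∀ b ∈ S, ∀ b' ∈ S, 𝔤.totalAt pos b S = 𝔤.totalAt pos b' S

theorem BaseIndep.total_eq {S : Finset Λ} (h : 𝔤.BaseIndep S) (hpos : 𝔤.InjOnColors pos) {b : Λ}
    (hb : b ∈ S) : 𝔤.total pos S = 𝔤.totalAt pos b S := by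
  obtain ⟨b', hb', h'⟩ := 𝔤.exists_total_eq ⟨b, hb⟩
  rw [h', h pos hpos b hb b' hb']

/-- If the next letter is not `c` or `d`, induction applies, since `glue b e` and `glue c d` act on
disjoint legs. If it is `c` or `d`, the two orders differ only where the other of the two follows
immediately. The two terms that survive are `[[b, c], d]` and `[[b, d], c]`, and their difference is
`[b, [c, d]]` by the Jacobi identity. -/
theorem swapWord_of_swapTotal {S : Finset Λ} (hT : 𝔤.SwapTotal S)
    (ih : ∀ e ∈ S, 𝔤.SwapWord (S.erase e)) : 𝔤.SwapWord S := by
  classical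
  intro pos b v p q c d hpos hb hc hd hcd hv x
  have hcne := hcd.ne
  have hbc : b ≠ c := fun h => hb (h ▸ hc)
  have hbd : b ≠ d := fun h => hb (h ▸ hd)
  rw [word_apply, word_apply, word_apply, add_sub_add_comm, ← smul_sub, hT pos c d hpos hc hd hcd]
  congr 1
  -- the letters other than `c` and `d`
  have hother : ∀ e ∈ S, e ≠ c → e ≠ d → 𝔤.color e = 𝔤.color b → ∀ p q,
      𝔤.word pos b (pos e) p q (S.erase e) (𝔤.glue b e x) -
        𝔤.word (swapPos pos c d) b (swapPos pos c d e) p q (S.erase e) (𝔤.glue b e x) =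
      𝔤.word pos b (pos e) p q ((S.erase d).erase e) (𝔤.glue b e (𝔤.glue c d x)) := by
    intro e he hec hed heb p q
    rw [swapPos_of_ne hec hed, ih e he pos b (pos e) p q c d hpos
      (fun h => hb (Finset.mem_of_mem_erase h)) (Finset.mem_erase.2 ⟨hec.symm, hc⟩)
      (Finset.mem_erase.2 ⟨hed.symm, hd⟩) (hcd.mono (Finset.erase_subset _ _)),
      Finset.erase_right_comm, 𝔤.comm c d b e hcne hbc.symm hec.symm hbd.symm hed.symm
      (fun h => hb (h ▸ he))]
    intro hcb
    exact hcd.lt_iff e he (heb.trans hcb.symm) hec hed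
  set F := S.filter fun e => 𝔤.color e = 𝔤.color b with hF
  set F' := (S.erase d).filter fun e => 𝔤.color e = 𝔤.color b with hF'
  have hterm : ∀ e ∈ F, e ≠ c → e ≠ d →
      𝔤.word pos b (pos e) (if v < pos e then p + 1 else p) (if v < pos e then q else q + 1)
          (S.erase e) (𝔤.glue b e x) -
        𝔤.word (swapPos pos c d) b (swapPos pos c d e)
          (if v < swapPos pos c d e then p + 1 else p)
          (if v < swapPos pos c d e then q else q + 1) (S.erase e) (𝔤.glue b e x) =
      𝔤.word pos b (pos e) (if v < pos e then p + 1 else p) (if v < pos e then q else q + 1)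
        ((S.erase d).erase e) (𝔤.glue b e (𝔤.glue c d x)) := by
    intro e heF hec hed
    obtain ⟨heS, heb⟩ := Finset.mem_filter.1 heF
    rw [← hother e heS hec hed heb, swapPos_of_ne hec hed]
  by_cases hcb : 𝔤.color c = 𝔤.color b
  · have hdb : 𝔤.color d = 𝔤.color b := hcd.color_eq.symm.trans hcb
    have hcF : c ∈ F := Finset.mem_filter.2 ⟨hc, hcb⟩
    have hdF : d ∈ F.erase c := Finset.mem_erase.2 ⟨hcne.symm, Finset.mem_filter.2 ⟨hd, hdb⟩⟩
    have hcF' : c ∈ F' := Finset.mem_filter.2 ⟨Finset.mem_erase.2 ⟨hcne, hc⟩, hcb⟩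
    have hG : F'.erase c = (F.erase c).erase d := by
      ext e
      simp only [hF, hF', Finset.mem_erase, Finset.mem_filter]
      tauto
    rw [← Finset.add_sum_erase _ _ hcF, ← Finset.add_sum_erase _ _ hcF,
      ← Finset.add_sum_erase _ _ hdF, ← Finset.add_sum_erase _ _ hdF,
      ← Finset.add_sum_erase _ _ hcF', hG]
    have hsum := Finset.sum_sub_distrib
      (s := (F.erase c).erase d)
      (f := fun e => 𝔤.word pos b (pos e) (if v < pos e then p + 1 else p)
        (if v < pos e then q else q + 1) (S.erase e) (𝔤.glue b e x))
      (g := fun e => 𝔤.word (swapPos pos c d) b (swapPos pos c d e)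
          (if v < swapPos pos c d e then p + 1 else p)
          (if v < swapPos pos c d e then q else q + 1) (S.erase e) (𝔤.glue b e x))
    rw [Finset.sum_congr rfl fun e he => hterm e
      (Finset.mem_of_mem_erase (Finset.mem_of_mem_erase he))
      (Finset.mem_erase.1 (Finset.mem_of_mem_erase he)).1 (Finset.mem_erase.1 he).1] at hsum
    rw [hsum]
    have hp : (if v < pos d then p + 1 else p) = if v < pos c then p + 1 else p := by
      simp only [hv hcb]
    have hq : (if v < pos d then q else q + 1) = if v < pos c then q else q + 1 := by
      simp only [hv hcb]
    rw [swapPos_left, swapPos_right, hp, hq]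
    generalize (if v < pos c then p + 1 else p) = p'
    generalize (if v < pos c then q else q + 1) = q'
    have hcomm : (S.erase d).erase c = (S.erase c).erase d := Finset.erase_right_comm
    have hcong : ∀ y, 𝔤.word pos b (pos d) p' q' ((S.erase c).erase d) y =
        𝔤.word pos b (pos c) p' q' ((S.erase c).erase d) y := by
      intro y
      rw [word_congr (fun _ _ _ _ _ => Iff.rfl)]
      intro e he heb
      obtain ⟨hed, he⟩ := Finset.mem_erase.1 he
      obtain ⟨hec, he⟩ := Finset.mem_erase.1 he
      exact (hcd.gt_iff e he (heb.trans hcb.symm) hec hed).symm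
    -- Words beginning with `c`, in the two orders: what remains is the part that continues with
    -- `d`.
    have h1 := word_sub_word (pos := pos) (pos' := swapPos pos c d) (R := S.erase c) (b := b)
      (d := d) (u := pos c) (u' := pos d) (p := p') (q := q')
      (Finset.mem_erase.2 ⟨hcne.symm, hd⟩) hdb hcd.sameOrder_left hcd.lt
      (by rw [swapPos_right]; exact not_lt.2 hcd.lt.le)
      (by
        intro e he hed heb
        obtain ⟨hec, heS⟩ := Finset.mem_erase.1 he
        rw [swapPos_of_ne hec hed]
        exact hcd.gt_iff e heS (heb.trans hcb.symm) hec hed) (𝔤.glue b c x)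
    -- Words beginning with `d`: here it is the interchanged order in which the next letter `c` is
    -- an ascent, so the roles of the two positionings are exchanged.
    have h2 := word_sub_word (pos := swapPos pos c d) (pos' := pos) (R := S.erase d) (b := b)
      (d := c) (u := pos c) (u' := pos d) (p := p') (q := q')
      (Finset.mem_erase.2 ⟨hcne, hc⟩) hcb
      (fun y hy z hz hyz => (hcd.sameOrder_right y hy z hz hyz).symm)
      (by rw [swapPos_left]; exact hcd.lt)
      (not_lt.2 hcd.lt.le)
      (by
        intro e he hec heb
        obtain ⟨hed, heS⟩ := Finset.mem_erase.1 he
        rw [swapPos_of_ne hec hed]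
        exact hcd.gt_iff e heS (heb.trans hcb.symm) hec hed) (𝔤.glue b d x)
    have h3 : 𝔤.word (swapPos pos c d) b (swapPos pos c d c) p' q' ((S.erase d).erase c)
        (𝔤.glue b c (𝔤.glue b d x)) =
        𝔤.word pos b (pos d) p' q' ((S.erase c).erase d) (𝔤.glue b c (𝔤.glue b d x)) := by
      rw [hcomm, swapPos_left, word_congr]
      · exact fun y hy z hz hyz => (hcd.sameOrder_left y (Finset.mem_of_mem_erase hy) z
          (Finset.mem_of_mem_erase hz) hyz).symm
      · intro e he _
        obtain ⟨hed, he⟩ := Finset.mem_erase.1 he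
        obtain ⟨hec, he⟩ := Finset.mem_erase.1 he
        rw [swapPos_of_ne hec hed]
    rw [h3, hcong] at h2
    rw [hcong] at h1
    rw [hcomm, ← 𝔤.jacobi b c d hbc hbd hcne, map_sub, ← h1, ← h2]
    abel
  · have hFF : F' = F := by
      ext e
      simp only [hF, hF', Finset.mem_erase, Finset.mem_filter]
      refine ⟨fun h => ⟨h.1.2, h.2⟩, fun h => ⟨⟨?_, h.1⟩, h.2⟩⟩
      rintro rfl
      exact hcb (hcd.color_eq.trans h.2)
    rw [hFF, ← Finset.sum_sub_distrib]
    refine Finset.sum_congr rfl fun e he => hterm e he ?_ ?_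
    · rintro rfl
      exact hcb (Finset.mem_filter.1 he).2
    · rintro rfl
      exact hcb (hcd.color_eq.trans (Finset.mem_filter.1 he).2)

/-! ### Naturality -/

/-- A map of systems over an injection of the labels, given by `f` and `ρ`, is compatible with
`total` as soon as `total` does not depend on the choice of bases in the target. -/
theorem total_map {Λ' V' : Type*} [DecidableEq Λ'] [AddCommGroup V'] [Module ℚ V']
    {𝔤' : GlueSystem Λ' C V' B} (f : Λ ↪ Λ') (ρ : V → V')
    (hglue : ∀ b c, b ≠ c → ∀ x, 𝔤'.glue (f b) (f c) (ρ x) = ρ (𝔤.glue b c x))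
    (hout : ∀ x, 𝔤'.out (ρ x) = 𝔤.out x) (hcolor : ∀ x, 𝔤'.color (f x) = 𝔤.color x)
    {pos' : Λ' → ℕ} (hpos : 𝔤'.InjOnColors pos') (S : Finset Λ)
    (hbase : ∀ S' ⊆ S.map f, 𝔤'.BaseIndep S') :
    (∀ x, 𝔤'.total pos' (S.map f) (ρ x) = 𝔤.total (pos' ∘ f) S x) ∧
    ∀ b v p q x, b ∉ S →
      𝔤'.word pos' (f b) v p q (S.map f) (ρ x) = 𝔤.word (pos' ∘ f) b v p q S x := by
  classical
  induction S using Finset.strongInduction with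
  | H S ih =>
    have hT : ∀ x, 𝔤'.total pos' (S.map f) (ρ x) = 𝔤.total (pos' ∘ f) S x := by
      intro x
      rcases S.eq_empty_or_nonempty with rfl | hS
      · rw [Finset.map_empty, total_empty, total_empty, hout]
      · obtain ⟨b, hb, hbS⟩ := 𝔤.exists_total_eq hS
        rw [hbS, (hbase _ subset_rfl).total_eq hpos (Finset.mem_map_of_mem f hb), totalAt, totalAt,
          ← Finset.map_erase]
        exact (ih _ (Finset.erase_ssubset hb) fun S' hS' =>
          hbase S' (hS'.trans (Finset.map_subset_map.2 (Finset.erase_subset _ _)))).2 _ _ _ _ _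
            (Finset.notMem_erase _ _)
    refine ⟨hT, fun b v p q x hb => ?_⟩
    rw [word_apply, word_apply, hT, Finset.filter_map, Finset.sum_map]
    simp only [Function.comp_def, hcolor]
    congr 1
    refine Finset.sum_congr rfl fun c hc => ?_
    have hcS := (Finset.mem_filter.1 hc).1
    have hbc : b ≠ c := fun h => hb (h ▸ hcS)
    rw [hglue b c hbc, ← Finset.map_erase]
    exact (ih _ (Finset.erase_ssubset hcS) fun S' hS' =>
        hbase S' (hS'.trans (Finset.map_subset_map.2 (Finset.erase_subset _ _)))).2 _ _ _ _ _
          fun h => hb (Finset.mem_of_mem_erase h)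

theorem total_relabel {c d : Λ} (hcd : c ≠ d) (hcol : 𝔤.color c = 𝔤.color d)
    (hpos : 𝔤.InjOnColors pos) (S : Finset Λ)
    (hbase : ∀ S' ⊆ S.map (Equiv.swap c d).toEmbedding, 𝔤.BaseIndep S') (x : V) :
    𝔤.total pos (S.map (Equiv.swap c d).toEmbedding) (𝔤.relabel c d x) =
      𝔤.total (swapPos pos c d) S x := by
  refine (total_map (𝔤 := 𝔤) (𝔤' := 𝔤) (Equiv.swap c d).toEmbedding (𝔤.relabel c d) ?_ ?_ ?_ hpos S
    hbase).1 x
  · intro a b hab x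
    exact (𝔤.relabel_glue c d a b hcd hab x).symm
  · exact 𝔤.out_relabel c d hcd hcol
  · intro a
    simp only [Equiv.coe_toEmbedding, Equiv.swap_apply_def]
    split_ifs with h1 h2
    · rw [h1, hcol]
    · rw [h2, hcol]
    · rfl

/-- The interchange rule for `totalAt` on `S`. -/
def SwapTotalAt (𝔤 : GlueSystem Λ C V B) (S : Finset Λ) : Prop :=
  ∀ b ∈ S, ∀ pos c d, 𝔤.InjOnColors pos → c ∈ S → d ∈ S → 𝔤.Consecutive pos S c d → ∀ x,
    𝔤.totalAt pos b S x - 𝔤.totalAt (swapPos pos c d) b S x =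
      𝔤.total pos (S.erase d) (𝔤.glue c d x)

/-- The base counts as the first entry of its word, so with base `c` the two orders differ exactly
in the words where `d` comes directly after the base. -/
theorem totalAt_swap_left {S : Finset Λ} {c d : Λ} (hpos : 𝔤.InjOnColors pos) (hc : c ∈ S)
    (hd : d ∈ S) (hcd : 𝔤.Consecutive pos S c d) (hbase : 𝔤.BaseIndep (S.erase d)) (x : V) :
    𝔤.totalAt pos c S x - 𝔤.totalAt (swapPos pos c d) c S x =
      𝔤.total pos (S.erase d) (𝔤.glue c d x) := by
  have hcne := hcd.ne
  rw [hbase.total_eq hpos (Finset.mem_erase.2 ⟨hcne, hc⟩), totalAt, totalAt, totalAt, swapPos_left,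
    Finset.erase_right_comm (a := d)]
  have h1 := word_sub_word (pos := pos) (pos' := swapPos pos c d) (R := S.erase c) (b := c)
      (d := d) (u := pos c) (u' := pos d) (p := 0) (q := 0)
      (Finset.mem_erase.2 ⟨hcne.symm, hd⟩) hcd.color_eq.symm hcd.sameOrder_left hcd.lt
      (by rw [swapPos_right]; exact not_lt.2 hcd.lt.le)
      (by
        intro e he hed heb
        obtain ⟨hec, heS⟩ := Finset.mem_erase.1 he
        rw [swapPos_of_ne hec hed]
        exact hcd.gt_iff e heS heb hec hed) x
  rw [h1, word_congr (fun _ _ _ _ _ => Iff.rfl)]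
  intro e he heb
  obtain ⟨hed, he⟩ := Finset.mem_erase.1 he
  obtain ⟨hec, he⟩ := Finset.mem_erase.1 he
  exact (hcd.gt_iff e he heb hec hed).symm

theorem map_swap_erase {S : Finset Λ} {c d : Λ} (hc : c ∈ S) (hd : d ∈ S) :
    (S.erase d).map (Equiv.swap c d).toEmbedding = S.erase c := by
  ext x
  simp only [Finset.mem_map_equiv, Finset.mem_erase, Equiv.symm_swap]
  rw [Equiv.swap_apply_def]
  split_ifs with h1 h2
  · subst h1; simp
  · subst h2; simp [hc, hd, eq_comm]
  · simp [h1, h2]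

theorem swapPos_swapPos (c d : Λ) : swapPos (swapPos pos c d) c d = pos := by
  funext x; simp [swapPos]

/-- On the smaller set `S.erase d` the base is already known to be irrelevant and can be chosen to
fit `b`. If `b` is neither `c` nor `d`, the rule for words applies. The base `d` is reduced to the
base `c` by exchanging the roles of the two legs, at the cost of a sign from antisymmetry. -/
theorem swapTotalAt_of_ssubset {S : Finset Λ} (hW : ∀ b ∈ S, 𝔤.SwapWord (S.erase b))
    (hbase : ∀ S' ⊂ S, 𝔤.BaseIndep S') : 𝔤.SwapTotalAt S := by
  intro b hb pos c d hpos hc hd hcd x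
  have hcne := hcd.ne
  by_cases hbc : b = c
  · subst hbc
    exact totalAt_swap_left hpos hb hd hcd (hbase _ (Finset.erase_ssubset hd)) x
  by_cases hbd : b = d
  · subst hbd
    have hsw := hpos.swapPos hcd.color_eq
    have hpp : swapPos (swapPos pos c b) b c = pos := by
      funext x; simp [swapPos, Equiv.swap_comm b c]
    have h := totalAt_swap_left (pos := swapPos pos c b) (c := b) (d := c) hsw hd hc
      ⟨by rw [swapPos_left, swapPos_right]; exact hcd.lt, hcd.color_eq.symm,
        fun x hx hxb hxb' hxc => by
          rw [swapPos_of_ne hxc hxb', swapPos_left, swapPos_right]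
          exact hcd.lt_iff x hx (hxb.trans hcd.color_eq.symm) hxc hxb',
        fun x hx hxb hxb' hxc => by
          rw [swapPos_of_ne hxc hxb', swapPos_left, swapPos_right]
          exact hcd.gt_iff x hx (hxb.trans hcd.color_eq.symm) hxc hxb'⟩
      (hbase _ (Finset.erase_ssubset hc)) x
    rw [hpp, 𝔤.antisymm c b hcne, map_neg, ← map_swap_erase hc hd,
      total_relabel hcne hcd.color_eq hsw _ (fun S' hS' => hbase _ ?_), swapPos_swapPos] at h
    · rw [← neg_sub, h, neg_neg]
    · rw [map_swap_erase hc hd] at hS'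
      exact lt_of_le_of_lt hS' (Finset.erase_ssubset hc)
  · have h1 : b ∈ S.erase d := Finset.mem_erase.2 ⟨hbd, hb⟩
    rw [(hbase _ (Finset.erase_ssubset hd)).total_eq hpos h1, totalAt, totalAt, totalAt,
      swapPos_of_ne hbc hbd, Finset.erase_right_comm (a := d)]
    exact hW b hb pos b (pos b) 0 0 c d hpos (Finset.notMem_erase _ _)
      (Finset.mem_erase.2 ⟨Ne.symm hbc, hc⟩) (Finset.mem_erase.2 ⟨Ne.symm hbd, hd⟩)
      (hcd.mono (Finset.erase_subset _ _))
      (fun h => hcd.lt_iff b hb h.symm hbc hbd) x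

/-! ### Independence of the base -/

variable [Fintype Λ]

/-- A colour-preserving permutation is a product of transpositions of equally coloured labels:
multiplying by the transposition of `x` and `σ⁻¹ x` shrinks the support of `σ⁻¹`. -/
theorem colorPerms_induction {M : Type*} (f : Equiv.Perm Λ → M)
    (h : ∀ σ ∈ 𝔤.colorPerms, ∀ c d, c ≠ d → 𝔤.color c = 𝔤.color d →
      f (σ * Equiv.swap c d) = f σ)
    {σ : Equiv.Perm Λ} (hσ : σ ∈ 𝔤.colorPerms) : f σ = f 1 := by
  induction hn : σ⁻¹.support.card using Nat.strong_induction_on generalizing σ with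
  | _ n ih =>
    by_cases h1 : σ⁻¹ = 1
    · rw [inv_eq_one.1 h1]
    · obtain ⟨x, hx⟩ : ∃ x, σ⁻¹ x ≠ x := by
        by_contra! hx
        exact h1 (Equiv.ext hx)
      have hcol : 𝔤.color (σ⁻¹ x) = 𝔤.color x := by
        rw [mem_colorPerms] at hσ
        rw [← hσ (σ⁻¹ x)]; simp
      rw [← h σ hσ x (σ⁻¹ x) (Ne.symm hx) hcol.symm]
      refine ih _ ?_ ?_ rfl
      · rw [← hn, mul_inv_rev, Equiv.swap_inv]
        exact Equiv.Perm.card_support_swap_mul hx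
      · rw [mem_colorPerms] at *
        intro y
        rw [Equiv.Perm.mul_apply, hσ, Equiv.swap_apply_def]
        split_ifs with h2 h3
        · rw [h2, hcol]
        · rw [h3, hcol]
        · rfl

/-- An interchange of neighbours changes `totalAt` by an amount that does not involve the base. So
the difference `Δ` for two bases is the same for all orders of the legs. It therefore equals its
average over the orders, which is zero by `sum_colorPerms_total`. -/
theorem baseIndep_of_swapTotalAt {S : Finset Λ} (hS : 𝔤.SwapTotalAt S) : 𝔤.BaseIndep S := by
  intro pos hpos b hb b' hb'
  ext x
  let Δ : (Λ → ℕ) → B := fun pos => 𝔤.totalAt pos b S x - 𝔤.totalAt pos b' S x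
  have hcongr : ∀ pos pos', 𝔤.SameOrder pos pos' S → Δ pos' = Δ pos := fun pos pos' h => by
    simp only [Δ]
    rw [totalAt_congr h hb, totalAt_congr h hb']
  have hcons : ∀ pos, 𝔤.InjOnColors pos → ∀ c d, 𝔤.Consecutive pos Finset.univ c d →
      Δ (swapPos pos c d) = Δ pos := by
    intro pos hpos c d hcd
    by_cases hc : c ∈ S
    · by_cases hd : d ∈ S
      · have h1 := hS b hb pos c d hpos hc hd (hcd.mono (Finset.subset_univ _)) x
        have h2 := hS b' hb' pos c d hpos hc hd (hcd.mono (Finset.subset_univ _)) x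
        rw [← h2, sub_eq_sub_iff_add_eq_add] at h1
        simp only [Δ]
        rw [sub_eq_sub_iff_add_eq_add, h1, add_comm]
      · exact hcongr _ _ (hcd.sameOrder_right.mono
          fun y hy => Finset.mem_erase.2 ⟨fun h => hd (h ▸ hy), Finset.mem_univ _⟩)
    · exact hcongr _ _ (hcd.sameOrder_left.mono
          fun y hy => Finset.mem_erase.2 ⟨fun h => hc (h ▸ hy), Finset.mem_univ _⟩)
  -- Legs that are not neighbours are interchanged through a leg `e` between them: three
  -- interchanges over shorter distances have the same effect as that of `c` and `d`.
  have hlt : ∀ n pos, 𝔤.InjOnColors pos → ∀ c d, 𝔤.color c = 𝔤.color d → pos c < pos d →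
      pos d - pos c = n → Δ (swapPos pos c d) = Δ pos := by
    intro n
    induction n using Nat.strong_induction_on with
    | _ n ih =>
      intro pos hpos c d hcol hlt hn
      by_cases he : ∃ e, 𝔤.color e = 𝔤.color c ∧ pos c < pos e ∧ pos e < pos d
      · obtain ⟨e, hec, hce, hed⟩ := he
        have nce : c ≠ e := by rintro rfl; omega
        have nde : d ≠ e := by rintro rfl; omega
        have ncd : c ≠ d := by rintro rfl; omega
        have hp1 := hpos.swapPos (c := c) (d := e) hec.symm
        have v1 : swapPos pos c e c = pos e := swapPos_left _ _
        have v2 : swapPos pos c e d = pos d := swapPos_of_ne ncd.symm nde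
        have v3 : swapPos pos c e e = pos c := swapPos_right _ _
        have hp2 := hp1.swapPos (c := c) (d := d) hcol
        have w1 : swapPos (swapPos pos c e) c d c = pos d := by rw [swapPos_left, v2]
        have w2 : swapPos (swapPos pos c e) c d d = pos e := by rw [swapPos_right, v1]
        have w3 : swapPos (swapPos pos c e) c d e = pos c := by
          rw [swapPos_of_ne nce.symm nde.symm, v3]
        have heq : swapPos pos c d = swapPos (swapPos (swapPos pos c e) c d) e d := by
          funext y
          by_cases hyc : y = c
          · subst hyc; rw [swapPos_left, swapPos_of_ne nce ncd, w1]
          by_cases hyd : y = d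
          · subst hyd; rw [swapPos_right, swapPos_right, w3]
          by_cases hye : y = e
          · subst hye; rw [swapPos_left, w2, swapPos_of_ne hyc hyd]
          · rw [swapPos_of_ne hyc hyd, swapPos_of_ne hye hyd, swapPos_of_ne hyc hyd,
              swapPos_of_ne hyc hye]
        rw [heq, ih _ _ _ hp2 e d (hec.trans hcol) _ rfl, ih _ _ _ hp1 c d hcol _ rfl,
          ih _ _ _ hpos c e hec.symm hce rfl]
        · omega
        · omega
        · omega
        · omega
        · omega
      · push Not at he
        refine hcons pos hpos c d ⟨hlt, hcol, fun y _ hyc hne hne' => ?_,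
          fun y _ hyc hne hne' => ?_⟩
        · refine ⟨fun h => h.trans hlt, fun h => ?_⟩
          by_contra hcon
          have h1 : pos c ≠ pos y := fun h => hne (hpos y c hyc h.symm)
          have := he y hyc (by omega)
          omega
        · refine ⟨fun h => ?_, fun h => hlt.trans h⟩
          have h1 : pos d ≠ pos y := fun h => hne' (hpos y d (hyc.trans hcol) h.symm)
          have := he y hyc h
          omega
  have hinj : ∀ σ ∈ 𝔤.colorPerms, 𝔤.InjOnColors (pos ∘ σ) := by
    intro σ hσ y z hyz h
    rw [mem_colorPerms] at hσ
    exact σ.injective (hpos _ _ (by rw [hσ, hσ, hyz]) h)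
  have hΔ : ∀ σ ∈ 𝔤.colorPerms, Δ (pos ∘ σ) = Δ pos := by
    intro σ hσ
    refine colorPerms_induction (fun σ : Equiv.Perm Λ => Δ (pos ∘ σ)) ?_ hσ
    intro σ hσ c d hcd hcol
    have hne : (pos ∘ σ) c ≠ (pos ∘ σ) d := fun h => hcd (hinj σ hσ c d hcol h)
    rcases lt_or_gt_of_ne hne with h | h
    · exact hlt _ _ (hinj σ hσ) c d hcol h rfl
    · rw [Equiv.swap_comm]
      exact hlt _ _ (hinj σ hσ) d c hcol.symm h rfl
  have hsum : ∑ σ ∈ 𝔤.colorPerms, Δ (pos ∘ σ) = 0 := by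
    simp only [Δ, Finset.sum_sub_distrib]
    rw [(sum_colorPerms_total hpos S x).2 b hb, (sum_colorPerms_total hpos S x).2 b' hb', sub_self]
  rw [Finset.sum_congr rfl hΔ, Finset.sum_const, ← Nat.cast_smul_eq_nsmul ℚ] at hsum
  have hne : (𝔤.colorPerms.card : ℚ) ≠ 0 := by
    have : 𝔤.colorPerms.card ≠ 0 := Finset.card_ne_zero_of_mem (a := 1) (by simp [mem_colorPerms])
    exact_mod_cast this
  exact sub_eq_zero.1 ((smul_eq_zero.1 hsum).resolve_left hne)

omit [Fintype Λ] in
theorem swapTotal_of_swapTotalAt {S : Finset Λ} (hS : 𝔤.SwapTotalAt S) : 𝔤.SwapTotal S := by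
  intro pos c d hpos hc hd hcd x
  obtain ⟨b, hb, hbS⟩ := 𝔤.exists_total_eq ⟨c, hc⟩
  rw [hbS, hbS]
  exact hS b hb pos c d hpos hc hd hcd x

variable (𝔤) in
-- The three properties must be proved together: the interchange rule on `S` for a given base uses
-- all smaller sets, independence of the base on `S` uses this rule for every base, and the rule for
-- words on `S` uses the one for `total` on `S`.
theorem baseIndep_and_swap (S : Finset Λ) : 𝔤.BaseIndep S ∧ 𝔤.SwapTotal S ∧ 𝔤.SwapWord S := by
  induction S using Finset.strongInduction with
  | H S ih =>
    have h := swapTotalAt_of_ssubset (fun b hb => (ih _ (Finset.erase_ssubset hb)).2.2)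
      fun S' hS' => (ih S' hS').1
    exact ⟨baseIndep_of_swapTotalAt h, swapTotal_of_swapTotalAt h,
      swapWord_of_swapTotal (swapTotal_of_swapTotalAt h)
        fun e he => (ih _ (Finset.erase_ssubset he)).2.2⟩

/-- The interchange of two consecutive legs of equal colour changes `total` by the term in which
they are joined. -/
theorem total_sub_total_swapPos (hpos : 𝔤.InjOnColors pos) {S : Finset Λ} {c d : Λ} (hc : c ∈ S)
    (hd : d ∈ S) (hcd : 𝔤.Consecutive pos S c d) (x : V) :
    𝔤.total pos S x - 𝔤.total (swapPos pos c d) S x = 𝔤.total pos (S.erase d) (𝔤.glue c d x) :=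
  (𝔤.baseIndep_and_swap S).2.1 pos c d hpos hc hd hcd x

omit [Fintype Λ] in
theorem total_map_eq {Λ' V' : Type*} [DecidableEq Λ'] [Fintype Λ'] [AddCommGroup V'] [Module ℚ V']
    {𝔤' : GlueSystem Λ' C V' B} (f : Λ ↪ Λ') (ρ : V → V')
    (hglue : ∀ b c, b ≠ c → ∀ x, 𝔤'.glue (f b) (f c) (ρ x) = ρ (𝔤.glue b c x))
    (hout : ∀ x, 𝔤'.out (ρ x) = 𝔤.out x) (hcolor : ∀ x, 𝔤'.color (f x) = 𝔤.color x)
    {pos' : Λ' → ℕ} (hpos : 𝔤'.InjOnColors pos') (S : Finset Λ) (x : V) :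
    𝔤'.total pos' (S.map f) (ρ x) = 𝔤.total (pos' ∘ f) S x :=
  (total_map f ρ hglue hout hcolor hpos S fun S' _ => (𝔤'.baseIndep_and_swap S').1).1 x

/-! ### Denominators -/

omit [Fintype Λ]

open Classical in
/-- The number of legs of colour `i` in `S`. -/
def colorCard (𝔤 : GlueSystem Λ C V B) (S : Finset Λ) (i : C) : ℕ :=
  (S.filter fun x => 𝔤.color x = i).card

open Classical in
theorem colorCard_erase {S : Finset Λ} {c : Λ} (hc : c ∈ S) (i : C) :
    𝔤.colorCard (S.erase c) i + (if i = 𝔤.color c then 1 else 0) = 𝔤.colorCard S i := by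
  unfold colorCard
  rw [Finset.filter_erase]
  split_ifs with h
  · rw [Finset.card_erase_of_mem (Finset.mem_filter.2 ⟨hc, h.symm⟩)]
    have : 0 < (S.filter fun x => 𝔤.color x = i).card :=
      Finset.card_pos.2 ⟨c, Finset.mem_filter.2 ⟨hc, h.symm⟩⟩
    omega
  · rw [Finset.erase_eq_of_notMem, add_zero]
    exact fun hm => h (Finset.mem_filter.1 hm).2.symm

variable [Fintype C]

open Classical in
-- The bracket under construction contains `p + q + 1` legs of the colour of `b`, counting `b`,
-- which are no longer in `S`. They are included in the factorial of that colour, and this provides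
-- the factor `(p + q + 1)!` that makes the coefficient integral when the bracket is closed. `X` and
-- `Y` are general, so that properties of graphs preserved by gluing can also be followed.
theorem factorial_smul_word_mem (X : Submodule ℤ V) (Y : Submodule ℤ B)
    (hglue : ∀ b c, b ≠ c → 𝔤.color b = 𝔤.color c → ∀ x ∈ X, 𝔤.glue b c x ∈ X)
    (hout : ∀ x ∈ X, 𝔤.out x ∈ Y) (S : Finset Λ) :
    (∀ x ∈ X, (∏ i, (𝔤.colorCard S i)!) • 𝔤.total pos S x ∈ Y) ∧
    ∀ b v p q, b ∉ S → ∀ x ∈ X,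
      (∏ i, (𝔤.colorCard S i + if i = 𝔤.color b then p + q + 1 else 0)!) •
        𝔤.word pos b v p q S x ∈ Y := by
  induction S using Finset.strongInduction with
  | H S ih =>
    have hT : ∀ x ∈ X, (∏ i, (𝔤.colorCard S i)!) • 𝔤.total pos S x ∈ Y := by
      intro x hx
      rcases S.eq_empty_or_nonempty with rfl | hS
      · simpa [total_empty, colorCard] using hout x hx
      · obtain ⟨b, hb, hbS⟩ := 𝔤.exists_total_eq hS
        have := (ih _ (Finset.erase_ssubset hb)).2 b (pos b) 0 0 (Finset.notMem_erase _ _) x hx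
        simp only [zero_add, colorCard_erase hb] at this
        rwa [hbS]
    refine ⟨hT, fun b v p q hb x hx => ?_⟩
    rw [word_apply, smul_add, Finset.smul_sum]
    refine Y.add_mem ?_ (Y.sum_mem fun c hc => ?_)
    · have hdvd : (p + q + 1)! * ∏ i, (𝔤.colorCard S i)! ∣
          ∏ i, (𝔤.colorCard S i + if i = 𝔤.color b then p + q + 1 else 0)! := by
        have h1 : ∏ i, (if i = 𝔤.color b then p + q + 1 else 0)! = (p + q + 1)! := by
          rw [Finset.prod_eq_single (𝔤.color b)]
          · simp
          · intro i _ hi; simp [hi]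
          · simp
        rw [← h1, ← Finset.prod_mul_distrib]
        refine Finset.prod_dvd_prod_of_dvd _ _ fun i _ => ?_
        rw [mul_comm]
        exact Nat.factorial_mul_factorial_dvd_factorial_add _ _
      obtain ⟨m, hm⟩ := hdvd
      have key : (∏ i, (𝔤.colorCard S i + if i = 𝔤.color b then p + q + 1 else 0)!) •
          (eulerCoeff p q • 𝔤.total pos S x) =
          ((m : ℤ) * ((-1) ^ q * (p ! * q !))) •
            ((∏ i, (𝔤.colorCard S i)!) • 𝔤.total pos S x) := by
        rw [hm, ← Nat.cast_smul_eq_nsmul ℚ, ← Nat.cast_smul_eq_nsmul ℚ, ← Int.cast_smul_eq_zsmul ℚ,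
          smul_smul, smul_smul]
        congr 1
        have := factorial_mul_eulerCoeff p q
        push_cast
        linear_combination (∏ i, ((𝔤.colorCard S i)! : ℚ)) * m * this
      rw [key]
      exact Y.smul_mem _ (hT x hx)
    · obtain ⟨hcS, hcb⟩ := Finset.mem_filter.1 hc
      have hbc : b ≠ c := fun h => hb (h ▸ hcS)
      have := (ih _ (Finset.erase_ssubset hcS)).2 b (pos c) (if v < pos c then p + 1 else p)
        (if v < pos c then q else q + 1) (fun h => hb (Finset.mem_of_mem_erase h)) _
        (hglue b c hbc hcb.symm x hx)
      convert this using 2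
      refine Finset.prod_congr rfl fun i _ => ?_
      rw [← colorCard_erase hcS i, hcb]
      congr 1
      split_ifs <;> omega

theorem factorial_smul_total_mem (X : Submodule ℤ V) (Y : Submodule ℤ B)
    (hglue : ∀ b c, b ≠ c → 𝔤.color b = 𝔤.color c → ∀ x ∈ X, 𝔤.glue b c x ∈ X)
    (hout : ∀ x ∈ X, 𝔤.out x ∈ Y) (S : Finset Λ) {x : V} (hx : x ∈ X) :
    (∏ i, (𝔤.colorCard S i)!) • 𝔤.total pos S x ∈ Y :=
  (factorial_smul_word_mem X Y hglue hout S).1 x hx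

end GlueSystem

/-! ### Joining two legs -/

namespace ChineseCharacter

variable (G : ChineseCharacter)

/-- The half-edges `x` and `y` lie in the same component. -/
abbrev Joined (x y : G.H) : Prop := Relation.EqvGen (fun u v => v = G.rot u ∨ v = G.opp u) x y

variable {G}

theorem joined_rot (x : G.H) : G.Joined x (G.rot x) := .rel _ _ (.inl rfl)

theorem joined_opp (x : G.H) : G.Joined x (G.opp x) := .rel _ _ (.inr rfl)

theorem Joined.map {G G' : ChineseCharacter} {f : G.H → G'.H}
    (hrot : ∀ h, G'.Joined (f h) (f (G.rot h))) (hopp : ∀ h, G'.Joined (f h) (f (G.opp h)))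
    {x y : G.H} (h : G.Joined x y) : G'.Joined (f x) (f y) := by
  induction h with
  | rel x y h =>
    rcases h with rfl | rfl
    · exact hrot x
    · exact hopp x
  | refl x => exact .refl _
  | symm x y _ ih => exact ih.symm
  | trans x y z _ _ ih1 ih2 => exact ih1.trans _ _ _ ih2

theorem eq_of_rot_eq {h b : G.H} (hb : G.rot b = b) (h' : G.rot h = b) : h = b :=
  G.rot.injective (h'.trans hb.symm)

theorem rot_ne_of_ne {h : G.H} (b : G.External) (h' : h ≠ b) : G.rot h ≠ b :=
  fun h2 => h' (eq_of_rot_eq b.2 h2)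

open Classical in
/-- The cyclic order after joining the legs `b` and `c`. -/
def glueRot (G : ChineseCharacter) (b c : G.External) : Equiv.Perm (G.H ⊕ Bool) :=
  Equiv.sumCongr G.rot (Equiv.refl Bool) * (Equiv.swap (Sum.inr true) (Sum.inl c.1) *
    Equiv.swap (Sum.inl c.1) (Sum.inl b.1))

variable {b c : G.External}

theorem glueRot_right (hbc : b ≠ c) : G.glueRot b c (Sum.inl c.1) = Sum.inl b.1 := by
  have h : b.1 ≠ c.1 := fun h => hbc (Subtype.ext h)
  simp [glueRot, Equiv.swap_apply_def, b.2, h]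

theorem glueRot_left (hbc : b ≠ c) : G.glueRot b c (Sum.inl b.1) = Sum.inr true := by
  have h : b.1 ≠ c.1 := fun h => hbc (Subtype.ext h)
  simp [glueRot]

theorem glueRot_true : G.glueRot b c (Sum.inr true) = Sum.inl c.1 := by
  simp [glueRot, Equiv.swap_apply_def, c.2]

theorem glueRot_false : G.glueRot b c (Sum.inr false) = Sum.inr false := by
  simp [glueRot, Equiv.swap_apply_def]

theorem glueRot_of_ne {h : G.H} (hb : h ≠ b) (hc : h ≠ c) :
    G.glueRot b c (Sum.inl h) = Sum.inl (G.rot h) := by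
  simp [glueRot, Equiv.swap_apply_def, hb, hc]

open Classical in
theorem glueRot_inl (hbc : b ≠ c) (h : G.H) :
    G.glueRot b c (Sum.inl h) =
      if h = c.1 then Sum.inl b.1 else if h = b.1 then Sum.inr true else Sum.inl (G.rot h) := by
  split_ifs with h1 h2
  · rw [h1, glueRot_right hbc]
  · rw [h2, glueRot_left hbc]
  · exact glueRot_of_ne h2 h1

/-- The character obtained by joining the legs `b` and `c`: a new edge connects the external
vertex `inr false` with a new trivalent vertex, whose cyclic order is `(inr true, c, b)`. -/
def glue (G : ChineseCharacter) (b c : G.External) (hbc : b ≠ c) : ChineseCharacter where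
  H := G.H ⊕ Bool
  finite_H := by
    have := G.finite_H
    infer_instance
  rot := G.glueRot b c
  opp := Equiv.sumCongr G.opp Equiv.boolNot
  rot_rot_rot := by
    rintro (h | _ | _)
    · by_cases hc : h = c
      · rw [hc, glueRot_right hbc, glueRot_left hbc, glueRot_true]
      by_cases hb : h = b
      · rw [hb, glueRot_left hbc, glueRot_true, glueRot_right hbc]
      · rw [glueRot_of_ne hb hc, glueRot_of_ne (rot_ne_of_ne b hb) (rot_ne_of_ne c hc),
          glueRot_of_ne (rot_ne_of_ne b (rot_ne_of_ne b hb)) (rot_ne_of_ne c (rot_ne_of_ne c hc)),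
          G.rot_rot_rot]
    · rw [glueRot_false, glueRot_false, glueRot_false]
    · rw [glueRot_true, glueRot_right hbc, glueRot_left hbc]
  opp_opp := by
    rintro (h | _ | _)
    · simp [G.opp_opp]
    · simp
    · simp
  opp_ne := by
    rintro (h | _ | _)
    · simp [G.opp_ne]
    · simp
    · simp
  exists_external := by
    -- Joining can only destroy the legs `b` and `c`. Both are now in the component of the new leg
    -- `inr false`, which replaces them as the required external vertex.
    have hb : Relation.EqvGen (fun x y => y = G.glueRot b c x ∨
        y = (Equiv.sumCongr G.opp Equiv.boolNot) x) (Sum.inl b.1) (Sum.inr false) := by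
      refine .trans _ (Sum.inr true) _ (.rel _ _ (.inl (glueRot_left hbc).symm))
        (.rel _ _ (.inr ?_))
      simp
    have hc : Relation.EqvGen (fun x y => y = G.glueRot b c x ∨
        y = (Equiv.sumCongr G.opp Equiv.boolNot) x) (Sum.inl c.1) (Sum.inr false) :=
      .trans _ (Sum.inl b.1) _ (.rel _ _ (.inl (glueRot_right hbc).symm)) hb
    have hlift : ∀ x y, G.Joined x y → Relation.EqvGen (fun x y => y = G.glueRot b c x ∨
        y = (Equiv.sumCongr G.opp Equiv.boolNot) x) (Sum.inl x) (Sum.inl y) := by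
      intro x y h
      induction h with
      | rel x y h =>
        rcases h with rfl | rfl
        · by_cases hxc : x = c
          · rw [hxc, c.2]; exact .refl _
          by_cases hxb : x = b
          · rw [hxb, b.2]; exact .refl _
          · exact .rel _ _ (.inl (glueRot_of_ne hxb hxc).symm)
        · exact .rel _ _ (.inr (by simp))
      | refl x => exact .refl _
      | symm x y _ ih => exact ih.symm
      | trans x y z _ _ ih1 ih2 => exact ih1.trans _ _ _ ih2
    rintro (h | _ | _)
    · obtain ⟨g, hg, hg'⟩ := G.exists_external h
      by_cases hgc : g = c
      · exact ⟨Sum.inr false, .trans _ _ _ (hgc ▸ hlift _ _ hg) hc, glueRot_false⟩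
      by_cases hgb : g = b
      · exact ⟨Sum.inr false, .trans _ _ _ (hgb ▸ hlift _ _ hg) hb, glueRot_false⟩
      · exact ⟨Sum.inl g, hlift _ _ hg, by rw [glueRot_of_ne hgb hgc, hg']⟩
    · exact ⟨Sum.inr false, .refl _, glueRot_false⟩
    · exact ⟨Sum.inr false, .rel _ _ (.inr (by simp)), glueRot_false⟩

theorem glue_opp_inl (hbc : b ≠ c) (h : G.H) :
    (G.glue b c hbc).opp (Sum.inl h) = Sum.inl (G.opp h) := rfl

theorem glue_opp_true (hbc : b ≠ c) :
    (G.glue b c hbc).opp (Sum.inr true) = Sum.inr false := rfl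

theorem glue_joined_left (hbc : b ≠ c) :
    (G.glue b c hbc).Joined (Sum.inl b.1) (Sum.inr true) :=
  .rel _ _ (.inl (glueRot_left hbc).symm)

theorem glue_joined_inl (hbc : b ≠ c) {x y : G.H} (h : G.Joined x y) :
    (G.glue b c hbc).Joined (Sum.inl x) (Sum.inl y) := by
  refine Joined.map (G' := G.glue b c hbc) (f := Sum.inl) (fun x => ?_) (fun x => ?_) h
  · by_cases hxc : x = c
    · rw [hxc, c.2]; exact .refl _
    by_cases hxb : x = b
    · rw [hxb, b.2]; exact .refl _
    · exact .rel _ _ (.inl (glueRot_of_ne hxb hxc).symm)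
  · exact .rel _ _ (.inr (glue_opp_inl hbc x).symm)

theorem IsConnected.glue (h : G.IsConnected) (hbc : b ≠ c) : (G.glue b c hbc).IsConnected := by
  refine ⟨⟨Sum.inr false⟩, ?_⟩
  have key : ∀ y, (G.glue b c hbc).Joined (Sum.inl b.1) y := by
    rintro (y | _ | _)
    · exact glue_joined_inl hbc (h.2 _ _)
    · refine (glue_joined_left hbc).trans _ _ _ (.rel _ _ (.inr ?_))
      rw [glue_opp_true]
    · exact glue_joined_left hbc
  exact fun x y => (key x).symm.trans _ _ _ (key y)

theorem glueRot_inl_eq_self (hbc : b ≠ c) {h : G.H} :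
    G.glueRot b c (Sum.inl h) = Sum.inl h ↔ G.rot h = h ∧ h ≠ b ∧ h ≠ c := by
  classical
  have hbc' : b.1 ≠ c.1 := fun h => hbc (Subtype.ext h)
  rw [glueRot_inl hbc]
  split_ifs with h1 h2
  · simp only [h1, Sum.inl.injEq, ne_eq, not_true_eq_false, and_false, iff_false]
    exact hbc'
  · simp [h2]
  · simp [h1, h2]

theorem glue_rot_inl_eq_self (hbc : b ≠ c) {h : G.H} :
    (G.glue b c hbc).rot (Sum.inl h) = Sum.inl h ↔ G.rot h = h ∧ h ≠ b ∧ h ≠ c :=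
  glueRot_inl_eq_self hbc

theorem glue_rot_true_ne (hbc : b ≠ c) :
    (G.glue b c hbc).rot (Sum.inr true) ≠ Sum.inr true := by
  change G.glueRot b c _ ≠ _
  rw [glueRot_true]; simp

/-- The leg of `G.glue b c` that corresponds to a leg of `G` other than `b`, `c`. -/
def glueLeg (hbc : b ≠ c) (h : G.External) (hb : h ≠ b) (hc : h ≠ c) :
    (G.glue b c hbc).External :=
  ⟨Sum.inl h.1, (glue_rot_inl_eq_self hbc).2
    ⟨h.2, fun h' => hb (Subtype.ext h'), fun h' => hc (Subtype.ext h')⟩⟩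

/-- The new leg of `G.glue b c`. -/
def newLeg (hbc : b ≠ c) : (G.glue b c hbc).External := ⟨Sum.inr false, glueRot_false⟩

theorem glue_external_cases (hbc : b ≠ c) {P : (G.glue b c hbc).External → Prop}
    (hnew : P (newLeg hbc)) (hold : ∀ h hb hc, P (glueLeg hbc h hb hc)) (y) : P y := by
  obtain ⟨h | _ | _, hy⟩ := y
  · obtain ⟨h1, h2, h3⟩ := (glue_rot_inl_eq_self hbc).1 hy
    exact hold ⟨h, h1⟩ (fun h' => h2 (congrArg Subtype.val h')) fun h' => h3 (congrArg Subtype.val h')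
  · exact hnew
  · exact absurd hy (glue_rot_true_ne hbc)

end ChineseCharacter

/-! ### Joining legs of marked characters, and reattachments -/

namespace MarkedCharacter

open ChineseCharacter

variable {n : ℕ} {ξ ξ' : MarkedCharacter n}

/-- Join the legs `b` and `c`; the new leg gets the colour `x`. -/
def glue (ξ : MarkedCharacter n) (b c : ξ.External) (hbc : b ≠ c) (x : Fin n) :
    MarkedCharacter n where
  toChineseCharacter := ξ.toChineseCharacter.glue b c hbc
  color y := match y with
    | ⟨Sum.inl h, hy⟩ => ξ.color ⟨h, ((glue_rot_inl_eq_self hbc).1 hy).1⟩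
    | ⟨Sum.inr _, _⟩ => x

/-- Recolour the legs. -/
def recolor {m : ℕ} (ξ : MarkedCharacter n) (κ : Fin n → Fin m) : MarkedCharacter m where
  toChineseCharacter := ξ.toChineseCharacter
  color := κ ∘ ξ.color

/-- The leg `b` is the only one of colour `x`. -/
def IsOnly (ξ : MarkedCharacter n) (x : Fin n) (b : ξ.External) : Prop :=
  ∀ h, ξ.color h = x ↔ h = b

theorem IsOnly.color_eq {x : Fin n} {b : ξ.External} (h : ξ.IsOnly x b) : ξ.color b = x :=
  (h b).2 rfl

theorem IsOnly.ne {x y : Fin n} {b c : ξ.External} (hb : ξ.IsOnly x b) (hc : ξ.IsOnly y c)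
    (hxy : x ≠ y) : b ≠ c := by
  rintro rfl
  exact hxy (hb.color_eq.symm.trans hc.color_eq)

theorem IsOnly.unique {x : Fin n} {b b' : ξ.External} (h : ξ.IsOnly x b) (h' : ξ.IsOnly x b') :
    b = b' := (h' b).1 h.color_eq

section Reattach

variable {ρ : Equiv.Perm ξ.H} {e : ξ.H ≃ ξ'.H}

theorem reattach_rot_eq_self (hρ : ∀ h, ξ.rot h = h → ρ h = h)
    (hrot : ∀ h, ξ'.rot (e (ρ h)) = e (ρ (ξ.rot h))) (h : ξ.H) :
    ξ.rot h = h ↔ ξ'.rot (e h) = e h := by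
  constructor
  · intro hh
    have := hrot h
    rwa [hh, hρ h hh] at this
  · intro hh
    obtain ⟨k, rfl⟩ := ρ.surjective h
    rw [hrot] at hh
    have hk := ρ.injective (e.injective hh)
    rw [hρ k hk, hk]

/-- The bijection of the legs that is given by a reattachment. -/
def reattachEquiv (hρ : ∀ h, ξ.rot h = h → ρ h = h)
    (hrot : ∀ h, ξ'.rot (e (ρ h)) = e (ρ (ξ.rot h))) : ξ.External ≃ ξ'.External :=
  e.subtypeEquiv (reattach_rot_eq_self hρ hrot)

theorem reattach_isOnly (hρ : ∀ h, ξ.rot h = h → ρ h = h)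
    (hrot : ∀ h, ξ'.rot (e (ρ h)) = e (ρ (ξ.rot h)))
    (hcol : ∀ (h : ξ.External) (h' : ξ'.External), e h.1 = h'.1 → ξ'.color h' = ξ.color h)
    {x : Fin n} {b : ξ.External} :
    ξ.IsOnly x b ↔ ξ'.IsOnly x (reattachEquiv hρ hrot b) := by
  have hc : ∀ h, ξ'.color (reattachEquiv hρ hrot h) = ξ.color h := fun h => hcol _ _ rfl
  constructor
  · intro h y
    obtain ⟨y, rfl⟩ := (reattachEquiv hρ hrot).surjective y
    rw [hc, h y, (reattachEquiv hρ hrot).injective.eq_iff]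
  · intro h y
    rw [← hc, h, (reattachEquiv hρ hrot).injective.eq_iff]

/-- A reattachment that fixes the legs takes place away from them, so it commutes with joining two
legs; on the two new half-edges it is the identity. -/
theorem reattach_glue (hρ : ∀ h, ξ.rot h = h → ρ h = h)
    (hopp : ∀ h, ξ'.opp (e h) = e (ξ.opp h))
    (hrot : ∀ h, ξ'.rot (e (ρ h)) = e (ρ (ξ.rot h)))
    (hcol : ∀ (h : ξ.External) (h' : ξ'.External), e h.1 = h'.1 → ξ'.color h' = ξ.color h)
    {b c : ξ.External} (hbc : b ≠ c) (x : Fin n)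
    (hbc' : reattachEquiv hρ hrot b ≠ reattachEquiv hρ hrot c) :
    (ξ.glue b c hbc x).Reattach (Equiv.Perm.sumCongr ρ 1)
      (ξ'.glue (reattachEquiv hρ hrot b) (reattachEquiv hρ hrot c) hbc' x) := by
  refine ⟨Equiv.sumCongr e (Equiv.refl Bool), ?_, ?_, ?_⟩
  · rintro (h | _ | _)
    · change Sum.inl _ = Sum.inl _
      rw [hopp]
    · rfl
    · rfl
  · have hb : (reattachEquiv hρ hrot b).1 = e b.1 := rfl
    have hc : (reattachEquiv hρ hrot c).1 = e c.1 := rfl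
    rintro (h | _ | _)
    · change ξ'.glueRot _ _ (Sum.inl (e (ρ h))) =
        (Equiv.sumCongr e (Equiv.refl Bool)) (Equiv.Perm.sumCongr ρ 1 (ξ.glueRot b c (Sum.inl h)))
      by_cases h1 : h = c
      · subst h1
        rw [glueRot_right hbc, hρ _ c.2, ← hc, glueRot_right hbc', hb]
        simp [hρ _ b.2]
      by_cases h2 : h = b
      · subst h2
        rw [glueRot_left hbc, hρ _ b.2, ← hb, glueRot_left hbc']
        simp
      · rw [glueRot_of_ne h2 h1, glueRot_of_ne, hrot]
        · simp
        · rw [hb]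
          intro h'
          have h3 := e.injective h'
          rw [← hρ _ b.2] at h3
          exact h2 (ρ.injective h3)
        · rw [hc]
          intro h'
          have h3 := e.injective h'
          rw [← hρ _ c.2] at h3
          exact h1 (ρ.injective h3)
    · change ξ'.glueRot _ _ (Sum.inr false) =
        (Equiv.sumCongr e (Equiv.refl Bool)) (Equiv.Perm.sumCongr ρ 1 (ξ.glueRot b c (Sum.inr false)))
      rw [glueRot_false, glueRot_false]
      simp
    · change ξ'.glueRot _ _ (Sum.inr true) =
        (Equiv.sumCongr e (Equiv.refl Bool)) (Equiv.Perm.sumCongr ρ 1 (ξ.glueRot b c (Sum.inr true)))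
      rw [glueRot_true, glueRot_true, hc]
      simp [hρ _ c.2]
  · intro y y' hyy'
    obtain ⟨y | y, hy⟩ := y <;> obtain ⟨y' | y', hy'⟩ := y'
    · exact hcol _ _ (Sum.inl.inj hyy')
    · exact absurd hyy' Sum.inl_ne_inr
    · exact absurd hyy' Sum.inr_ne_inl
    · rfl

end Reattach

theorem swap_fixes_external {a : ξ.H} (ha : ξ.rot a ≠ a) [DecidableEq ξ.H] (h : ξ.H)
    (hh : ξ.rot h = h) : Equiv.swap (ξ.rot a) (ξ.rot (ξ.rot a)) h = h := by
  refine Equiv.swap_apply_of_ne_of_ne ?_ ?_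
  · rintro rfl
    exact ha (ξ.rot.injective hh)
  · rintro rfl
    exact ha (ξ.rot.injective (ξ.rot.injective hh))

theorem cycle_fixes_external {a a' : ξ.H} (ha : ξ.rot a ≠ a) (ha' : ξ.rot a' ≠ a')
    [DecidableEq ξ.H] (h : ξ.H) (hh : ξ.rot h = h) :
    (Equiv.swap (ξ.rot a) (ξ.rot (ξ.rot a)) * Equiv.swap (ξ.rot (ξ.rot a)) (ξ.rot a')) h = h := by
  rw [Equiv.Perm.mul_apply, Equiv.swap_apply_of_ne_of_ne (x := h), swap_fixes_external ha h hh]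
  · rintro rfl
    exact ha (ξ.rot.injective (ξ.rot.injective hh))
  · rintro rfl
    exact ha' (ξ.rot.injective hh)

end MarkedCharacter

/-! ### Linear maps on `SpaceB` -/

section SpaceB

open MarkedCharacter

variable {n : ℕ}

theorem toB_eq {ξ ξ' : MarkedCharacter n} (h : ξ.Reattach 1 ξ') : ξ.toB = ξ'.toB := by
  rw [← sub_eq_zero]
  exact (Submodule.Quotient.mk_eq_zero _).2 (Submodule.subset_span (.homeo _ _ h))

theorem toB_add_toB {ξ₁ ξ₂ : MarkedCharacter n} {inst : DecidableEq ξ₁.H} (a : ξ₁.H)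
    (ha : ξ₁.rot a ≠ a) (h : ξ₁.Reattach (Equiv.swap (ξ₁.rot a) (ξ₁.rot (ξ₁.rot a))) ξ₂) :
    ξ₁.toB + ξ₂.toB = 0 := by
  obtain rfl := Subsingleton.elim inst (Classical.typeDecidableEq _)
  exact (Submodule.Quotient.mk_eq_zero _).2 (Submodule.subset_span (.antisymm _ _ a ha h))

theorem toB_add_toB_add_toB {ξ₁ ξ₂ ξ₃ : MarkedCharacter n} {inst : DecidableEq ξ₁.H}
    (a b c d : ξ₁.H) (hb : b = ξ₁.rot a) (hc : c = ξ₁.rot b) (hd : d = ξ₁.rot (ξ₁.opp a))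
    (ha : b ≠ a) (ha' : d ≠ ξ₁.opp a) (hab : ξ₁.opp a ≠ b) (hac : ξ₁.opp a ≠ c)
    (h₂ : ξ₁.Reattach (Equiv.swap b c * Equiv.swap c d) ξ₂)
    (h₃ : ξ₁.Reattach (Equiv.swap b c * Equiv.swap c d)⁻¹ ξ₃) :
    ξ₁.toB + ξ₂.toB + ξ₃.toB = 0 := by
  obtain rfl := Subsingleton.elim inst (Classical.typeDecidableEq _)
  exact (Submodule.Quotient.mk_eq_zero _).2 (Submodule.subset_span
    (.jacobi _ _ _ a b c d hb hc hd ha ha' hab hac h₂ h₃))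

open Classical in
/-- A function on marked characters respects the relations that define `SpaceB`. -/
structure RespectsB {M : Type*} [AddCommGroup M] (f : MarkedCharacter n → M) : Prop where
  homeo : ∀ ξ ξ', ξ.Reattach 1 ξ' → f ξ = f ξ'
  antisymm : ∀ (ξ₁ ξ₂ : MarkedCharacter n) (a : ξ₁.H), ξ₁.rot a ≠ a →
    ξ₁.Reattach (Equiv.swap (ξ₁.rot a) (ξ₁.rot (ξ₁.rot a))) ξ₂ → f ξ₁ + f ξ₂ = 0
  jacobi : ∀ (ξ₁ ξ₂ ξ₃ : MarkedCharacter n) (a b c d : ξ₁.H),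
    b = ξ₁.rot a → c = ξ₁.rot b → d = ξ₁.rot (ξ₁.opp a) → b ≠ a → d ≠ ξ₁.opp a →
    ξ₁.opp a ≠ b → ξ₁.opp a ≠ c → ξ₁.Reattach (Equiv.swap b c * Equiv.swap c d) ξ₂ →
    ξ₁.Reattach (Equiv.swap b c * Equiv.swap c d)⁻¹ ξ₃ → f ξ₁ + f ξ₂ + f ξ₃ = 0

/-- The linear map on `SpaceB` with given values at the classes of marked characters. -/
def liftB {M : Type*} [AddCommGroup M] [Module ℚ M] (f : MarkedCharacter n → M)
    (hf : RespectsB f) : SpaceB n →ₗ[ℚ] M :=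
  Submodule.liftQ _ (Finsupp.linearCombination ℚ f) <| by
    rw [Submodule.span_le]
    rintro x (⟨ξ, ξ', h⟩ | ⟨ξ₁, ξ₂, a, ha, h⟩ | ⟨ξ₁, ξ₂, ξ₃, a, b, c, d, h1, h2, h3, h4, h5, h6, h7, h8, h9⟩)
    · simp [hf.homeo _ _ h]
    · simpa using hf.antisymm _ _ a ha h
    · simpa using hf.jacobi _ _ _ a b c d h1 h2 h3 h4 h5 h6 h7 h8 h9

@[simp]
theorem liftB_toB {M : Type*} [AddCommGroup M] [Module ℚ M] (f : MarkedCharacter n → M)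
    (hf : RespectsB f) (ξ : MarkedCharacter n) : liftB f hf ξ.toB = f ξ := by
  change Finsupp.linearCombination ℚ f (Finsupp.single ξ 1) = f ξ
  simp

theorem span_toB : Submodule.span ℚ (Set.range (toB (n := n))) = ⊤ := by
  refine Submodule.eq_top_iff'.2 fun x => ?_
  obtain ⟨x, rfl⟩ := Submodule.Quotient.mk_surjective _ x
  induction x using Finsupp.induction_linear with
  | zero => exact Submodule.zero_mem _
  | add x y hx hy => exact Submodule.add_mem _ hx hy
  | single ξ r =>
    have : (Submodule.Quotient.mk (Finsupp.single ξ r) : SpaceB n) = r • ξ.toB := by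
      rw [toB, ← Submodule.Quotient.mk_smul]; simp
    rw [this]
    exact Submodule.smul_mem _ _ (Submodule.subset_span ⟨ξ, rfl⟩)

theorem linearMapB_ext {M : Type*} [AddCommGroup M] [Module ℚ M] {f g : SpaceB n →ₗ[ℚ] M}
    (h : ∀ ξ : MarkedCharacter n, f ξ.toB = g ξ.toB) : f = g :=
  LinearMap.ext_on_range span_toB h

/-! ### The relations in explicit form -/

theorem rot_ne_rot_rot {ξ : MarkedCharacter n} {a : ξ.H} (ha : ξ.rot a ≠ a) :
    ξ.rot a ≠ ξ.rot (ξ.rot a) := fun h => ha (ξ.rot.injective h.symm)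

theorem ne_rot_rot {ξ : MarkedCharacter n} {a : ξ.H} (ha : ξ.rot a ≠ a) :
    a ≠ ξ.rot (ξ.rot a) := fun h => ha (by
      conv_lhs => rw [h]
      exact ξ.rot_rot_rot a)

/-- Antisymmetry, where the cyclic order `(a, b, c)` becomes `(a, c, b)`. -/
theorem toB_add_toB_of {ξ₁ ξ₂ : MarkedCharacter n} {a b c : ξ₁.H} (hb : ξ₁.rot a = b)
    (hc : ξ₁.rot b = c) (hab : b ≠ a) (e : ξ₁.H ≃ ξ₂.H) (hopp : ∀ h, ξ₂.opp (e h) = e (ξ₁.opp h))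
    (h1 : ξ₂.rot (e a) = e c) (h2 : ξ₂.rot (e c) = e b) (h3 : ξ₂.rot (e b) = e a)
    (hrot : ∀ h, h ≠ a → h ≠ b → h ≠ c → ξ₂.rot (e h) = e (ξ₁.rot h))
    (hcol : ∀ (h : ξ₁.External) (h' : ξ₂.External), e h.1 = h'.1 → ξ₂.color h' = ξ₁.color h) :
    ξ₁.toB + ξ₂.toB = 0 := by
  classical
  subst hb hc
  have hac := ne_rot_rot hab
  have hbc := rot_ne_rot_rot hab
  refine toB_add_toB (inst := Classical.decEq _) a hab ⟨e, hopp, fun h => ?_, hcol⟩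
  by_cases ha : h = a
  · subst ha
    rw [Equiv.swap_apply_of_ne_of_ne hab.symm hac, Equiv.swap_apply_left, h1]
  by_cases hb : h = ξ₁.rot a
  · subst hb
    rw [Equiv.swap_apply_left, Equiv.swap_apply_right, h2]
  by_cases hc : h = ξ₁.rot (ξ₁.rot a)
  · subst hc
    rw [Equiv.swap_apply_right, ξ₁.rot_rot_rot, Equiv.swap_apply_of_ne_of_ne hab.symm hac, h3]
  · rw [Equiv.swap_apply_of_ne_of_ne hb hc, hrot h ha hb hc, Equiv.swap_apply_of_ne_of_ne]
    · exact fun h' => ha (ξ₁.rot.injective h')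
    · exact fun h' => hb (ξ₁.rot.injective h')

/-- The permutation in the Jacobi relation at the vertices `(a, b, c)` and `(a', d, g)`. -/
theorem jacobi_perm {ξ₁ : MarkedCharacter n} [DecidableEq ξ₁.H] {a a' b c d g : ξ₁.H}
    (ha' : ξ₁.opp a = a') (hb : ξ₁.rot a = b) (hc : ξ₁.rot b = c) (hd : ξ₁.rot a' = d)
    (hg : ξ₁.rot d = g) (hab : b ≠ a) (had : d ≠ a') (ha'b : a' ≠ b) (ha'c : a' ≠ c) :
    [a, a', b, c, d, g].Nodup ∧ ξ₁.rot c = a ∧ ξ₁.rot g = a' ∧ ∃ ρ : Equiv.Perm ξ₁.H,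
      ρ = Equiv.swap b c * Equiv.swap c d ∧ ρ a = a ∧ ρ b = c ∧ ρ c = d ∧ ρ d = b ∧ ρ a' = a' ∧
      ρ g = g ∧ ∀ h, h ≠ b → h ≠ c → h ≠ d → ρ h = h := by
  have hinj := ξ₁.rot.injective
  have ha'a : a' ≠ a := ha' ▸ ξ₁.opp_ne a
  have hca : ξ₁.rot c = a := by rw [← hc, ← hb, ξ₁.rot_rot_rot]
  have hga : ξ₁.rot g = a' := by rw [← hg, ← hd, ξ₁.rot_rot_rot]
  have hac : a ≠ c := fun h => hab (by rw [← hb, h, hca]; exact h)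
  have hbc : b ≠ c := fun h => hab (by rw [← hca, ← h, hc]; exact h)
  have hda : d ≠ a := fun h => ha'c (hinj (by rw [hd, hca, h]))
  have hdb : d ≠ b := fun h => ha'a (hinj (by rw [hd, hb, h]))
  have hdc : d ≠ c := fun h => ha'b (hinj (by rw [hd, hc, h]))
  have hgb : g ≠ b := fun h => hda (hinj (by rw [hg, hb, h]))
  have hgc : g ≠ c := fun h => hdb (hinj (by rw [hg, hc, h]))
  have hga' : g ≠ a := fun h => hdc (hinj (by rw [hg, hca, h]))
  have hga'' : g ≠ a' := fun h => had (by rw [← hga, ← hd, h])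
  have hgd : g ≠ d := fun h => had (by rw [← hga, h, hg]; exact h.symm)
  obtain ⟨ρ, hρ⟩ : ∃ ρ : Equiv.Perm ξ₁.H, ρ = Equiv.swap b c * Equiv.swap c d := ⟨_, rfl⟩
  have r1 : ρ a = a := by
    rw [hρ, Equiv.Perm.mul_apply, Equiv.swap_apply_of_ne_of_ne hac hda.symm,
      Equiv.swap_apply_of_ne_of_ne hab.symm hac]
  have r2 : ρ b = c := by
    rw [hρ, Equiv.Perm.mul_apply, Equiv.swap_apply_of_ne_of_ne hbc hdb.symm,
      Equiv.swap_apply_left]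
  have r3 : ρ c = d := by
    rw [hρ, Equiv.Perm.mul_apply, Equiv.swap_apply_left, Equiv.swap_apply_of_ne_of_ne hdb hdc]
  have r4 : ρ d = b := by
    rw [hρ, Equiv.Perm.mul_apply, Equiv.swap_apply_right, Equiv.swap_apply_right]
  have r5 : ρ a' = a' := by
    rw [hρ, Equiv.Perm.mul_apply, Equiv.swap_apply_of_ne_of_ne ha'c had.symm,
      Equiv.swap_apply_of_ne_of_ne ha'b ha'c]
  have r6 : ρ g = g := by
    rw [hρ, Equiv.Perm.mul_apply, Equiv.swap_apply_of_ne_of_ne hgc hgd,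
      Equiv.swap_apply_of_ne_of_ne hgb hgc]
  have r7 : ∀ h, h ≠ b → h ≠ c → h ≠ d → ρ h = h := fun h h1 h2 h3 => by
    rw [hρ, Equiv.Perm.mul_apply, Equiv.swap_apply_of_ne_of_ne h2 h3,
      Equiv.swap_apply_of_ne_of_ne h1 h2]
  refine ⟨?_, hca, hga, ρ, hρ, r1, r2, r3, r4, r5, r6, r7⟩
  simp only [List.nodup_cons, List.mem_cons, List.not_mem_nil, or_false, not_or, List.nodup_nil,
    not_false_eq_true, and_true]
  exact ⟨⟨ha'a.symm, hab.symm, hac, hda.symm, hga'.symm⟩, ⟨ha'b, ha'c, had.symm, hga''.symm⟩,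
    ⟨hbc, hdb.symm, hgb.symm⟩, ⟨hdc.symm, hgc.symm⟩, hgd.symm⟩

/-- The Jacobi relation, where `(a, b, c)`, `(a', d, g)` becomes `(a, c, d)`, `(a', b, g)` and
`(a, d, b)`, `(a', c, g)`. -/
theorem toB_add_toB_add_toB_of {ξ₁ ξ₂ ξ₃ : MarkedCharacter n} {a a' b c d g : ξ₁.H}
    (ha' : ξ₁.opp a = a') (hb : ξ₁.rot a = b) (hc : ξ₁.rot b = c) (hd : ξ₁.rot a' = d)
    (hg : ξ₁.rot d = g) (hab : b ≠ a) (had : d ≠ a') (ha'b : a' ≠ b) (ha'c : a' ≠ c)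
    (e₂ : ξ₁.H ≃ ξ₂.H) (hopp₂ : ∀ h, ξ₂.opp (e₂ h) = e₂ (ξ₁.opp h))
    (h21 : ξ₂.rot (e₂ a) = e₂ c) (h22 : ξ₂.rot (e₂ c) = e₂ d) (h23 : ξ₂.rot (e₂ d) = e₂ a)
    (h24 : ξ₂.rot (e₂ a') = e₂ b) (h25 : ξ₂.rot (e₂ b) = e₂ g) (h26 : ξ₂.rot (e₂ g) = e₂ a')
    (hrot₂ : ∀ h, h ≠ a → h ≠ b → h ≠ c → h ≠ a' → h ≠ d → h ≠ g →
      ξ₂.rot (e₂ h) = e₂ (ξ₁.rot h))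
    (hcol₂ : ∀ (h : ξ₁.External) (h' : ξ₂.External), e₂ h.1 = h'.1 → ξ₂.color h' = ξ₁.color h)
    (e₃ : ξ₁.H ≃ ξ₃.H) (hopp₃ : ∀ h, ξ₃.opp (e₃ h) = e₃ (ξ₁.opp h))
    (h31 : ξ₃.rot (e₃ a) = e₃ d) (h32 : ξ₃.rot (e₃ d) = e₃ b) (h33 : ξ₃.rot (e₃ b) = e₃ a)
    (h34 : ξ₃.rot (e₃ a') = e₃ c) (h35 : ξ₃.rot (e₃ c) = e₃ g) (h36 : ξ₃.rot (e₃ g) = e₃ a')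
    (hrot₃ : ∀ h, h ≠ a → h ≠ b → h ≠ c → h ≠ a' → h ≠ d → h ≠ g →
      ξ₃.rot (e₃ h) = e₃ (ξ₁.rot h))
    (hcol₃ : ∀ (h : ξ₁.External) (h' : ξ₃.External), e₃ h.1 = h'.1 → ξ₃.color h' = ξ₁.color h) :
    ξ₁.toB + ξ₂.toB + ξ₃.toB = 0 := by
  classical
  have hinj := ξ₁.rot.injective
  obtain ⟨-, hca, hga, ρ, hρ, r1, r2, r3, r4, r5, r6, r7⟩ :=
    jacobi_perm ha' hb hc hd hg hab had ha'b ha'c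
  have i1 : ρ⁻¹ a = a := Equiv.Perm.inv_eq_iff_eq.2 r1.symm
  have i2 : ρ⁻¹ c = b := Equiv.Perm.inv_eq_iff_eq.2 r2.symm
  have i3 : ρ⁻¹ d = c := Equiv.Perm.inv_eq_iff_eq.2 r3.symm
  have i4 : ρ⁻¹ b = d := Equiv.Perm.inv_eq_iff_eq.2 r4.symm
  have i5 : ρ⁻¹ a' = a' := Equiv.Perm.inv_eq_iff_eq.2 r5.symm
  have i6 : ρ⁻¹ g = g := Equiv.Perm.inv_eq_iff_eq.2 r6.symm
  have i7 : ∀ h, h ≠ b → h ≠ c → h ≠ d → ρ⁻¹ h = h := fun h h1 h2 h3 =>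
    Equiv.Perm.inv_eq_iff_eq.2 (r7 h h1 h2 h3).symm
  have hcases : ∀ h, h = a ∨ h = b ∨ h = c ∨ h = a' ∨ h = d ∨ h = g ∨
      ((h ≠ a ∧ h ≠ b ∧ h ≠ c ∧ h ≠ a' ∧ h ≠ d ∧ h ≠ g) ∧
        ξ₁.rot h ≠ b ∧ ξ₁.rot h ≠ c ∧ ξ₁.rot h ≠ d) := by
    intro h
    by_cases h1 : h = a
    · tauto
    by_cases h2 : h = b
    · tauto
    by_cases h3 : h = a'
    · tauto
    have h4 : ξ₁.rot h ≠ b := fun h' => h1 (hinj (h'.trans hb.symm))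
    have h5 : ξ₁.rot h ≠ c := fun h' => h2 (hinj (h'.trans hc.symm))
    have h6 : ξ₁.rot h ≠ d := fun h' => h3 (hinj (h'.trans hd.symm))
    tauto
  refine toB_add_toB_add_toB (inst := Classical.decEq _) a b c d hb.symm hc.symm (by rw [ha', hd]) hab (by rwa [ha'])
    (by rwa [ha']) (by rwa [ha']) ⟨e₂, hopp₂, fun h => ?_, hcol₂⟩ ⟨e₃, hopp₃, fun h => ?_, hcol₃⟩
  · rw [← hρ]
    rcases hcases h with rfl | rfl | rfl | rfl | rfl | rfl | ⟨⟨h1, h2, h3, h4, h5, h6⟩, h7, h8, h9⟩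
    · rw [r1, hb, r2, h21]
    · rw [r2, hc, r3, h22]
    · rw [r3, hca, r1, h23]
    · rw [r5, hd, r4, h24]
    · rw [r4, hg, r6, h25]
    · rw [r6, hga, r5, h26]
    · rw [r7 h h2 h3 h5, r7 _ h7 h8 h9, hrot₂ h h1 h2 h3 h4 h5 h6]
  · rw [← hρ]
    rcases hcases h with rfl | rfl | rfl | rfl | rfl | rfl | ⟨⟨h1, h2, h3, h4, h5, h6⟩, h7, h8, h9⟩
    · rw [i1, hb, i4, h31]
    · rw [i4, hc, i2, h32]
    · rw [i2, hca, i1, h33]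
    · rw [i5, hd, i3, h34]
    · rw [i3, hg, i6, h35]
    · rw [i6, hga, i5, h36]
    · rw [i7 h h2 h3 h5, i7 _ h7 h8 h9, hrot₃ h h1 h2 h3 h4 h5 h6]

end SpaceB

open MarkedCharacter ChineseCharacter

/-! ### Gluing and recolouring as linear operators on `SpaceB` -/

namespace MarkedCharacter

variable {n m : ℕ} {ξ ξ' : MarkedCharacter n}

theorem Reattach.recolor {ρ : Equiv.Perm ξ.H} (h : ξ.Reattach ρ ξ') (κ : Fin n → Fin m) :
    (ξ.recolor κ).Reattach ρ (ξ'.recolor κ) := by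
  obtain ⟨e, h1, h2, h3⟩ := h
  exact ⟨e, h1, h2, fun x y hxy => congrArg κ (h3 x y hxy)⟩

open Classical in
/-- The class of the character in which the only legs of colours `x` and `y` are joined, if there
are such legs. -/
def glueTerm (x y : Fin n) (ξ : MarkedCharacter n) : SpaceB n :=
  if h : x ≠ y ∧ (∃ b, ξ.IsOnly x b) ∧ ∃ c, ξ.IsOnly y c then
    (ξ.glue h.2.1.choose h.2.2.choose (h.2.1.choose_spec.ne h.2.2.choose_spec h.1) x).toB
  else 0

theorem glueTerm_eq {x y : Fin n} (hxy : x ≠ y) {b c : ξ.External} (hb : ξ.IsOnly x b)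
    (hc : ξ.IsOnly y c) : glueTerm x y ξ = (ξ.glue b c (hb.ne hc hxy) x).toB := by
  have h : x ≠ y ∧ (∃ b, ξ.IsOnly x b) ∧ ∃ c, ξ.IsOnly y c := ⟨hxy, ⟨b, hb⟩, c, hc⟩
  obtain rfl := h.2.1.choose_spec.unique hb
  obtain rfl := h.2.2.choose_spec.unique hc
  rw [glueTerm, dif_pos h]

theorem glueTerm_eq_zero {x y : Fin n}
    (h : ¬ (x ≠ y ∧ (∃ b, ξ.IsOnly x b) ∧ ∃ c, ξ.IsOnly y c)) : glueTerm x y ξ = 0 := by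
  rw [glueTerm, dif_neg h]

section

variable {ρ : Equiv.Perm ξ.H} {e : ξ.H ≃ ξ'.H}

theorem Reattach.exists_isOnly (h : ξ.Reattach ρ ξ') (hρ : ∀ h, ξ.rot h = h → ρ h = h) (x : Fin n) :
    (∃ b, ξ.IsOnly x b) ↔ ∃ b, ξ'.IsOnly x b := by
  obtain ⟨e, h1, h2, h3⟩ := h
  constructor
  · rintro ⟨b, hb⟩
    exact ⟨_, (reattach_isOnly hρ h2 h3).1 hb⟩
  · rintro ⟨b, hb⟩
    obtain ⟨b, rfl⟩ := (reattachEquiv hρ h2).surjective b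
    exact ⟨b, (reattach_isOnly hρ h2 h3).2 hb⟩

theorem Reattach.glue (h : ξ.Reattach ρ ξ') (hρ : ∀ h, ξ.rot h = h → ρ h = h) {x y : Fin n}
    (hxy : x ≠ y) {b c : ξ.External} (hb : ξ.IsOnly x b) (hc : ξ.IsOnly y c) :
    ∃ ζ : MarkedCharacter n, (ξ.glue b c (hb.ne hc hxy) x).Reattach (Equiv.Perm.sumCongr ρ 1) ζ ∧
      glueTerm x y ξ' = ζ.toB := by
  obtain ⟨e, h1, h2, h3⟩ := h
  have hb' := (reattach_isOnly hρ h2 h3).1 hb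
  have hc' := (reattach_isOnly hρ h2 h3).1 hc
  exact ⟨_, reattach_glue hρ h1 h2 h3 _ _ (hb'.ne hc' hxy), glueTerm_eq hxy hb' hc'⟩

theorem Reattach.glueTerm_eq_zero (h : ξ.Reattach ρ ξ') (hρ : ∀ h, ξ.rot h = h → ρ h = h)
    {x y : Fin n} (h0 : ¬ (x ≠ y ∧ (∃ b, ξ.IsOnly x b) ∧ ∃ c, ξ.IsOnly y c)) :
    glueTerm x y ξ' = 0 :=
  MarkedCharacter.glueTerm_eq_zero fun h' => h0
    ⟨h'.1, (h.exists_isOnly hρ x).2 h'.2.1, (h.exists_isOnly hρ y).2 h'.2.2⟩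

end

theorem glue_rot_inl_of_ne {b c : ξ.External} (hbc : b ≠ c) (x : Fin n) {a : ξ.H}
    (ha : ξ.rot a ≠ a) : (ξ.glue b c hbc x).rot (Sum.inl a) = Sum.inl (ξ.rot a) :=
  glueRot_of_ne (fun h => ha (by rw [h, b.2])) (fun h => ha (by rw [h, c.2]))

theorem rot_rot_ne {a : ξ.H} (ha : ξ.rot a ≠ a) : ξ.rot (ξ.rot a) ≠ ξ.rot a :=
  fun h => ha (ξ.rot.injective h)

/-- Antisymmetry and Jacobi involve trivalent vertices only, so each relation reappears among the
glued characters. Whether the legs of colours `x` and `y` exist and are unique is the same for all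
terms of a relation; if they are not, all terms are zero. -/
theorem respectsB_glueTerm (x y : Fin n) : RespectsB (glueTerm x y) where
  homeo ξ ξ' h := by
    by_cases h0 : x ≠ y ∧ (∃ b, ξ.IsOnly x b) ∧ ∃ c, ξ.IsOnly y c
    · obtain ⟨hxy, ⟨b, hb⟩, c, hc⟩ := h0
      obtain ⟨ζ, hζ, hζ'⟩ := h.glue (fun _ _ => rfl) hxy hb hc
      rw [glueTerm_eq hxy hb hc, hζ']
      refine toB_eq ?_
      rwa [Equiv.Perm.sumCongr_one] at hζ
    · rw [glueTerm_eq_zero h0, h.glueTerm_eq_zero (fun _ _ => rfl) h0]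
  antisymm ξ₁ ξ₂ a ha h := by
    classical
    by_cases h0 : x ≠ y ∧ (∃ b, ξ₁.IsOnly x b) ∧ ∃ c, ξ₁.IsOnly y c
    · obtain ⟨hxy, ⟨b, hb⟩, c, hc⟩ := h0
      obtain ⟨ζ, hζ, hζ'⟩ := h.glue (swap_fixes_external ha) hxy hb hc
      rw [glueTerm_eq hxy hb hc, hζ']
      rw [Equiv.Perm.sumCongr_swap_one] at hζ
      have h1 := glue_rot_inl_of_ne (hb.ne hc hxy) x ha
      have h2 := glue_rot_inl_of_ne (hb.ne hc hxy) x (rot_rot_ne ha)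
      rw [← h2, ← h1] at hζ
      exact @toB_add_toB _ _ _ _ (Sum.inl a) (by rw [h1]; exact fun h' => ha (Sum.inl.inj h')) hζ
    · rw [glueTerm_eq_zero h0, h.glueTerm_eq_zero (swap_fixes_external ha) h0, add_zero]
  jacobi ξ₁ ξ₂ ξ₃ a b c d hb hc hd ha ha' hab hac h2 h3 := by
    classical
    subst hb hc hd
    have hρ := cycle_fixes_external ha ha'
    have hρ' : ∀ h, ξ₁.rot h = h → (Equiv.swap (ξ₁.rot a) (ξ₁.rot (ξ₁.rot a)) *
        Equiv.swap (ξ₁.rot (ξ₁.rot a)) (ξ₁.rot (ξ₁.opp a)))⁻¹ h = h := by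
      intro h hh
      rw [Equiv.Perm.inv_eq_iff_eq, hρ h hh]
    by_cases h0 : x ≠ y ∧ (∃ b, ξ₁.IsOnly x b) ∧ ∃ c, ξ₁.IsOnly y c
    · obtain ⟨hxy, ⟨b, hb⟩, c, hc⟩ := h0
      obtain ⟨ζ₂, hζ₂, hζ₂'⟩ := h2.glue hρ hxy hb hc
      obtain ⟨ζ₃, hζ₃, hζ₃'⟩ := h3.glue hρ' hxy hb hc
      rw [glueTerm_eq hxy hb hc, hζ₂', hζ₃']
      have e1 := glue_rot_inl_of_ne (hb.ne hc hxy) x ha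
      have e2 := glue_rot_inl_of_ne (hb.ne hc hxy) x (rot_rot_ne ha)
      have e3 := glue_rot_inl_of_ne (hb.ne hc hxy) x ha'
      have e4 : (ξ₁.glue b c (hb.ne hc hxy) x).opp (Sum.inl a) = Sum.inl (ξ₁.opp a) := rfl
      have hcyc : Equiv.Perm.sumCongr (Equiv.swap (ξ₁.rot a) (ξ₁.rot (ξ₁.rot a)) *
          Equiv.swap (ξ₁.rot (ξ₁.rot a)) (ξ₁.rot (ξ₁.opp a))) (1 : Equiv.Perm Bool) =
          Equiv.swap (Sum.inl (ξ₁.rot a)) (Sum.inl (ξ₁.rot (ξ₁.rot a))) *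
          Equiv.swap (Sum.inl (ξ₁.rot (ξ₁.rot a))) (Sum.inl (ξ₁.rot (ξ₁.opp a))) := by
        rw [← Equiv.Perm.sumCongr_swap_one, ← Equiv.Perm.sumCongr_swap_one,
          Equiv.Perm.sumCongr_mul, one_mul]
      have : Equiv.Perm.sumCongr (Equiv.swap (ξ₁.rot a) (ξ₁.rot (ξ₁.rot a)) *
          Equiv.swap (ξ₁.rot (ξ₁.rot a)) (ξ₁.rot (ξ₁.opp a)))⁻¹ (1 : Equiv.Perm Bool) =
          (Equiv.Perm.sumCongr (Equiv.swap (ξ₁.rot a) (ξ₁.rot (ξ₁.rot a)) *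
          Equiv.swap (ξ₁.rot (ξ₁.rot a)) (ξ₁.rot (ξ₁.opp a))) (1 : Equiv.Perm Bool))⁻¹ := by
          rw [Equiv.Perm.sumCongr_inv, inv_one]
      rw [this, hcyc] at hζ₃
      rw [hcyc] at hζ₂
      exact @toB_add_toB_add_toB _ _ _ _ _ (Sum.inl a) (Sum.inl (ξ₁.rot a))
        (Sum.inl (ξ₁.rot (ξ₁.rot a))) (Sum.inl (ξ₁.rot (ξ₁.opp a))) e1.symm e2.symm
        (by rw [e4, e3]) (fun h => ha (Sum.inl.inj h)) (fun h => ha' (Sum.inl.inj h))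
        (fun h => hab (Sum.inl.inj h)) (fun h => hac (Sum.inl.inj h)) hζ₂ hζ₃
    · rw [glueTerm_eq_zero h0, h2.glueTerm_eq_zero hρ h0, h3.glueTerm_eq_zero hρ' h0]
      simp

theorem glue_isOnly_new {x y : Fin n} (hxy : x ≠ y) {b c : ξ.External} (hb : ξ.IsOnly x b)
    (hc : ξ.IsOnly y c) :
    (ξ.glue b c (hb.ne hc hxy) x).IsOnly x (newLeg (hb.ne hc hxy)) := by
  refine glue_external_cases (hb.ne hc hxy) ?_ ?_
  · exact ⟨fun _ => rfl, fun _ => rfl⟩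
  · intro h h1 h2
    refine ⟨fun h' => absurd ((hb h).1 h') h1, fun h' => ?_⟩
    exact absurd (congrArg Subtype.val h') Sum.inl_ne_inr

theorem glue_isOnly_old {x y z : Fin n} (hxy : x ≠ y) (hxz : x ≠ z) (hyz : y ≠ z)
    {b c d : ξ.External} (hb : ξ.IsOnly x b) (hc : ξ.IsOnly y c) (hd : ξ.IsOnly z d) :
    (ξ.glue b c (hb.ne hc hxy) x).IsOnly z
      (glueLeg (hb.ne hc hxy) d (hb.ne hd hxz).symm (hc.ne hd hyz).symm) := by
  refine glue_external_cases (hb.ne hc hxy) ?_ ?_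
  · refine ⟨fun h => absurd h hxz, fun h' => ?_⟩
    exact absurd (congrArg Subtype.val h').symm Sum.inl_ne_inr
  · intro h h1 h2
    refine ⟨fun h' => ?_, fun h' => ?_⟩
    · obtain rfl := (hd h).1 h'
      rfl
    · have := Sum.inl.inj (congrArg Subtype.val h')
      exact (hd h).2 (Subtype.ext this)

/-- Gluing does not create a unique leg of a third colour. This makes both sides of the operator
identities vanish when one of the labels involved is not carried by exactly one leg. -/
theorem exists_isOnly_of_glue {x y z : Fin n} (hxy : x ≠ y) (hxz : x ≠ z) (hyz : y ≠ z)
    {b c : ξ.External} (hb : ξ.IsOnly x b) (hc : ξ.IsOnly y c)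
    (h : ∃ d, (ξ.glue b c (hb.ne hc hxy) x).IsOnly z d) : ∃ d, ξ.IsOnly z d := by
  obtain ⟨d, hd⟩ := h
  revert hd
  refine glue_external_cases (hb.ne hc hxy) (P := fun d => (ξ.glue b c (hb.ne hc hxy) x).IsOnly z d → _) ?_ ?_ d
  · intro h
    exact absurd h.color_eq hxz
  · intro d h1 h2 hd
    refine ⟨d, fun h => ⟨fun h' => ?_, fun h' => ?_⟩⟩
    · have hb' : h ≠ b := fun h'' => hxz (hb.color_eq.symm.trans (h'' ▸ h'))
      have hc' : h ≠ c := fun h'' => hyz (hc.color_eq.symm.trans (h'' ▸ h'))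
      have := (hd (glueLeg (hb.ne hc hxy) h hb' hc')).1 h'
      exact Subtype.ext (Sum.inl.inj (congrArg Subtype.val this))
    · rw [h']
      exact hd.color_eq

end MarkedCharacter

section

variable {n m : ℕ}

theorem respectsB_recolor (κ : Fin n → Fin m) :
    RespectsB (fun ξ : MarkedCharacter n => (ξ.recolor κ).toB) where
  homeo _ _ h := toB_eq (h.recolor κ)
  antisymm ξ _ a ha h := toB_add_toB (ξ₁ := ξ.recolor κ) a ha (h.recolor κ)
  jacobi ξ _ _ a b c d hb hc hd ha ha' hab hac h2 h3 :=
    toB_add_toB_add_toB (ξ₁ := ξ.recolor κ) a b c d hb hc hd ha ha' hab hac (h2.recolor κ) (h3.recolor κ)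

/-- The recolouring map. -/
def recolorB (κ : Fin n → Fin m) : SpaceB n →ₗ[ℚ] SpaceB m := liftB _ (respectsB_recolor κ)

@[simp]
theorem recolorB_toB (κ : Fin n → Fin m) (ξ : MarkedCharacter n) :
    recolorB κ ξ.toB = (ξ.recolor κ).toB := liftB_toB _ _ _

/-- Joining the legs of the colours `x` and `y`. -/
def glueB (x y : Fin n) : SpaceB n →ₗ[ℚ] SpaceB n := liftB _ (respectsB_glueTerm x y)

theorem glueB_toB (x y : Fin n) (ξ : MarkedCharacter n) : glueB x y ξ.toB = glueTerm x y ξ :=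
  liftB_toB _ _ _

theorem glueB_toB_eq {ξ : MarkedCharacter n} {x y : Fin n} (hxy : x ≠ y) {b c : ξ.External}
    (hb : ξ.IsOnly x b) (hc : ξ.IsOnly y c) :
    glueB x y ξ.toB = (ξ.glue b c (hb.ne hc hxy) x).toB := by
  rw [glueB_toB, glueTerm_eq hxy hb hc]

theorem glueB_toB_eq_zero {ξ : MarkedCharacter n} {x y : Fin n}
    (h : ¬ ((∃ b, ξ.IsOnly x b) ∧ ∃ c, ξ.IsOnly y c)) : glueB x y ξ.toB = 0 := by
  rw [glueB_toB, glueTerm_eq_zero fun h' => h h'.2]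

theorem glueB_glueB_eq_zero {ξ : MarkedCharacter n} {x y z w : Fin n} (hxy : x ≠ y)
    (h : (∃ b, ξ.IsOnly x b) → (∃ c, ξ.IsOnly y c) →
      (w ≠ x ∧ w ≠ y ∧ ¬ ∃ d, ξ.IsOnly w d) ∨ z ≠ x ∧ z ≠ y ∧ ¬ ∃ d, ξ.IsOnly z d) :
    glueB z w (glueB x y ξ.toB) = 0 := by
  by_cases h0 : (∃ b, ξ.IsOnly x b) ∧ ∃ c, ξ.IsOnly y c
  · obtain ⟨⟨b, hb⟩, c, hc⟩ := h0
    rw [glueB_toB_eq hxy hb hc, glueB_toB_eq_zero]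
    rintro ⟨hz, hw⟩
    rcases h ⟨b, hb⟩ ⟨c, hc⟩ with ⟨h1, h2, h3⟩ | ⟨h1, h2, h3⟩
    · exact h3 (exists_isOnly_of_glue hxy h1.symm h2.symm hb hc hw)
    · exact h3 (exists_isOnly_of_glue hxy h1.symm h2.symm hb hc hz)
  · rw [glueB_toB_eq_zero h0, map_zero]

/-- Joining `b` with `c` or `c` with `b` gives the same graph with opposite cyclic orders at the new
vertex. The recolourings allow the new leg to have different colours in the two graphs before they
are compared. -/
theorem toB_glue_add_toB_glue (ξ : MarkedCharacter n) {b c : ξ.External} (hbc : b ≠ c)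
    {κ κ' : Fin n → Fin m} {x x' : Fin n} (hx : κ x = κ' x')
    (hκ : ∀ h, h ≠ b → h ≠ c → κ (ξ.color h) = κ' (ξ.color h)) :
    ((ξ.glue b c hbc x).recolor κ).toB + ((ξ.glue c b hbc.symm x').recolor κ').toB = 0 := by
  refine toB_add_toB_of (ξ₁ := (ξ.glue b c hbc x).recolor κ)
    (ξ₂ := (ξ.glue c b hbc.symm x').recolor κ') (a := Sum.inr true)
    (b := Sum.inl c.1) (c := Sum.inl b.1) glueRot_true (glueRot_right hbc) Sum.inl_ne_inr
    (Equiv.refl (ξ.H ⊕ Bool)) (fun h => rfl) glueRot_true (glueRot_right hbc.symm)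
    (glueRot_left hbc.symm) ?_ ?_
  · rintro (h | _ | _) h1 h2 h3
    · have hb : h ≠ b.1 := fun h' => h3 (congrArg Sum.inl h')
      have hc : h ≠ c.1 := fun h' => h2 (congrArg Sum.inl h')
      exact (glueRot_of_ne hc hb).trans (glueRot_of_ne hb hc).symm
    · exact (glueRot_false (b := c) (c := b)).trans (glueRot_false (b := b) (c := c)).symm
    · exact absurd rfl h1
  · rintro ⟨h | t, hy⟩ ⟨h' | t', hy'⟩ hh
    · obtain rfl := Sum.inl.inj hh
      obtain ⟨h1, h2, h3⟩ := (glueRot_inl_eq_self hbc).1 hy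
      exact (hκ ⟨h, h1⟩ (fun h' => h2 (congrArg Subtype.val h'))
        fun h' => h3 (congrArg Subtype.val h')).symm
    · exact absurd hh Sum.inl_ne_inr
    · exact absurd hh Sum.inr_ne_inl
    · exact hx.symm

theorem toB_glue_eq_neg (ξ : MarkedCharacter n) {b c : ξ.External} (hbc : b ≠ c) (x : Fin n) :
    (ξ.glue c b hbc.symm x).toB = -(ξ.glue b c hbc x).toB :=
  eq_neg_of_add_eq_zero_right (toB_glue_add_toB_glue ξ hbc (κ := id) (κ' := id) rfl fun _ _ _ => rfl)

theorem glueB_antisymm {x y : Fin n} (hxy : x ≠ y) (v : SpaceB n) :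
    glueB y x v = -recolorB (Equiv.swap x y) (glueB x y v) := by
  suffices h : glueB y x = -(recolorB (Equiv.swap x y) ∘ₗ glueB x y) from LinearMap.congr_fun h v
  refine linearMapB_ext fun ξ => ?_
  simp only [LinearMap.neg_apply, LinearMap.comp_apply]
  by_cases h : (∃ b, ξ.IsOnly x b) ∧ ∃ c, ξ.IsOnly y c
  · obtain ⟨⟨b, hb⟩, c, hc⟩ := h
    rw [glueB_toB_eq hxy hb hc, glueB_toB_eq hxy.symm hc hb, recolorB_toB, eq_neg_iff_add_eq_zero,
      add_comm]
    refine toB_glue_add_toB_glue ξ (hb.ne hc hxy) (κ := Equiv.swap x y) (κ' := id) (by simp) ?_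
    intro h h1 h2
    rw [Equiv.swap_apply_of_ne_of_ne (fun h' => h1 ((hb h).1 h')) (fun h' => h2 ((hc h).1 h'))]
    rfl
  · rw [glueB_toB_eq_zero h, glueB_toB_eq_zero fun h' => h ⟨h'.2, h'.1⟩, map_zero, neg_zero]

theorem MarkedCharacter.IsOnly.recolor {ξ : MarkedCharacter n} {κ : Fin n → Fin m}
    (hκ : Function.Injective κ) {x : Fin n} {b : ξ.External} :
    (ξ.recolor κ).IsOnly (κ x) b ↔ ξ.IsOnly x b :=
  forall_congr' fun h => by
    change (κ (ξ.color h) = κ x ↔ _) ↔ _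
    rw [hκ.eq_iff]
    rfl

theorem glueB_recolorB {κ : Fin n → Fin m} (hκ : Function.Injective κ) {x y : Fin n} (hxy : x ≠ y)
    (v : SpaceB n) : glueB (κ x) (κ y) (recolorB κ v) = recolorB κ (glueB x y v) := by
  suffices h : glueB (κ x) (κ y) ∘ₗ recolorB κ = recolorB κ ∘ₗ glueB x y from
    LinearMap.congr_fun h v
  refine linearMapB_ext fun ξ => ?_
  simp only [LinearMap.comp_apply, recolorB_toB]
  by_cases h : (∃ b, ξ.IsOnly x b) ∧ ∃ c, ξ.IsOnly y c
  · obtain ⟨⟨b, hb⟩, c, hc⟩ := h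
    rw [glueB_toB_eq hxy hb hc, glueB_toB_eq (fun h' => hxy (hκ h'))
      ((IsOnly.recolor hκ).2 hb) ((IsOnly.recolor hκ).2 hc), recolorB_toB]
    refine toB_eq ⟨Equiv.refl _, fun _ => rfl, fun _ => rfl, ?_⟩
    rintro ⟨h | t, hy⟩ ⟨h' | t', hy'⟩ hh
    · obtain rfl := Sum.inl.inj hh
      rfl
    · exact absurd hh Sum.inl_ne_inr
    · exact absurd hh Sum.inr_ne_inl
    · rfl
  · rw [glueB_toB_eq_zero h, map_zero, glueB_toB_eq_zero]
    rintro ⟨⟨b, hb⟩, c, hc⟩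
    exact h ⟨⟨b, (IsOnly.recolor hκ).1 hb⟩, c, (IsOnly.recolor hκ).1 hc⟩

theorem recolorB_recolorB {k : ℕ} (κ : Fin n → Fin m) (κ' : Fin m → Fin k) (v : SpaceB n) :
    recolorB κ' (recolorB κ v) = recolorB (κ' ∘ κ) v := by
  suffices h : recolorB κ' ∘ₗ recolorB κ = recolorB (κ' ∘ κ) from LinearMap.congr_fun h v
  refine linearMapB_ext fun ξ => ?_
  simp only [LinearMap.comp_apply, recolorB_toB]
  rfl

theorem glueB_comm {x y z w : Fin n} (hxy : x ≠ y) (hxz : x ≠ z) (hxw : x ≠ w) (hyz : y ≠ z)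
    (hyw : y ≠ w) (hzw : z ≠ w) (v : SpaceB n) :
    glueB x y (glueB z w v) = glueB z w (glueB x y v) := by
  suffices h : glueB x y ∘ₗ glueB z w = glueB z w ∘ₗ glueB x y from LinearMap.congr_fun h v
  refine linearMapB_ext fun ξ => ?_
  simp only [LinearMap.comp_apply]
  by_cases h : ((∃ b, ξ.IsOnly x b) ∧ ∃ c, ξ.IsOnly y c) ∧
    ((∃ b, ξ.IsOnly z b) ∧ ∃ c, ξ.IsOnly w c)
  · obtain ⟨⟨⟨b, hb⟩, c, hc⟩, ⟨d, hd⟩, e, he⟩ := h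
    rw [glueB_toB_eq hxy hb hc, glueB_toB_eq hzw hd he,
      glueB_toB_eq hxy (glue_isOnly_old hzw hxz.symm hxw.symm hd he hb)
        (glue_isOnly_old hzw hyz.symm hyw.symm hd he hc),
      glueB_toB_eq hzw (glue_isOnly_old hxy hxz hyz hb hc hd)
        (glue_isOnly_old hxy hxw hyw hb hc he)]
    -- The two orders of gluing give the same graph, except that the two new edges are adjoined in
    -- the opposite order.
    let E₀ : (ξ.H ⊕ Bool) ⊕ Bool ≃ (ξ.H ⊕ Bool) ⊕ Bool :=
      ((Equiv.sumAssoc _ _ _).trans (Equiv.sumCongr (Equiv.refl _) (Equiv.sumComm _ _))).trans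
        (Equiv.sumAssoc _ _ _).symm
    have nbd : b.1 ≠ d.1 := fun h => hb.ne hd hxz (Subtype.ext h)
    have nbe : b.1 ≠ e.1 := fun h => hb.ne he hxw (Subtype.ext h)
    have ncd : c.1 ≠ d.1 := fun h => hc.ne hd hyz (Subtype.ext h)
    have nce : c.1 ≠ e.1 := fun h => hc.ne he hyw (Subtype.ext h)
    have hbc := hb.ne hc hxy
    have hde := hd.ne he hzw
    have inl2 : ∀ {u v : ξ.H}, u ≠ v → (Sum.inl u : ξ.H ⊕ Bool) ≠ Sum.inl v :=
      fun h h' => h (Sum.inl.inj h')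
    have hB := glue_isOnly_old hzw hxz.symm hxw.symm hd he hb
    have hC := glue_isOnly_old hzw hyz.symm hyw.symm hd he hc
    have hD := glue_isOnly_old hxy hxz hyz hb hc hd
    have hE := glue_isOnly_old hxy hxw hyw hb hc he
    have hBC := hB.ne hC hxy
    have hDE := hD.ne hE hzw
    let X₁ := (ξ.glue d e hde z).glue _ _ hBC x
    let X₂ := (ξ.glue b c hbc x).glue _ _ hDE z
    let E : X₁.H ≃ X₂.H := E₀
    refine toB_eq ⟨E, ?_, ?_, ?_⟩
    · rintro ((h | t) | t) <;> rfl
    · have key : ∀ h u, X₁.rot h = u → X₂.rot (E h) = E u → X₂.rot (E h) = E (X₁.rot h) :=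
        fun h u h1 h2 => by rw [h1, h2]
      rintro ((h | _ | _) | _ | _)
      · by_cases h1 : h = c
        · subst h1
          exact key _ _ (glueRot_right hBC) ((glueRot_of_ne (inl2 ncd) (inl2 nce)).trans
            (congrArg Sum.inl (glueRot_right hbc)))
        by_cases h2 : h = b
        · subst h2
          exact key _ _ (glueRot_left hBC) ((glueRot_of_ne (inl2 nbd) (inl2 nbe)).trans
            (congrArg Sum.inl (glueRot_left hbc)))
        by_cases h3 : h = e
        · subst h3
          exact key _ _ ((glueRot_of_ne (inl2 nbe.symm) (inl2 nce.symm)).trans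
            (congrArg Sum.inl (glueRot_right hde))) (glueRot_right hDE)
        by_cases h4 : h = d
        · subst h4
          exact key _ _ ((glueRot_of_ne (inl2 nbd.symm) (inl2 ncd.symm)).trans
            (congrArg Sum.inl (glueRot_left hde))) (glueRot_left hDE)
        · exact key _ _ ((glueRot_of_ne (inl2 h2) (inl2 h1)).trans
            (congrArg Sum.inl (glueRot_of_ne h4 h3))) ((glueRot_of_ne (inl2 h4) (inl2 h3)).trans
            (congrArg Sum.inl (glueRot_of_ne h2 h1)))
      · exact key _ _ ((glueRot_of_ne Sum.inr_ne_inl Sum.inr_ne_inl).trans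
          (congrArg Sum.inl glueRot_false)) glueRot_false
      · exact key _ _ ((glueRot_of_ne Sum.inr_ne_inl Sum.inr_ne_inl).trans
          (congrArg Sum.inl glueRot_true)) glueRot_true
      · exact key _ _ glueRot_false ((glueRot_of_ne Sum.inr_ne_inl Sum.inr_ne_inl).trans
          (congrArg Sum.inl glueRot_false))
      · exact key _ _ glueRot_true ((glueRot_of_ne Sum.inr_ne_inl Sum.inr_ne_inl).trans
          (congrArg Sum.inl glueRot_true))
    · rintro ⟨(h | t) | t, hy⟩ ⟨(h' | t') | t', hy'⟩ hh
      · obtain rfl := Sum.inl.inj (Sum.inl.inj hh)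
        rfl
      · exact absurd (Sum.inl.inj hh) Sum.inl_ne_inr
      · exact absurd hh Sum.inl_ne_inr
      · exact absurd hh Sum.inr_ne_inl
      · exact absurd hh Sum.inr_ne_inl
      · rfl
      · exact absurd (Sum.inl.inj hh) Sum.inr_ne_inl
      · rfl
      · exact absurd hh Sum.inl_ne_inr
  · rw [glueB_glueB_eq_zero hzw, glueB_glueB_eq_zero hxy]
    · intro h1 h2
      by_cases h3 : ∃ b, ξ.IsOnly z b
      · exact Or.inl ⟨hxw.symm, hyw.symm, fun h4 => h ⟨⟨h1, h2⟩, h3, h4⟩⟩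
      · exact Or.inr ⟨hxz.symm, hyz.symm, h3⟩
    · intro h1 h2
      by_cases h3 : ∃ b, ξ.IsOnly x b
      · exact Or.inl ⟨hyz, hyw, fun h4 => h ⟨⟨h3, h4⟩, h1, h2⟩⟩
      · exact Or.inr ⟨hxz, hxw, h3⟩

/-- The three iterated brackets of the legs `p`, `q`, `r` are trees with these three ends and a new
leg, joined at the rest of the graph; they are the three terms of one IHX relation. Its edge is the
one adjoined by the first gluing of the term `[[p, q], r]`. -/
theorem glueB_jacobi {x y z : Fin n} (hxy : x ≠ y) (hxz : x ≠ z) (hyz : y ≠ z) (v : SpaceB n) :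
    glueB x z (glueB x y v) - glueB x y (glueB x z v) = glueB x y (glueB y z v) := by
  suffices h : glueB x z ∘ₗ glueB x y - glueB x y ∘ₗ glueB x z = glueB x y ∘ₗ glueB y z from
    LinearMap.congr_fun h v
  refine linearMapB_ext fun ξ => ?_
  simp only [LinearMap.comp_apply, LinearMap.sub_apply]
  by_cases h : (∃ b, ξ.IsOnly x b) ∧ (∃ c, ξ.IsOnly y c) ∧ ∃ d, ξ.IsOnly z d
  · obtain ⟨⟨p, hp⟩, ⟨q, hq⟩, r, hr⟩ := h
    have hpq := hp.ne hq hxy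
    have hpr := hp.ne hr hxz
    have hqr := hq.ne hr hyz
    have hR := glue_isOnly_old hxy hxz hyz hp hq hr
    have hQ := glue_isOnly_old hxz hxy hyz.symm hp hr hq
    have hP := glue_isOnly_old hyz hxy.symm hxz.symm hq hr hp
    have nR : newLeg hpq ≠ glueLeg hpq r hpr.symm hqr.symm :=
      (glue_isOnly_new hxy hp hq).ne hR hxz
    have nQ : newLeg hpr ≠ glueLeg hpr q hpq.symm hqr :=
      (glue_isOnly_new hxz hp hr).ne hQ hxy
    have nP : glueLeg hqr p hpq hpr ≠ newLeg hqr :=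
      hP.ne (glue_isOnly_new hyz hq hr) hxy
    have nQ' : newLeg hpr.symm ≠ glueLeg hpr.symm q hqr hpq.symm :=
      fun h => Sum.inr_ne_inl (congrArg Subtype.val h)
    have nP' : glueLeg hqr.symm p hpr hpq ≠ newLeg hqr.symm :=
      fun h => Sum.inl_ne_inr (congrArg Subtype.val h)
    -- The first gluing is reversed, with a sign, in order that the cyclic orders become those
    -- required by the Jacobi relation. The same is done in `e3`.
    have e2 : glueB x y (glueB x z ξ.toB) =
        -((ξ.glue r p hpr.symm x).glue (newLeg hpr.symm)
          (glueLeg hpr.symm q hqr hpq.symm) nQ' x).toB := by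
      have h1 : (ξ.glue p r hpr x).toB = -(ξ.glue r p hpr.symm x).toB :=
        toB_glue_eq_neg ξ hpr.symm x
      have h2 : IsOnly (ξ.glue r p hpr.symm x) x (newLeg hpr.symm) := by
        refine glue_external_cases hpr.symm ⟨fun _ => rfl, fun _ => rfl⟩ fun h h1 h2 =>
          ⟨fun h' => absurd ((hp h).1 h') h2, fun h' => ?_⟩
        exact absurd (congrArg Subtype.val h') Sum.inl_ne_inr
      have h3 : IsOnly (ξ.glue r p hpr.symm x) y (glueLeg hpr.symm q hqr hpq.symm) := by
        refine glue_external_cases hpr.symm ⟨fun h => absurd h hxy, fun h' => ?_⟩ fun h h1 h2 =>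
          ⟨fun h' => ?_, fun h' => ?_⟩
        · exact absurd (congrArg Subtype.val h').symm Sum.inl_ne_inr
        · obtain rfl := (hq h).1 h'
          rfl
        · exact (hq h).2 (Subtype.ext (Sum.inl.inj (congrArg Subtype.val h')))
      rw [glueB_toB_eq hxz hp hr, h1, map_neg, glueB_toB_eq hxy h2 h3]
    have e3 : glueB x y (glueB y z ξ.toB) =
        -((ξ.glue r q hqr.symm y).glue (glueLeg hqr.symm p hpr hpq) (newLeg hqr.symm) nP' x).toB := by
      have h1 : (ξ.glue q r hqr y).toB = -(ξ.glue r q hqr.symm y).toB :=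
        toB_glue_eq_neg ξ hqr.symm y
      have h2 : IsOnly (ξ.glue r q hqr.symm y) y (newLeg hqr.symm) := by
        refine glue_external_cases hqr.symm ⟨fun _ => rfl, fun _ => rfl⟩ fun h h1 h2 =>
          ⟨fun h' => absurd ((hq h).1 h') h2, fun h' => ?_⟩
        exact absurd (congrArg Subtype.val h') Sum.inl_ne_inr
      have h3 : IsOnly (ξ.glue r q hqr.symm y) x (glueLeg hqr.symm p hpr hpq) := by
        refine glue_external_cases hqr.symm ⟨fun h => absurd h.symm hxy, fun h' => ?_⟩
          fun h h1 h2 => ⟨fun h' => ?_, fun h' => ?_⟩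
        · exact absurd (congrArg Subtype.val h').symm Sum.inl_ne_inr
        · obtain rfl := (hp h).1 h'
          rfl
        · exact (hp h).2 (Subtype.ext (Sum.inl.inj (congrArg Subtype.val h')))
      rw [glueB_toB_eq hyz hq hr, h1, map_neg, glueB_toB_eq hxy h3 h2]
    have e1 : glueB x z (glueB x y ξ.toB) = ((ξ.glue p q hpq x).glue (newLeg hpq)
        (glueLeg hpq r hpr.symm hqr.symm) nR x).toB := by
      rw [glueB_toB_eq hxy hp hq, glueB_toB_eq hxz (glue_isOnly_new hxy hp hq) hR]
    rw [e1, e2, e3, sub_neg_eq_add, eq_neg_iff_add_eq_zero, add_right_comm]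
    have inl2 : ∀ {u v : ξ.H}, u ≠ v → (Sum.inl u : ξ.H ⊕ Bool) ≠ Sum.inl v :=
      fun h h' => h (Sum.inl.inj h')
    have npq : p.1 ≠ q.1 := fun h => hpq (Subtype.ext h)
    have npr : p.1 ≠ r.1 := fun h => hpr (Subtype.ext h)
    have nqr : q.1 ≠ r.1 := fun h => hqr (Subtype.ext h)
    have tf : (Sum.inr true : ξ.H ⊕ Bool) ≠ Sum.inr false := by simp
    -- The inner edge is reversed: its end at the vertex of the first gluing in `X₁` corresponds to
    -- its end at the vertex with the final new leg in `X₂` and `X₃`.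
    let E₀ : (ξ.H ⊕ Bool) ⊕ Bool ≃ (ξ.H ⊕ Bool) ⊕ Bool :=
      Equiv.sumCongr (Equiv.sumCongr (Equiv.refl _) Equiv.boolNot) (Equiv.refl _)
    let X₁ := (ξ.glue p q hpq x).glue _ _ nR x
    let X₂ := (ξ.glue r q hqr.symm y).glue _ _ nP' x
    let X₃ := (ξ.glue r p hpr.symm x).glue _ _ nQ' x
    let E₂ : X₁.H ≃ X₂.H := E₀
    let E₃ : X₁.H ≃ X₃.H := E₀
    have key₂ : ∀ h u, X₁.rot h = u → X₂.rot (E₂ h) = E₂ u → X₂.rot (E₂ h) = E₂ (X₁.rot h) :=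
      fun h u h1 h2 => by rw [h1, h2]
    have key₃ : ∀ h u, X₁.rot h = u → X₃.rot (E₃ h) = E₃ u → X₃.rot (E₃ h) = E₃ (X₁.rot h) :=
      fun h u h1 h2 => by rw [h1, h2]
    have hq₁ : X₁.rot (Sum.inl (Sum.inr true)) = Sum.inl (Sum.inl q.1) :=
      (glueRot_of_ne tf Sum.inr_ne_inl).trans (congrArg Sum.inl glueRot_true)
    refine toB_add_toB_add_toB_of (ξ₁ := X₁) (ξ₂ := X₂) (ξ₃ := X₃)
      (a := (Sum.inl (Sum.inr true) : (ξ.H ⊕ Bool) ⊕ Bool))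
      (a' := (Sum.inl (Sum.inr false) : (ξ.H ⊕ Bool) ⊕ Bool))
      (b := (Sum.inl (Sum.inl q.1) : (ξ.H ⊕ Bool) ⊕ Bool))
      (c := (Sum.inl (Sum.inl p.1) : (ξ.H ⊕ Bool) ⊕ Bool))
      (d := (Sum.inr true : (ξ.H ⊕ Bool) ⊕ Bool))
      (g := (Sum.inl (Sum.inl r.1) : (ξ.H ⊕ Bool) ⊕ Bool)) rfl
      hq₁
      ((glueRot_of_ne Sum.inl_ne_inr (inl2 nqr)).trans (congrArg Sum.inl (glueRot_right hpq)))
      (glueRot_left nR) glueRot_true (fun h => Sum.inl_ne_inr (Sum.inl.inj h)) Sum.inr_ne_inl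
      (fun h => Sum.inr_ne_inl (Sum.inl.inj h)) (fun h => Sum.inr_ne_inl (Sum.inl.inj h))
      E₂ ?_ (glueRot_right nP') (glueRot_left nP') glueRot_true
      ((glueRot_of_ne Sum.inr_ne_inl tf).trans (congrArg Sum.inl glueRot_true))
      ((glueRot_of_ne (inl2 npq.symm) Sum.inl_ne_inr).trans
        (congrArg Sum.inl (glueRot_right hqr.symm)))
      ((glueRot_of_ne (inl2 npr.symm) Sum.inl_ne_inr).trans
        (congrArg Sum.inl (glueRot_left hqr.symm))) ?_ ?_
      E₃ ?_ (glueRot_left nQ') glueRot_true (glueRot_right nQ')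
      ((glueRot_of_ne tf Sum.inr_ne_inl).trans (congrArg Sum.inl glueRot_true))
      ((glueRot_of_ne Sum.inl_ne_inr (inl2 npq)).trans
        (congrArg Sum.inl (glueRot_right hpr.symm)))
      ((glueRot_of_ne Sum.inl_ne_inr (inl2 nqr.symm)).trans
        (congrArg Sum.inl (glueRot_left hpr.symm))) ?_ ?_
    · rintro ((h | _ | _) | _ | _) <;> rfl
    · rintro ((h | _ | _) | _ | _) h1 h2 h3 h4 h5 h6
      · have n1 : h ≠ q.1 := fun h' => h2 (congrArg (fun u => Sum.inl (Sum.inl u)) h')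
        have n2 : h ≠ p.1 := fun h' => h3 (congrArg (fun u => Sum.inl (Sum.inl u)) h')
        have n3 : h ≠ r.1 := fun h' => h6 (congrArg (fun u => Sum.inl (Sum.inl u)) h')
        exact key₂ _ _ ((glueRot_of_ne Sum.inl_ne_inr (inl2 n3)).trans
            (congrArg Sum.inl (glueRot_of_ne n2 n1))) ((glueRot_of_ne (inl2 n2) Sum.inl_ne_inr).trans
          (congrArg Sum.inl (glueRot_of_ne n3 n1)))
      · exact absurd rfl h4
      · exact absurd rfl h1
      · exact key₂ _ _ glueRot_false glueRot_false
      · exact absurd rfl h5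
    · rintro ⟨(h | _ | _) | t, hy⟩ ⟨(h' | t') | t', hy'⟩ hh
      · obtain rfl := Sum.inl.inj (Sum.inl.inj hh)
        rfl
      · exact absurd (Sum.inl.inj hh) Sum.inl_ne_inr
      · exact absurd hh Sum.inl_ne_inr
      · exact absurd ((glueRot_left nR).symm.trans hy) Sum.inr_ne_inl
      · exact absurd ((glueRot_left nR).symm.trans hy) Sum.inr_ne_inl
      · exact absurd ((glueRot_left nR).symm.trans hy) Sum.inr_ne_inl
      · exact absurd (Sum.inl.inj (hq₁.symm.trans hy)) Sum.inl_ne_inr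
      · exact absurd (Sum.inl.inj (hq₁.symm.trans hy)) Sum.inl_ne_inr
      · exact absurd (Sum.inl.inj (hq₁.symm.trans hy)) Sum.inl_ne_inr
      · exact absurd hh Sum.inr_ne_inl
      · exact absurd hh Sum.inr_ne_inl
      · rfl
    · rintro ((h | _ | _) | _ | _) <;> rfl
    · rintro ((h | _ | _) | _ | _) h1 h2 h3 h4 h5 h6
      · have n1 : h ≠ q.1 := fun h' => h2 (congrArg (fun u => Sum.inl (Sum.inl u)) h')
        have n2 : h ≠ p.1 := fun h' => h3 (congrArg (fun u => Sum.inl (Sum.inl u)) h')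
        have n3 : h ≠ r.1 := fun h' => h6 (congrArg (fun u => Sum.inl (Sum.inl u)) h')
        exact key₃ _ _ ((glueRot_of_ne Sum.inl_ne_inr (inl2 n3)).trans
            (congrArg Sum.inl (glueRot_of_ne n2 n1))) ((glueRot_of_ne Sum.inl_ne_inr (inl2 n1)).trans
          (congrArg Sum.inl (glueRot_of_ne n3 n2)))
      · exact absurd rfl h4
      · exact absurd rfl h1
      · exact key₃ _ _ glueRot_false glueRot_false
      · exact absurd rfl h5
    · rintro ⟨(h | _ | _) | t, hy⟩ ⟨(h' | t') | t', hy'⟩ hh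
      · obtain rfl := Sum.inl.inj (Sum.inl.inj hh)
        rfl
      · exact absurd (Sum.inl.inj hh) Sum.inl_ne_inr
      · exact absurd hh Sum.inl_ne_inr
      · exact absurd ((glueRot_left nR).symm.trans hy) Sum.inr_ne_inl
      · exact absurd ((glueRot_left nR).symm.trans hy) Sum.inr_ne_inl
      · exact absurd ((glueRot_left nR).symm.trans hy) Sum.inr_ne_inl
      · exact absurd (Sum.inl.inj (hq₁.symm.trans hy)) Sum.inl_ne_inr
      · exact absurd (Sum.inl.inj (hq₁.symm.trans hy)) Sum.inl_ne_inr
      · exact absurd (Sum.inl.inj (hq₁.symm.trans hy)) Sum.inl_ne_inr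
      · exact absurd hh Sum.inr_ne_inl
      · exact absurd hh Sum.inr_ne_inl
      · rfl
  · rw [glueB_glueB_eq_zero hxy, glueB_glueB_eq_zero hxz, glueB_glueB_eq_zero hyz, sub_zero]
    · intro h1 h2
      exact Or.inr ⟨hxy, hxz, fun h3 => h ⟨h3, h1, h2⟩⟩
    · intro h1 h2
      exact Or.inl ⟨hxy.symm, hyz, fun h3 => h ⟨h1, h3, h2⟩⟩
    · intro h1 h2
      exact Or.inl ⟨hxz.symm, hyz.symm, fun h3 => h ⟨h1, h2, h3⟩⟩

end

/-- The gluing operators on characters whose legs are labelled by `Fin N`, where the label `x` has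
the colour `κ x`. -/
def graphSystem {N l : ℕ} (κ : Fin N → Fin l) :
    GlueSystem (Fin N) (Fin l) (SpaceB N) (SpaceB l) where
  glue := glueB
  relabel c d := recolorB (Equiv.swap c d)
  out := recolorB κ
  color := κ
  jacobi _ _ _ h1 h2 h3 x := glueB_jacobi h1 h2 h3 x
  comm _ _ _ _ h1 h2 h3 h4 h5 h6 x := glueB_comm h1 h2 h3 h4 h5 h6 x
  antisymm _ _ h x := glueB_antisymm h x
  relabel_glue c d _ _ _ h v := (glueB_recolorB (Equiv.swap c d).injective h v).symm
  out_relabel c d _ h v := by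
    have h' : κ ∘ Equiv.swap c d = κ := by
      funext x
      simp only [Function.comp_apply, Equiv.swap_apply_def]
      split_ifs with h1 h2
      · rw [h1, h]
      · rw [h2, h]
      · rfl
    rw [recolorB_recolorB, h']

/-! ### Linear maps on `SpaceP` -/

section SpaceP

variable {n : ℕ}

theorem toP_eq {D D' : CharacterDiagram n} (h : D.Homeo D') : D.toP = D'.toP := by
  rw [← sub_eq_zero]
  exact (Submodule.Quotient.mk_eq_zero _).2 (Submodule.subset_span (.homeo _ _ h))

theorem toP_eq_sub {S T U : CharacterDiagram n} (h : CharacterDiagram.STU S T U) :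
    S.toP = T.toP - U.toP := by
  have : S.toP - T.toP + U.toP = 0 :=
    (Submodule.Quotient.mk_eq_zero _).2 (Submodule.subset_span (.stu _ _ _ h))
  rw [← sub_eq_zero, ← this]
  abel

/-- The linear map on `SpaceP` with given values at the classes of diagrams. -/
def liftP {M : Type*} [AddCommGroup M] [Module ℚ M] (f : CharacterDiagram n → M)
    (hhomeo : ∀ D D', D.Homeo D' → f D = f D')
    (hstu : ∀ S T U, CharacterDiagram.STU S T U → f T - f U = f S) : SpaceP n →ₗ[ℚ] M :=
  Submodule.liftQ _ (Finsupp.linearCombination ℚ f) <| by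
    rw [Submodule.span_le]
    rintro x (⟨D, D', h⟩ | ⟨S, T, U, h⟩)
    · simp [hhomeo _ _ h]
    · simp [← hstu _ _ _ h]

@[simp]
theorem liftP_toP {M : Type*} [AddCommGroup M] [Module ℚ M] (f : CharacterDiagram n → M)
    (hhomeo hstu) (D : CharacterDiagram n) : liftP f hhomeo hstu D.toP = f D := by
  change Finsupp.linearCombination ℚ f (Finsupp.single D 1) = f D
  simp

theorem span_toP : Submodule.span ℚ (Set.range (CharacterDiagram.toP (n := n))) = ⊤ := by
  refine Submodule.eq_top_iff'.2 fun x => ?_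
  obtain ⟨x, rfl⟩ := Submodule.Quotient.mk_surjective _ x
  induction x using Finsupp.induction_linear with
  | zero => exact Submodule.zero_mem _
  | add x y hx hy => exact Submodule.add_mem _ hx hy
  | single D r =>
    have : (Submodule.Quotient.mk (Finsupp.single D r) : SpaceP n) = r • D.toP := by
      rw [CharacterDiagram.toP, ← Submodule.Quotient.mk_smul]; simp
    rw [this]
    exact Submodule.smul_mem _ _ (Submodule.subset_span ⟨D, rfl⟩)

end SpaceP

/-! ### The inverse symmetrization of diagrams -/

namespace CharacterDiagram

variable {l N : ℕ}

/-- The underlying graph of a diagram, with labelled legs. -/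
def labelled (D : CharacterDiagram l) (lab : D.H → Fin N) : MarkedCharacter N where
  toChineseCharacter := D.toChineseCharacter
  color h := lab h.1

open Classical in
/-- The labels that occur on the legs. -/
def labels (D : CharacterDiagram l) (lab : D.H → Fin N) : Finset (Fin N) :=
  Finset.univ.filter fun x => ∃ h, D.rot h = h ∧ lab h = x

theorem mem_labels {D : CharacterDiagram l} {lab : D.H → Fin N} {x : Fin N} :
    x ∈ D.labels lab ↔ ∃ h, D.rot h = h ∧ lab h = x := by simp [labels]

/-- The legs are labelled injectively, and `κ` and `pos` give the string of each label and its place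
on the string. -/
structure IsLabelling (D : CharacterDiagram l) (lab : D.H → Fin N) (κ : Fin N → Fin l)
    (pos : Fin N → ℕ) : Prop where
  inj : ∀ h h', D.rot h = h → D.rot h' = h' → lab h = lab h' → h = h'
  mem : ∀ h, D.rot h = h → h ∈ D.strand (κ (lab h))
  sorted : ∀ i, (D.strand i).Pairwise fun x y => pos (lab x) < pos (lab y)
  injOn : (graphSystem κ).InjOnColors pos

/-- The value of the inverse symmetrization at a labelled diagram. -/
def value (D : CharacterDiagram l) (lab : D.H → Fin N) (κ : Fin N → Fin l) (pos : Fin N → ℕ) :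
    SpaceB l :=
  (graphSystem κ).total pos (D.labels lab) (D.labelled lab).toB

theorem rot_of_mem {D : CharacterDiagram l} {h : D.H} {i : Fin l} (hi : h ∈ D.strand i) :
    D.rot h = h := (D.mem_iff h).1 ⟨i, hi⟩

theorem IsLabelling.color_eq {D : CharacterDiagram l} {lab : D.H → Fin N} {κ : Fin N → Fin l}
    {pos : Fin N → ℕ} (hL : D.IsLabelling lab κ pos) {h : D.H} {i : Fin l} (hi : h ∈ D.strand i) :
    κ (lab h) = i :=
  D.disjoint _ _ h (hL.mem h (rot_of_mem hi)) hi

theorem lt_iff_of_pairwise {α : Type*} {L : List α} {p q : α → ℕ}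
    (hp : L.Pairwise fun x y => p x < p y) (hq : L.Pairwise fun x y => q x < q y) {x y : α}
    (hx : x ∈ L) (hy : y ∈ L) : p x < p y ↔ q x < q y := by
  obtain ⟨i, hi, rfl⟩ := List.getElem_of_mem hx
  obtain ⟨j, hj, rfl⟩ := List.getElem_of_mem hy
  rw [List.pairwise_iff_getElem] at hp hq
  rcases lt_trichotomy i j with h | h | h
  · exact iff_of_true (hp _ _ _ _ h) (hq _ _ _ _ h)
  · subst h; simp
  · exact iff_of_false (hp _ _ hj hi h).le.not_gt (hq _ _ hj hi h).le.not_gt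

theorem IsLabelling.sameOrder {D : CharacterDiagram l} {lab : D.H → Fin N} {κ : Fin N → Fin l}
    {pos : Fin N → ℕ} (hL : D.IsLabelling lab κ pos) {pos' : Fin N → ℕ}
    (hsorted : ∀ i, (D.strand i).Pairwise fun x y => pos' (lab x) < pos' (lab y)) :
    (graphSystem κ).SameOrder pos pos' (D.labels lab) := by
  intro x hx y hy hxy
  obtain ⟨h, hh, rfl⟩ := mem_labels.1 hx
  obtain ⟨h', hh', rfl⟩ := mem_labels.1 hy
  have h1 := hL.mem h hh
  have h2 := hL.mem h' hh'
  rw [show κ (lab h) = κ (lab h') from hxy] at h1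
  exact lt_iff_of_pairwise (p := fun x => pos (lab x)) (q := fun x => pos' (lab x)) (hL.sorted _)
    (hsorted _) h1 h2

/-- A labelling without unused labels embeds into any other one, and `total` is natural for
injections of labels. This naturality needs independence of the bases, since the bases chosen on the
two sides need not correspond. -/
theorem value_eq_value {N' : ℕ} {D : CharacterDiagram l} {lab : D.H → Fin N} {κ : Fin N → Fin l}
    {pos : Fin N → ℕ} (hL : D.IsLabelling lab κ pos) (hsurj : ∀ x, ∃ h, D.rot h = h ∧ lab h = x)
    {lab' : D.H → Fin N'} {κ' : Fin N' → Fin l} {pos' : Fin N' → ℕ}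
    (hL' : D.IsLabelling lab' κ' pos') : D.value lab κ pos = D.value lab' κ' pos' := by
  choose r hr hr' using hsurj
  have hrl : ∀ h, D.rot h = h → r (lab h) = h := fun h hh => hL.inj _ _ (hr _) hh (hr' _)
  let f : Fin N ↪ Fin N' := ⟨fun x => lab' (r x), fun x y hxy => by
    rw [← hr' x, ← hr' y, hL'.inj _ _ (hr x) (hr y) hxy]⟩
  have hκ : ∀ x, κ' (f x) = κ x := fun x => by
    have := hL.color_eq (hL'.mem _ (hr x))
    rw [hr'] at this
    exact this.symm
  have hS : D.labels lab' = (D.labels lab).map f := by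
    ext y
    simp only [Finset.mem_map, mem_labels]
    constructor
    · rintro ⟨h, hh, rfl⟩
      exact ⟨lab h, ⟨h, hh, rfl⟩, congrArg lab' (hrl h hh)⟩
    · rintro ⟨x, ⟨h, hh, rfl⟩, rfl⟩
      exact ⟨r (lab h), hr _, rfl⟩
  have hx : (D.labelled lab').toB = recolorB f (D.labelled lab).toB := by
    rw [recolorB_toB]
    congr 1
    change MarkedCharacter.mk _ _ = MarkedCharacter.mk _ _
    congr 1
    funext h
    exact congrArg lab' (hrl h.1 h.2).symm
  rw [value, value, hS, hx, GlueSystem.total_map_eq (𝔤 := graphSystem κ) (𝔤' := graphSystem κ') f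
    (recolorB f)]
  · rw [GlueSystem.total_congr]
    refine hL.sameOrder fun i => (hL'.sorted i).imp_of_mem ?_
    intro x y hx hy hxy
    change pos' (lab' (r (lab x))) < pos' (lab' (r (lab y)))
    rwa [hrl x (rot_of_mem hx), hrl y (rot_of_mem hy)]
  · exact fun b c hbc x => glueB_recolorB f.injective hbc x
  · intro x
    change recolorB κ' (recolorB f x) = recolorB κ x
    rw [recolorB_recolorB]
    congr 1
    exact congrArg recolorB (funext hκ)
  · exact hκ
  · exact hL'.injOn

theorem exists_labelling (D : CharacterDiagram l) : ∃ (N : ℕ) (lab : D.H → Fin N)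
    (κ : Fin N → Fin l) (pos : Fin N → ℕ), D.IsLabelling lab κ pos ∧
      ∀ x, ∃ h, D.rot h = h ∧ lab h = x := by
  classical
  have := D.finite_H
  obtain ⟨N, ⟨e⟩⟩ := Finite.exists_equiv_fin D.External
  -- `lab` must also be defined on half-edges that are not legs, which is impossible for `Fin 0`.
  -- But then there are no half-edges at all, because every component has a leg.
  by_cases hN : N = 0
  · subst hN
    have hemp : ∀ h, D.rot h ≠ h := fun h hh => (e ⟨h, hh⟩).elim0
    by_cases hH : Nonempty D.H
    · obtain ⟨h⟩ := hH
      obtain ⟨g, _, hg⟩ := D.exists_external h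
      exact absurd hg (hemp g)
    · refine ⟨0, fun h => absurd ⟨h⟩ hH, fun x => x.elim0, fun x => x.elim0, ⟨?_, ?_, ?_, ?_⟩, ?_⟩
      · exact fun h => absurd ⟨h⟩ hH
      · exact fun h => absurd ⟨h⟩ hH
      · intro i
        have : D.strand i = [] := List.eq_nil_iff_forall_not_mem.2 fun h _ => hH ⟨h⟩
        rw [this]
        exact List.Pairwise.nil
      · exact fun x => x.elim0
      · exact fun x => x.elim0
  · have hstr : ∀ x : D.External, ∃ i, x.1 ∈ D.strand i := fun x => (D.mem_iff x.1).2 x.2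
    choose s hs using hstr
    let lab : D.H → Fin N := fun h => if hh : D.rot h = h then e ⟨h, hh⟩ else ⟨0, by omega⟩
    have hlab : ∀ h (hh : D.rot h = h), lab h = e ⟨h, hh⟩ := fun h hh => dif_pos hh
    have hpos : ∀ i, ∀ h ∈ D.strand i, (D.strand (s (e.symm (lab h)))).idxOf (e.symm (lab h)).1 =
        (D.strand i).idxOf h := by
      intro i h hi
      rw [hlab h (rot_of_mem hi), e.symm_apply_apply,
        D.disjoint _ _ h (hs ⟨h, rot_of_mem hi⟩) hi]
    refine ⟨N, lab, fun x => s (e.symm x), fun x => (D.strand (s (e.symm x))).idxOf (e.symm x).1,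
      ⟨?_, ?_, ?_, ?_⟩, ?_⟩
    · intro h h' hh hh' heq
      rw [hlab h hh, hlab h' hh'] at heq
      exact congrArg Subtype.val (e.injective heq)
    · intro h hh
      rw [hlab h hh, e.symm_apply_apply]
      exact hs ⟨h, hh⟩
    · intro i
      have : (D.strand i).Pairwise fun x y => (D.strand i).idxOf x < (D.strand i).idxOf y := by
        rw [List.pairwise_iff_getElem]
        intro a b ha hb hab
        rwa [List.Nodup.idxOf_getElem (D.nodup i), List.Nodup.idxOf_getElem (D.nodup i)]
      refine this.imp_of_mem fun {x y} hx hy hxy => ?_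
      rwa [hpos i x hx, hpos i y hy]
    · intro x y hxy h
      change s (e.symm x) = s (e.symm y) at hxy
      have h1 := hs (e.symm x)
      simp only at h
      rw [hxy] at h h1
      exact e.symm.injective (Subtype.ext ((List.idxOf_inj h1).1 h))
    · intro x
      refine ⟨(e.symm x).1, (e.symm x).2, ?_⟩
      rw [hlab _ (e.symm x).2]
      exact e.apply_symm_apply x

/-- The value of the inverse symmetrization at a diagram. -/
def desymmetrize (D : CharacterDiagram l) : SpaceB l :=
  D.value D.exists_labelling.choose_spec.choose
    D.exists_labelling.choose_spec.choose_spec.choose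
    D.exists_labelling.choose_spec.choose_spec.choose_spec.choose

theorem desymmetrize_eq {D : CharacterDiagram l} {lab : D.H → Fin N} {κ : Fin N → Fin l}
    {pos : Fin N → ℕ} (hL : D.IsLabelling lab κ pos) : D.desymmetrize = D.value lab κ pos :=
  value_eq_value D.exists_labelling.choose_spec.choose_spec.choose_spec.choose_spec.1
    D.exists_labelling.choose_spec.choose_spec.choose_spec.choose_spec.2 hL

theorem desymmetrize_homeo {D D' : CharacterDiagram l} (h : D.Homeo D') :
    D.desymmetrize = D'.desymmetrize := by
  obtain ⟨e, hopp, hrot, hstr⟩ := h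
  obtain ⟨N, lab, κ, pos, hL, -⟩ := D.exists_labelling
  have hext : ∀ h, D'.rot h = h ↔ D.rot (e.symm h) = e.symm h := by
    intro h
    obtain ⟨h, rfl⟩ := e.surjective h
    rw [hrot, e.symm_apply_apply, e.injective.eq_iff]
  have hL' : D'.IsLabelling (fun h => lab (e.symm h)) κ pos := by
    refine ⟨fun h h' hh hh' heq => ?_, fun h hh => ?_, fun i => ?_, hL.injOn⟩
    · exact e.symm.injective (hL.inj _ _ ((hext h).1 hh) ((hext h').1 hh') heq)
    · rw [hstr]
      exact List.mem_map.2 ⟨_, hL.mem _ ((hext h).1 hh), e.apply_symm_apply h⟩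
    · rw [hstr, List.pairwise_map]
      simpa using hL.sorted i
  rw [desymmetrize_eq hL, desymmetrize_eq hL', value, value]
  have h1 : D'.labels (fun h => lab (e.symm h)) = D.labels lab := by
    ext x
    simp only [mem_labels]
    constructor
    · rintro ⟨h, hh, rfl⟩
      exact ⟨e.symm h, (hext h).1 hh, rfl⟩
    · rintro ⟨h, hh, rfl⟩
      exact ⟨e h, (hext _).2 (by rw [e.symm_apply_apply, hh]), by rw [e.symm_apply_apply]⟩
  have h2 : (D.labelled lab).toB = (D'.labelled fun h => lab (e.symm h)).toB := by
    refine toB_eq ⟨e, hopp, hrot, fun h h' hh => ?_⟩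
    change lab (e.symm h'.1) = lab h.1
    rw [← hh]
    exact congrArg lab (e.symm_apply_apply h.1)
  rw [h1, h2]

/-- With corresponding labels, `T` and `U` have the same labelled graph, and their positions differ
by the interchange of two neighbours. The graph of `S` is obtained by joining these two legs. So STU
is exactly the interchange rule for `total`. -/
theorem desymmetrize_stu {S T U : CharacterDiagram l} (h : STU S T U) :
    T.desymmetrize - U.desymmetrize = S.desymmetrize := by
  obtain ⟨f, g, i, L, R, b, c, hTi, hUopp, hUrot, hUi, hUj, hSopp, hSopp', hSrot, hSf, hSt, hSc, hSb,
    hSi, hSj⟩ := h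
  obtain ⟨N, lab, κ, pos, hL, -⟩ := T.exists_labelling
  have hbi : b ∈ T.strand i := by rw [hTi]; simp
  have hci : c ∈ T.strand i := by rw [hTi]; simp
  have hb := rot_of_mem hbi
  have hc := rot_of_mem hci
  have hbc : b ≠ c := by
    rintro rfl
    have := T.nodup i
    rw [hTi] at this
    simp [List.nodup_append] at this
  have hlbc : lab b ≠ lab c := fun h => hbc (hL.inj _ _ hb hc h)
  have hκb := hL.color_eq hbi
  have hκc := hL.color_eq hci
  have hsort := hL.sorted i
  rw [hTi] at hsort
  simp only [List.pairwise_append, List.pairwise_cons, List.mem_cons] at hsort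
  obtain ⟨hsL, ⟨hsb, hsc, hsR⟩, hsLR⟩ := hsort
  have hlt : pos (lab b) < pos (lab c) := hsb c (Or.inl rfl)
  have hother : ∀ h ∈ T.strand i, h ≠ b → h ≠ c →
      (pos (lab h) < pos (lab b) ∧ pos (lab h) < pos (lab c)) ∨
      (pos (lab b) < pos (lab h) ∧ pos (lab c) < pos (lab h)) := by
    intro h hi h1 h2
    rw [hTi] at hi
    simp only [List.mem_append, List.mem_cons, h1, h2, false_or] at hi
    rcases hi with hi | hi
    · exact Or.inl ⟨hsLR h hi b (Or.inl rfl), hsLR h hi c (Or.inr (Or.inl rfl))⟩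
    · exact Or.inr ⟨hsb h (Or.inr hi), hsc h hi⟩
  have hcons : (graphSystem κ).Consecutive pos (T.labels lab) (lab b) (lab c) := by
    refine ⟨hlt, hκb.trans hκc.symm, ?_, ?_⟩
    all_goals
      intro x hx hxb h1 h2
      obtain ⟨h, hh, rfl⟩ := mem_labels.1 hx
      have h3 := hL.mem h hh
      rw [show κ (lab h) = i from hxb.trans hκb] at h3
      have := hother h h3 (fun h' => h1 (by rw [h'])) (fun h' => h2 (by rw [h']))
      omega
  -- the diagram `U`
  have hUext : ∀ h, U.rot h = h ↔ T.rot (f.symm h) = f.symm h := by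
    intro h
    obtain ⟨h, rfl⟩ := f.surjective h
    rw [hUrot, f.symm_apply_apply, f.injective.eq_iff]
  have hsw : ∀ h, T.rot h = h → h ≠ b → h ≠ c →
      GlueSystem.swapPos pos (lab b) (lab c) (lab h) = pos (lab h) := fun h hh h1 h2 =>
    GlueSystem.swapPos_of_ne (fun h' => h1 (hL.inj _ _ hh hb h'))
      fun h' => h2 (hL.inj _ _ hh hc h')
  have hnd := T.nodup i
  rw [hTi] at hnd
  have hLU : U.IsLabelling (fun h => lab (f.symm h)) κ
      (GlueSystem.swapPos pos (lab b) (lab c)) := by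
    refine ⟨fun h h' hh hh' heq => ?_, fun h hh => ?_, fun j => ?_,
      hL.injOn.swapPos (hκb.trans hκc.symm)⟩
    · exact f.symm.injective (hL.inj _ _ ((hUext h).1 hh) ((hUext h').1 hh') heq)
    · have h1 := hL.mem _ ((hUext h).1 hh)
      by_cases hj : κ (lab (f.symm h)) = i
      · rw [hj] at h1 ⊢
        rw [hUi]
        refine List.mem_map.2 ⟨f.symm h, ?_, f.apply_symm_apply h⟩
        rw [hTi] at h1
        simp only [List.mem_append, List.mem_cons] at h1 ⊢
        tauto
      · rw [hUj _ hj]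
        exact List.mem_map.2 ⟨f.symm h, h1, f.apply_symm_apply h⟩
    · by_cases hj : j = i
      · subst hj
        rw [hUi, List.pairwise_map]
        simp only [f.symm_apply_apply]
        have hL' : ∀ x ∈ L, GlueSystem.swapPos pos (lab b) (lab c) (lab x) = pos (lab x) := by
          intro x hx
          refine hsw x (rot_of_mem (i := j) (by rw [hTi]; simp [hx])) ?_ ?_
          · rintro rfl
            simp [List.nodup_append] at hnd
            exact (hnd.2.2 _ hx).1 rfl
          · rintro rfl
            simp [List.nodup_append] at hnd
            exact (hnd.2.2 _ hx).2.1 rfl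
        have hR' : ∀ x ∈ R, GlueSystem.swapPos pos (lab b) (lab c) (lab x) = pos (lab x) := by
          intro x hx
          refine hsw x (rot_of_mem (i := j) (by rw [hTi]; simp [hx])) ?_ ?_
          · rintro rfl
            simp [List.nodup_append, hx] at hnd
          · rintro rfl
            simp [List.nodup_append, hx] at hnd
        have hb' : GlueSystem.swapPos pos (lab b) (lab c) (lab b) = pos (lab c) :=
          GlueSystem.swapPos_left _ _
        have hc' : GlueSystem.swapPos pos (lab b) (lab c) (lab c) = pos (lab b) :=
          GlueSystem.swapPos_right _ _
        simp only [List.pairwise_append, List.pairwise_cons, List.mem_cons]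
        refine ⟨hsL.imp_of_mem fun hx hy h => ?_, ⟨?_, ?_, hsR.imp_of_mem fun hx hy h => ?_⟩, ?_⟩
        · rwa [hL' _ hx, hL' _ hy]
        · rintro x (rfl | hx)
          · rwa [hc', hb']
          · rw [hc', hR' x hx]; exact hsb x (Or.inr hx)
        · intro x hx
          rw [hb', hR' x hx]; exact hsc x hx
        · rwa [hR' _ hx, hR' _ hy]
        · rintro x hx y (rfl | rfl | hy)
          · rw [hL' x hx, hc']; exact hsLR x hx b (Or.inl rfl)
          · rw [hL' x hx, hb']; exact hsLR x hx c (Or.inr (Or.inl rfl))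
          · rw [hL' x hx, hR' y hy]; exact hsLR x hx y (Or.inr (Or.inr hy))
      · rw [hUj j hj, List.pairwise_map]
        simp only [f.symm_apply_apply]
        refine (hL.sorted j).imp_of_mem fun {x y} hx hy h => ?_
        rw [hsw x (rot_of_mem hx), hsw y (rot_of_mem hy)]
        · exact h
        · rintro rfl; exact hj (T.disjoint _ _ _ hy hbi)
        · rintro rfl; exact hj (T.disjoint _ _ _ hy hci)
        · rintro rfl; exact hj (T.disjoint _ _ _ hx hbi)
        · rintro rfl; exact hj (T.disjoint _ _ _ hx hci)
  have hUlabels : U.labels (fun h => lab (f.symm h)) = T.labels lab := by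
    ext x
    simp only [mem_labels]
    constructor
    · rintro ⟨h, hh, rfl⟩
      exact ⟨f.symm h, (hUext h).1 hh, rfl⟩
    · rintro ⟨h, hh, rfl⟩
      exact ⟨f h, (hUext _).2 (by rw [f.symm_apply_apply, hh]), by rw [f.symm_apply_apply]⟩
  have hUtoB : (U.labelled fun h => lab (f.symm h)).toB = (T.labelled lab).toB := by
    refine (toB_eq ⟨f, hUopp, hUrot, fun h h' hh => ?_⟩).symm
    change lab (f.symm h'.1) = lab h.1
    rw [← hh]
    exact congrArg lab (f.symm_apply_apply h.1)
  -- the diagram `S`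
  have hSext : ∀ y, S.rot (g y) = g y ↔ y = Sum.inr false ∨
      ∃ h, y = Sum.inl h ∧ T.rot h = h ∧ h ≠ b ∧ h ≠ c := by
    rintro (h | _ | _)
    · by_cases h1 : h = b
      · subst h1
        simp [hSb]
      by_cases h2 : h = c
      · subst h2
        simp [hSc, hbc]
      · rw [hSrot h h1 h2]
        simp [h1, h2]
    · simp [hSf]
    · simp [hSt]
  -- The new leg inherits the label of `b`, as in `glueB`, and the label of `c` is no longer used by
  -- a leg. The value at the trivalent half-edge `inr true` is irrelevant.
  let labS : S.H → Fin N := fun y => Sum.elim lab (fun _ => lab b) (g.symm y)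
  have hlS : ∀ h, labS (g (Sum.inl h)) = lab h := fun h => by simp [labS]
  have hlS' : ∀ t, labS (g (Sum.inr t)) = lab b := fun t => by simp [labS]
  have hLS : S.IsLabelling labS κ pos := by
    refine ⟨fun y y' hy hy' heq => ?_, fun y hy => ?_, fun j => ?_, hL.injOn⟩
    · obtain ⟨y, rfl⟩ := g.surjective y
      obtain ⟨y', rfl⟩ := g.surjective y'
      rcases (hSext y).1 hy with rfl | ⟨h, rfl, hh, h1, h2⟩ <;>
        rcases (hSext y').1 hy' with rfl | ⟨h', rfl, hh', h1', h2'⟩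
      · rfl
      · rw [hlS, hlS'] at heq
        exact absurd (hL.inj _ _ hh' hb heq.symm) h1'
      · rw [hlS, hlS'] at heq
        exact absurd (hL.inj _ _ hh hb heq) h1
      · rw [hlS, hlS] at heq
        rw [hL.inj _ _ hh hh' heq]
    · obtain ⟨y, rfl⟩ := g.surjective y
      rcases (hSext y).1 hy with rfl | ⟨h, rfl, hh, h1, h2⟩
      · rw [hlS', hκb, hSi]
        simp
      · rw [hlS]
        have h3 := hL.mem h hh
        by_cases hj : κ (lab h) = i
        · rw [hj] at h3 ⊢
          rw [hTi] at h3
          rw [hSi]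
          simp only [List.mem_append, List.mem_cons, h1, h2, false_or] at h3
          rcases h3 with h3 | h3
          · exact List.mem_append_left _ (List.mem_map.2 ⟨h, h3, rfl⟩)
          · exact List.mem_append_right _ (List.mem_cons_of_mem _ (List.mem_map.2 ⟨h, h3, rfl⟩))
        · rw [hSj _ hj]
          exact List.mem_map.2 ⟨h, h3, rfl⟩
    · by_cases hj : j = i
      · subst hj
        rw [hSi]
        simp only [List.pairwise_append, List.pairwise_cons, List.pairwise_map, List.mem_cons,
          List.mem_map, hlS]
        refine ⟨hsL, ⟨?_, hsR⟩, ?_⟩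
        · rintro _ ⟨x, hx, rfl⟩
          rw [hlS, hlS']
          exact hsb x (Or.inr hx)
        · rintro _ ⟨x, hx, rfl⟩ y (rfl | ⟨y, hy, rfl⟩)
          · rw [hlS, hlS']
            exact hsLR x hx b (Or.inl rfl)
          · rw [hlS, hlS]
            exact hsLR x hx y (Or.inr (Or.inr hy))
      · rw [hSj j hj, List.pairwise_map]
        simp only [hlS]
        exact hL.sorted j
  have hSlabels : S.labels labS = (T.labels lab).erase (lab c) := by
    ext x
    simp only [Finset.mem_erase, mem_labels]
    constructor
    · rintro ⟨y, hy, rfl⟩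
      obtain ⟨y, rfl⟩ := g.surjective y
      rcases (hSext y).1 hy with rfl | ⟨h, rfl, hh, h1, h2⟩
      · rw [hlS']
        exact ⟨hlbc, b, hb, rfl⟩
      · rw [hlS]
        exact ⟨fun h' => h2 (hL.inj _ _ hh hc h'), h, hh, rfl⟩
    · rintro ⟨hx, h, hh, rfl⟩
      by_cases h1 : h = b
      · exact ⟨g (Sum.inr false), hSf, by rw [hlS', h1]⟩
      · exact ⟨g (Sum.inl h), (hSext _).2 (Or.inr ⟨h, rfl, hh, h1, fun h' => hx (by rw [h'])⟩), hlS h⟩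
  have honly : ∀ h (hh : T.rot h = h), (T.labelled lab).IsOnly (lab h) ⟨h, hh⟩ := by
    intro h hh y
    exact ⟨fun h' => Subtype.ext (hL.inj _ _ y.2 hh h'), fun h' => by rw [h']; rfl⟩
  have hStoB : glueB (lab b) (lab c) (T.labelled lab).toB = (S.labelled labS).toB := by
    have hbc' : (⟨b, hb⟩ : (T.labelled lab).External) ≠ ⟨c, hc⟩ :=
      fun h => hbc (congrArg Subtype.val h)
    rw [glueB_toB_eq hlbc (honly b hb) (honly c hc)]
    refine toB_eq ⟨g, ?_, ?_, ?_⟩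
    · rintro (h | _ | _)
      · exact hSopp h
      · exact hSopp'
      · have := S.opp_opp (g (Sum.inr false))
        rw [hSopp'] at this
        exact this
    · have key : ∀ (h u : T.H ⊕ Bool),
          (T.labelled lab).glueRot ⟨b, hb⟩ ⟨c, hc⟩ h = u → S.rot (g h) = g u →
          S.rot (g h) = g ((T.labelled lab).glueRot ⟨b, hb⟩ ⟨c, hc⟩ h) :=
        fun h u h1 h2 => by rw [h1, h2]
      rintro (h | _ | _)
      · by_cases h1 : h = b
        · subst h1
          exact key _ _ (glueRot_left hbc') hSb
        by_cases h2 : h = c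
        · subst h2
          exact key _ _ (glueRot_right hbc') hSc
        · exact key _ _ (glueRot_of_ne h1 h2) (hSrot h h1 h2)
      · exact key _ _ glueRot_false hSf
      · exact key _ _ glueRot_true hSt
    · rintro ⟨h | t, hy⟩ y' hh
      · change labS y'.1 = lab h
        rw [← hh]
        exact hlS h
      · change labS y'.1 = lab b
        rw [← hh]
        exact hlS' t
  rw [desymmetrize_eq hL, desymmetrize_eq hLU, desymmetrize_eq hLS, value, value, value, hUlabels,
    hUtoB, hSlabels, ← hStoB]
  exact GlueSystem.total_sub_total_swapPos hL.injOn (mem_labels.2 ⟨b, hb, rfl⟩)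
    (mem_labels.2 ⟨c, hc, rfl⟩) hcons _

end CharacterDiagram

/-- The inverse symmetrization. -/
def desymm (l : ℕ) : SpaceP l →ₗ[ℚ] SpaceB l :=
  liftP CharacterDiagram.desymmetrize (fun _ _ => CharacterDiagram.desymmetrize_homeo)
    fun _ _ _ => CharacterDiagram.desymmetrize_stu

theorem desymm_toP {l : ℕ} (D : CharacterDiagram l) : desymm l D.toP = D.desymmetrize :=
  liftP_toP _ _ _ _

/-! ### Diagrams carried by subsets of the half-edges of a fixed character -/

namespace ChineseCharacter

variable (G : ChineseCharacter) {n : ℕ}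

/-- The subset `Y` of the half-edges of `G`, with the edges of `G`, the cyclic orders `r` and the
strings `st`, is a Chinese character diagram. -/
structure IsDiagram (Y : Set G.H) (r : G.H → G.H) (st : Fin n → List G.H) : Prop where
  opp_mem : ∀ h ∈ Y, G.opp h ∈ Y
  rot_mem : ∀ h ∈ Y, r h ∈ Y
  rot_rot_rot : ∀ h ∈ Y, r (r (r h)) = h
  exists_external : ∀ C ⊆ Y, C.Nonempty → (∀ h ∈ C, G.opp h ∈ C) → (∀ h ∈ C, r h ∈ C) →
    ∃ g ∈ C, r g = g
  nodup : ∀ i, (st i).Nodup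
  disjoint : ∀ i j h, h ∈ st i → h ∈ st j → i = j
  mem_iff : ∀ h, (∃ i, h ∈ st i) ↔ h ∈ Y ∧ r h = h

namespace IsDiagram

variable {G} {Y : Set G.H} {r : G.H → G.H} {st : Fin n → List G.H}

theorem mem (hD : G.IsDiagram Y r st) {i : Fin n} {h : G.H} (hh : h ∈ st i) : h ∈ Y :=
  ((hD.mem_iff h).1 ⟨i, hh⟩).1

theorem rot_eq (hD : G.IsDiagram Y r st) {i : Fin n} {h : G.H} (hh : h ∈ st i) : r h = h :=
  ((hD.mem_iff h).1 ⟨i, hh⟩).2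

theorem rot_inj (hD : G.IsDiagram Y r st) {h k : G.H} (hh : h ∈ Y) (hk : k ∈ Y) (h' : r h = r k) :
    h = k := by
  rw [← hD.rot_rot_rot h hh, h', hD.rot_rot_rot k hk]

/-- The diagram with half-edges `Y`. -/
def diagram (hD : G.IsDiagram Y r st) : CharacterDiagram n where
  H := Y
  finite_H := by
    have := G.finite_H
    infer_instance
  rot :=
    { toFun := fun h => ⟨r h, hD.rot_mem h h.2⟩
      invFun := fun h => ⟨r (r h), hD.rot_mem _ (hD.rot_mem h h.2)⟩
      left_inv := fun h => Subtype.ext (hD.rot_rot_rot h h.2)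
      right_inv := fun h => Subtype.ext (hD.rot_rot_rot h h.2) }
  opp :=
    { toFun := fun h => ⟨G.opp h, hD.opp_mem h h.2⟩
      invFun := fun h => ⟨G.opp h, hD.opp_mem h h.2⟩
      left_inv := fun h => Subtype.ext (G.opp_opp h)
      right_inv := fun h => Subtype.ext (G.opp_opp h) }
  rot_rot_rot h := Subtype.ext (hD.rot_rot_rot h h.2)
  opp_opp h := Subtype.ext (G.opp_opp h)
  opp_ne h h' := G.opp_ne h (congrArg Subtype.val h')
  exists_external := by
    intro h
    -- The component of `h` is one of the closed subsets to which the condition in `IsDiagram`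
    -- applies.
    obtain ⟨g, ⟨hg, hg'⟩, hgr⟩ := hD.exists_external
      {g | ∃ hg : g ∈ Y, Relation.EqvGen (fun x y : Y => y = (⟨r x, hD.rot_mem x x.2⟩ : Y) ∨
        y = (⟨G.opp x, hD.opp_mem x x.2⟩ : Y)) h ⟨g, hg⟩} (fun g hg => hg.1)
      ⟨h, h.2, .refl _⟩ (fun g ⟨hg, hg'⟩ => ⟨hD.opp_mem g hg, hg'.trans _ _ _ (.rel _ _ (.inr rfl))⟩)
      (fun g ⟨hg, hg'⟩ => ⟨hD.rot_mem g hg, hg'.trans _ _ _ (.rel _ _ (.inl rfl))⟩)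
    exact ⟨⟨g, hg⟩, hg', Subtype.ext hgr⟩
  strand i := (st i).attachWith (· ∈ Y) fun _ hh => hD.mem hh
  nodup i := by
    rw [← List.nodup_map_iff Subtype.val_injective, List.attachWith_map_subtype_val]
    exact hD.nodup i
  disjoint i j h hi hj := by
    rw [List.mem_attachWith] at hi hj
    exact hD.disjoint i j h hi hj
  mem_iff h := by
    simp only [List.mem_attachWith, hD.mem_iff, h.2, true_and]
    exact ⟨fun h' => Subtype.ext h', fun h' => congrArg Subtype.val h'⟩

theorem strand_map_val (hD : G.IsDiagram Y r st) (i : Fin n) :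
    (hD.diagram.strand i).map Subtype.val = st i :=
  List.attachWith_map_subtype_val _

end IsDiagram

open Classical in
/-- The class of the diagram with half-edges `Y`. -/
def toP (Y : Set G.H) (r : G.H → G.H) (st : Fin n → List G.H) : SpaceP n :=
  if hD : G.IsDiagram Y r st then hD.diagram.toP else 0

variable {G} {Y : Set G.H} {r r' : G.H → G.H} {st : Fin n → List G.H}

theorem toP_of (hD : G.IsDiagram Y r st) : G.toP Y r st = hD.diagram.toP := dif_pos hD

theorem isDiagram_of_equiv (D : CharacterDiagram n) (e : G.H ≃ D.H)
    (hopp : ∀ h, D.opp (e h) = e (G.opp h)) (hr : ∀ h, D.rot (e h) = e (r h))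
    (hst : ∀ i, D.strand i = (st i).map e) : G.IsDiagram Set.univ r st where
  opp_mem _ _ := trivial
  rot_mem _ _ := trivial
  rot_rot_rot h _ := by
    apply e.injective
    rw [← hr, ← hr, ← hr, D.rot_rot_rot]
  exists_external := by
    rintro C - ⟨h, hh⟩ hCo hCr
    obtain ⟨g, hg, hg'⟩ := D.exists_external (e h)
    obtain ⟨g, rfl⟩ := e.surjective g
    refine ⟨g, ?_, e.injective (by rw [← hr, hg'])⟩
    -- Components are defined by an equivalence relation, so closure under the inverse of `r` is
    -- needed too; it follows from `r` having order dividing three.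
    have hCr' : ∀ h, r h ∈ C → h ∈ C := fun h hh => by
      have h3 : r (r (r h)) = h := by
        apply e.injective
        rw [← hr, ← hr, ← hr, D.rot_rot_rot]
      rw [← h3]
      exact hCr _ (hCr _ hh)
    have key : ∀ x y, D.Joined x y → (e.symm x ∈ C ↔ e.symm y ∈ C) := by
      intro x y hxy
      induction hxy with
      | rel x y h =>
        obtain ⟨x, rfl⟩ := e.surjective x
        rcases h with rfl | rfl
        · rw [hr, e.symm_apply_apply, e.symm_apply_apply]
          exact ⟨hCr x, hCr' x⟩
        · rw [hopp, e.symm_apply_apply, e.symm_apply_apply]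
          exact ⟨hCo x, fun h => G.opp_opp x ▸ hCo _ h⟩
      | refl x => rfl
      | symm x y _ ih => exact ih.symm
      | trans x y z _ _ ih1 ih2 => exact ih1.trans ih2
    simpa using (key _ _ hg).1 (by simpa using hh)
  nodup i := by
    have := D.nodup i
    rw [hst] at this
    exact this.of_map
  disjoint i j h hi hj := by
    refine D.disjoint i j (e h) ?_ ?_
    · rw [hst]; exact List.mem_map_of_mem hi
    · rw [hst]; exact List.mem_map_of_mem hj
  mem_iff h := by
    have := D.mem_iff (e h)
    simp only [hst, hr, List.mem_map_of_injective e.injective, e.injective.eq_iff] at this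
    rw [this]
    simp

theorem toP_univ (D : CharacterDiagram n) (e : G.H ≃ D.H)
    (hopp : ∀ h, D.opp (e h) = e (G.opp h)) (hr : ∀ h, D.rot (e h) = e (r h))
    (hst : ∀ i, D.strand i = (st i).map e) : G.toP Set.univ r st = D.toP := by
  have hD := isDiagram_of_equiv D e hopp hr hst
  rw [toP_of hD]
  refine toP_eq ⟨(Equiv.Set.univ G.H).trans e, fun h => hopp h.1, fun h => hr h.1, fun i => ?_⟩
  exact (hst i).trans ((congrArg (List.map e) (hD.strand_map_val i).symm).trans
    (List.map_map (l := hD.diagram.strand i) (f := Subtype.val) (g := e)))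

/-! ### Resolving a trivalent vertex next to a leg -/

open Classical in
/-- The cyclic orders after the vertices in `A` have been cut into legs. -/
def cut (A : Set G.H) (r : G.H → G.H) (h : G.H) : G.H := if h ∈ A then h else r h

theorem cut_of_mem {A : Set G.H} {h : G.H} (hh : h ∈ A) : cut A r h = h := if_pos hh

theorem cut_of_notMem {A : Set G.H} {h : G.H} (hh : h ∉ A) : cut A r h = r h := if_neg hh

theorem cut_cut (A B : Set G.H) : cut A (cut B r) = cut (A ∪ B) r := by
  classical
  funext h
  by_cases hA : h ∈ A
  · rw [cut_of_mem hA, cut_of_mem (Or.inl hA)]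
  · by_cases hB : h ∈ B
    · rw [cut_of_notMem hA, cut_of_mem hB, cut_of_mem (Or.inr hB)]
    · rw [cut_of_notMem hA, cut_of_notMem hB, cut_of_notMem (by simp [hA, hB])]

theorem cut_congr {A : Set G.H} (h : ∀ h ∉ A, r h = r' h) : cut A r = cut A r' := by
  funext x
  by_cases hA : x ∈ A
  · rw [cut_of_mem hA, cut_of_mem hA]
  · rw [cut_of_notMem hA, cut_of_notMem hA, h x hA]

/-- `s` is a leg, and its edge ends at the trivalent vertex `(a, x, y)`. -/
structure IsStem (G : ChineseCharacter) (r : G.H → G.H) (s a x y : G.H) : Prop where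
  opp_eq : G.opp s = a
  rot_left : r a = x
  rot_mid : r x = y
  rot_right : r y = a
  ne : x ≠ a

/-- Removing two elements from a set. -/
def sdiffPairEquiv {α : Type*} {Y : Set α} {s a : α} (hs : s ∈ Y) (ha : a ∈ Y) (has : a ≠ s) :
    (Y \ {s, a} : Set α) ⊕ Bool ≃ Y :=
  Equiv.ofBijective (Sum.elim (fun h => ⟨h.1, h.2.1⟩) fun t => if t then ⟨a, ha⟩ else ⟨s, hs⟩) <| by
    constructor
    · rintro (⟨h, hh, hne⟩ | _ | _) (⟨k, hk, hne'⟩ | _ | _) h' <;>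
        simp only [Sum.elim_inl, Sum.elim_inr, Bool.false_eq_true, if_false, if_true,
          Subtype.mk.injEq] at h'
      · simp [h']
      · exact absurd (Or.inl h') hne
      · exact absurd (Or.inr h') hne
      · exact absurd (Or.inl h'.symm) hne'
      · rfl
      · exact absurd h'.symm has
      · exact absurd (Or.inr h'.symm) hne'
      · exact absurd h' has
      · rfl
    · rintro ⟨h, hh⟩
      by_cases h1 : h = s
      · exact ⟨Sum.inr false, Subtype.ext h1.symm⟩
      by_cases h2 : h = a
      · exact ⟨Sum.inr true, Subtype.ext h2.symm⟩
      · exact ⟨Sum.inl ⟨h, hh, by rintro (h' | h'); exacts [h1 h', h2 h']⟩, rfl⟩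

section stem

variable {s a x y : G.H}

/-- Deleting the edge `{s, a}` and cutting its trivalent vertex leaves `x` and `y` as legs on the
string of `s`. The order `w` is left open, so that both terms of STU are covered. -/
theorem IsStem.isDiagram {w L R : List G.H} {i : Fin n} (h : G.IsStem r s a x y)
    (hD : G.IsDiagram Y r (Function.update st i (L ++ s :: R)))
    (hw : w.Perm (x :: y :: (L ++ R))) :
    G.IsDiagram (Y \ {s, a}) (cut {a, x, y} r) (Function.update st i w) := by
  have hsi : s ∈ Function.update st i (L ++ s :: R) i := by simp
  have hs := hD.mem hsi
  have hrs := hD.rot_eq hsi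
  obtain ⟨hopp, hax, hxy, hya, hxa⟩ := h
  have ha : a ∈ Y := hopp ▸ hD.opp_mem s hs
  have hx : x ∈ Y := hax ▸ hD.rot_mem a ha
  have hy : y ∈ Y := hxy ▸ hD.rot_mem x hx
  have has : a ≠ s := hopp ▸ G.opp_ne s
  have hys : y ≠ s := fun h => has (by rw [← hya, h, hrs])
  have hxs : x ≠ s := fun h => hys (by rw [← hxy, h, hrs])
  have hyx : y ≠ x := fun h => hxa (by rw [← hya, h, hxy, h])
  have hay : y ≠ a := fun h => hxa (by rw [← hax, ← h, hya, h])
  have hcut : ∀ h ∈ Y, h ∉ ({a, x, y} : Set G.H) → r h ∉ ({a, x, y} : Set G.H) := by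
    intro h hh hA hrA
    simp only [Set.mem_insert_iff, Set.mem_singleton_iff, not_or] at hA hrA
    rcases hrA with h1 | h1 | h1
    · exact hA.2.2 (hD.rot_inj hh hy (h1.trans hya.symm))
    · exact hA.1 (hD.rot_inj hh ha (h1.trans hax.symm))
    · exact hA.2.1 (hD.rot_inj hh hx (h1.trans hxy.symm))
  have hmem : ∀ j h, h ∈ Function.update st i w j ↔
      (h ∈ Function.update st i (L ++ s :: R) j ∧ h ≠ s) ∨ (j = i ∧ (h = x ∨ h = y)) := by
    intro j h
    by_cases hj : j = i
    · subst hj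
      have hnd := hD.nodup j
      simp only [Function.update_self] at hnd ⊢
      have h1 : s ∉ L ∧ s ∉ R := by
        rw [List.nodup_middle, List.nodup_cons, List.mem_append] at hnd
        tauto
      have h2 : h ∈ L → h ≠ s := fun h' h'' => h1.1 (h'' ▸ h')
      have h3 : h ∈ R → h ≠ s := fun h' h'' => h1.2 (h'' ▸ h')
      rw [hw.mem_iff]
      simp only [List.mem_cons, List.mem_append]
      tauto
    · have h1 : h ∈ st j → h ≠ s := fun h1 h2 => by
        refine hj (hD.disjoint j i s ?_ hsi)
        rw [Function.update_of_ne hj]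
        exact h2 ▸ h1
      rw [Function.update_of_ne hj, Function.update_of_ne hj]
      tauto
  have hfix : r x ≠ x ∧ r y ≠ y := ⟨by rwa [hxy], by rw [hya]; exact hay.symm⟩
  refine ⟨?_, ?_, ?_, ?_, ?_, ?_, ?_⟩
  · rintro h ⟨hh, hne⟩
    refine ⟨hD.opp_mem h hh, fun h' => hne ?_⟩
    rcases h' with h' | h'
    · exact Or.inr (by rw [← hopp, ← h', G.opp_opp]; rfl)
    · refine Or.inl ?_
      rw [← G.opp_opp h, Set.mem_singleton_iff.1 h', ← hopp, G.opp_opp]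
  · rintro h ⟨hh, hne⟩
    by_cases hA : h ∈ ({a, x, y} : Set G.H)
    · rw [cut_of_mem hA]; exact ⟨hh, hne⟩
    · rw [cut_of_notMem hA]
      refine ⟨hD.rot_mem h hh, ?_⟩
      rintro (h' | h')
      · exact hne (Or.inl (hD.rot_inj hh hs (h'.trans hrs.symm)))
      · exact hcut h hh hA (Or.inl h')
  · rintro h ⟨hh, hne⟩
    by_cases hA : h ∈ ({a, x, y} : Set G.H)
    · rw [cut_of_mem hA, cut_of_mem hA, cut_of_mem hA]
    · have h1 := hcut h hh hA
      have h2 := hcut _ (hD.rot_mem h hh) h1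
      rw [cut_of_notMem hA, cut_of_notMem h1, cut_of_notMem h2, hD.rot_rot_rot h hh]
  · intro C hC hCne hCo hCr
    -- A closed set without legs avoids `a`, `x`, `y`, which are legs now. There the cyclic orders
    -- are unchanged, so it already had a leg before the cut.
    by_contra! hno
    have hCA : ∀ h ∈ C, h ∉ ({a, x, y} : Set G.H) := fun h hh hA => hno h hh (cut_of_mem hA)
    obtain ⟨g, hg, hg'⟩ := hD.exists_external C (fun h hh => (hC hh).1) hCne hCo fun h hh => by
      rw [← cut_of_notMem (r := r) (hCA h hh)]
      exact hCr h hh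
    exact hno g hg (by rw [cut_of_notMem (hCA g hg), hg'])
  · intro j
    by_cases hj : j = i
    · subst hj
      have hnd := hD.nodup j
      rw [Function.update_self] at hnd ⊢
      rw [hw.nodup_iff, List.nodup_cons, List.nodup_cons]
      have hLR : ∀ h ∈ L ++ R, r h = h := fun h hh => hD.rot_eq (i := j) (by
        rw [Function.update_self]
        simp only [List.mem_append, List.mem_cons] at hh ⊢
        tauto)
      refine ⟨?_, fun h => hfix.2 (hLR y h), (List.nodup_cons.1 (List.nodup_middle.1 hnd)).2⟩
      rw [List.mem_cons, not_or]
      exact ⟨hyx.symm, fun h => hfix.1 (hLR x h)⟩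
    · have := hD.nodup j
      rwa [Function.update_of_ne hj] at this ⊢
  · intro j k h hj hk
    rw [hmem] at hj hk
    have h0 : ∀ j, h ∈ Function.update st i (L ++ s :: R) j → h ≠ x ∧ h ≠ y := fun j hj =>
      ⟨fun h' => hfix.1 (h' ▸ hD.rot_eq hj), fun h' => hfix.2 (h' ▸ hD.rot_eq hj)⟩
    rcases hj with ⟨hj, -⟩ | ⟨rfl, hj⟩ <;> rcases hk with ⟨hk, -⟩ | ⟨rfl, hk⟩
    · exact hD.disjoint j k h hj hk
    · have := h0 _ hj; tauto
    · have := h0 _ hk; tauto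
    · rfl
  · intro h
    have h1 : (∃ j, h ∈ Function.update st i w j) ↔
        ((∃ j, h ∈ Function.update st i (L ++ s :: R) j) ∧ h ≠ s) ∨ (h = x ∨ h = y) := by
      simp only [hmem]
      constructor
      · rintro ⟨j, hj | hj⟩
        · exact Or.inl ⟨⟨j, hj.1⟩, hj.2⟩
        · exact Or.inr hj.2
      · rintro (⟨⟨j, hj⟩, hs⟩ | hh)
        · exact ⟨j, Or.inl ⟨hj, hs⟩⟩
        · exact ⟨i, Or.inr ⟨rfl, hh⟩⟩
    rw [h1, hD.mem_iff]
    simp only [Set.mem_sdiff, Set.mem_insert_iff, Set.mem_singleton_iff, not_or]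
    by_cases hA : h ∈ ({a, x, y} : Set G.H)
    · rw [cut_of_mem hA]
      rcases hA with rfl | rfl | rfl
      · simp [hax, hxa, hay.symm, hxa.symm]
      · simp [hx, hxs, hxa]
      · simp [hy, hys, hay]
    · rw [cut_of_notMem hA]
      simp only [Set.mem_insert_iff, Set.mem_singleton_iff, not_or] at hA
      tauto

/-- STU at the stem. The cyclic order `(a, x, y)` is the `(a, c, b)` of the relation, so the
positive term has `y` before `x`. -/
theorem toP_stem {L R : List G.H} {i : Fin n}
    (hD : G.IsDiagram Y r (Function.update st i (L ++ s :: R))) (h : G.IsStem r s a x y) :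
    G.toP Y r (Function.update st i (L ++ s :: R)) =
      G.toP (Y \ {s, a}) (cut {a, x, y} r) (Function.update st i (L ++ y :: x :: R)) -
      G.toP (Y \ {s, a}) (cut {a, x, y} r) (Function.update st i (L ++ x :: y :: R)) := by
  have hp : (L ++ x :: y :: R).Perm (x :: y :: (L ++ R)) :=
    List.perm_middle.trans (List.perm_middle.cons _)
  have hT := h.isDiagram (w := L ++ y :: x :: R) hD
    (((List.Perm.swap x y R).append_left L).trans hp)
  have hU := h.isDiagram (w := L ++ x :: y :: R) hD hp
  rw [toP_of hD, toP_of hT, toP_of hU]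
  have hsi : s ∈ Function.update st i (L ++ s :: R) i := by simp
  have hs := hD.mem hsi
  have hrs := hD.rot_eq hsi
  obtain ⟨hopp, hax, hxy, hya, hxa⟩ := h
  have ha : a ∈ Y := hopp ▸ hD.opp_mem s hs
  have hx : x ∈ Y := hax ▸ hD.rot_mem a ha
  have hy : y ∈ Y := hxy ▸ hD.rot_mem x hx
  have has : a ≠ s := hopp ▸ G.opp_ne s
  have hys : y ≠ s := fun h => has (by rw [← hya, h, hrs])
  have hxs : x ≠ s := fun h => hys (by rw [← hxy, h, hrs])
  have hay : y ≠ a := fun h => hxa (by rw [← hax, ← h, hya, h])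
  have hTi : (hT.diagram.strand i).map Subtype.val = L ++ y :: x :: R := by
    rw [hT.strand_map_val, Function.update_self]
  obtain ⟨L', M, hTi, rfl, hM⟩ := List.map_eq_append_iff.1 hTi
  obtain ⟨b, M, rfl, hb, hM⟩ := List.map_eq_cons_iff.1 hM
  obtain ⟨c, R', rfl, hc, rfl⟩ := List.map_eq_cons_iff.1 hM
  have hcut : ∀ h, h ≠ a → h ≠ x → h ≠ y → cut {a, x, y} r h = r h := fun h h1 h2 h3 =>
    cut_of_notMem (by simp [h1, h2, h3])
  have hinj {Y : Set G.H} : Function.Injective (List.map (Subtype.val : Y → G.H)) :=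
    List.map_injective_iff.2 Subtype.val_injective
  have hid : ∀ M : List (Y \ {s, a} : Set G.H),
      (M.map (Equiv.refl (Y \ {s, a} : Set G.H))).map Subtype.val = M.map Subtype.val :=
    fun M => by rw [List.map_map]; rfl
  have hinl : ∀ M : List (Y \ {s, a} : Set G.H),
      (M.map fun h => sdiffPairEquiv hs ha has (Sum.inl h)).map Subtype.val =
        M.map Subtype.val := fun M => by rw [List.map_map]; rfl
  refine toP_eq_sub ⟨Equiv.refl _, sdiffPairEquiv hs ha has, i, L', R', b, c, hTi, fun _ => rfl,
    fun _ => rfl, hinj ?_, fun j hj => hinj ?_, fun _ => rfl, Subtype.ext hopp, ?_,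
    Subtype.ext hrs, Subtype.ext (hax.trans hc.symm), Subtype.ext ?_, Subtype.ext ?_,
    hinj ?_, fun j hj => hinj ?_⟩
  · refine (hU.strand_map_val i).trans ?_
    rw [Function.update_self]
    refine Eq.trans ?_ (hid (L' ++ c :: b :: R')).symm
    rw [List.map_append, List.map_cons, List.map_cons, hb, hc]
  · refine (hU.strand_map_val j).trans ?_
    rw [Function.update_of_ne hj]
    have := hT.strand_map_val j
    rw [Function.update_of_ne hj] at this
    exact this.symm.trans (hid _).symm
  · rintro ⟨h, hh, hne⟩ h1 h2
    refine Subtype.ext (hcut h (fun h' => hne (Or.inr h')) ?_ ?_).symm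
    · exact fun h' => h2 (Subtype.ext (h'.trans hc.symm))
    · exact fun h' => h1 (Subtype.ext (h'.trans hb.symm))
  · change r c.1 = b.1
    rw [hb, hc, hxy]
  · change r b.1 = a
    rw [hb, hya]
  · refine (hD.strand_map_val i).trans ?_
    rw [Function.update_self]
    refine Eq.trans ?_ (List.map_append).symm
    exact congrArg₂ _ (hinl L').symm (congrArg (List.cons s) (hinl R').symm)
  · refine (hD.strand_map_val j).trans ?_
    rw [Function.update_of_ne hj]
    have := hT.strand_map_val j
    rw [Function.update_of_ne hj] at this
    exact this.symm.trans (hinl _).symm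

end stem
end ChineseCharacter

/-! ### Antisymmetry and the Jacobi relation for diagrams -/

namespace ChineseCharacter

variable {G : ChineseCharacter} {n : ℕ} {Y : Set G.H} {r r' r₁ r₂ r₃ : G.H → G.H}
  {st : Fin n → List G.H}

/-- `(a, b, c)` is a trivalent vertex. -/
structure IsVertex (r : G.H → G.H) (a b c : G.H) : Prop where
  left : r a = b
  mid : r b = c
  right : r c = a
  ne : b ≠ a

namespace IsVertex

variable {a b c : G.H}

theorem rotate (h : IsVertex r a b c) : IsVertex r b c a :=
  ⟨h.mid, h.right, h.left, fun h' => h.ne (by rw [← h.right, h', h.mid, h'])⟩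

theorem isStem (h : IsVertex r a b c) {s : G.H} (hs : G.opp s = a) : G.IsStem r s a b c :=
  ⟨hs, h.left, h.mid, h.right, h.ne⟩

theorem cut (h : IsVertex r a b c) {A : Set G.H} (ha : a ∉ A) (hb : b ∉ A) (hc : c ∉ A) :
    IsVertex (cut A r) a b c :=
  ⟨by rw [cut_of_notMem ha, h.left], by rw [cut_of_notMem hb, h.mid],
    by rw [cut_of_notMem hc, h.right], h.ne⟩

theorem rot_mem (h : IsVertex r a b c) {k : G.H} (hk : k ∈ ({a, b, c} : Set G.H)) :
    r k ∈ ({a, b, c} : Set G.H) := by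
  rcases hk with rfl | rfl | rfl
  · rw [h.left]; simp
  · rw [h.mid]; simp
  · rw [h.right]; simp

end IsVertex

section

variable {s a x y : G.H}

theorem IsStem.notMem (h : G.IsStem r s a x y) {S : Set G.H} (hS : ∀ k ∈ S, r k ∈ S)
    (ha : a ∉ S) : x ∉ S ∧ y ∉ S := by
  have hy : y ∉ S := fun hy => ha (h.rot_right ▸ hS y hy)
  exact ⟨fun hx => hy (h.rot_mid ▸ hS x hx), hy⟩

theorem IsStem.congr (h : G.IsStem r s a x y) (ha : r' a = r a) (hx : r' x = r x)
    (hy : r' y = r y) : G.IsStem r' s a x y :=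
  ⟨h.opp_eq, ha ▸ h.rot_left, hx ▸ h.rot_mid, hy ▸ h.rot_right, h.ne⟩

theorem IsStem.ncard_lt (hs : s ∈ Y) : (Y \ {s, a}).ncard < Y.ncard := by
  have := G.finite_H
  exact Set.ncard_lt_ncard ⟨Set.sdiff_subset, fun h => (h hs).2 (Or.inl rfl)⟩ (Set.toFinite _)

/-- If every leg were joined to another leg, the half-edges at trivalent vertices would form a
closed set without a leg, although each component has one. -/
theorem IsDiagram.exists_stem (hD : G.IsDiagram Y r st) (ha : a ∈ Y) (hra : r a ≠ a) :
    ∃ (i : Fin n) (L R : List G.H) (s b x y : G.H), st i = L ++ s :: R ∧ G.IsStem r s b x y := by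
  by_contra! hno
  have hleg : ∀ s ∈ Y, r s = s → r (G.opp s) = G.opp s := by
    intro s hs hrs
    by_contra hne
    obtain ⟨i, hi⟩ := (hD.mem_iff s).2 ⟨hs, hrs⟩
    obtain ⟨L, R, hLR⟩ := List.append_of_mem hi
    exact hno i L R s _ _ _ hLR
      ⟨rfl, rfl, rfl, hD.rot_rot_rot _ (hD.opp_mem s hs), hne⟩
  obtain ⟨g, ⟨hg, hg'⟩, hg''⟩ := hD.exists_external {h ∈ Y | r h ≠ h} (fun h hh => hh.1) ⟨a, ha, hra⟩
    (fun h hh => ⟨hD.opp_mem h hh.1, fun h' => hh.2 <| by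
      have := hleg _ (hD.opp_mem h hh.1) h'
      rwa [G.opp_opp] at this⟩)
    (fun h hh => ⟨hD.rot_mem h hh.1, fun h' => hh.2 (hD.rot_inj (hD.rot_mem h hh.1) hh.1 h')⟩)
  exact hg' hg''

theorem perm_stem (L R : List G.H) :
    (L ++ y :: x :: R).Perm (x :: y :: (L ++ R)) ∧ (L ++ x :: y :: R).Perm (x :: y :: (L ++ R)) := by
  have hp : (L ++ x :: y :: R).Perm (x :: y :: (L ++ R)) :=
    List.perm_middle.trans (List.perm_middle.cons _)
  exact ⟨((List.Perm.swap x y R).append_left L).trans hp, hp⟩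

end

/-- Resolving the vertex turns antisymmetry into that of the commutator. -/
theorem toP_add_toP_of_stem {s a b c : G.H} {i : Fin n} {L R : List G.H}
    (hD : G.IsDiagram Y r (Function.update st i (L ++ s :: R)))
    (hD' : G.IsDiagram Y r' (Function.update st i (L ++ s :: R)))
    (h : G.IsStem r s a b c) (hv' : IsVertex r' a c b)
    (hrr : ∀ h ∉ ({a, b, c} : Set G.H), r h = r' h) :
    G.toP Y r (Function.update st i (L ++ s :: R)) +
      G.toP Y r' (Function.update st i (L ++ s :: R)) = 0 := by
  rw [toP_stem hD h, toP_stem hD' (hv'.isStem h.opp_eq), Set.pair_comm c b, cut_congr hrr]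
  abel

/-- By induction on the number of half-edges. A stem ending at the vertex `(a, b, c)` settles the
claim directly. Any other stem is resolved in the same way in both diagrams and reduces the claim to
smaller ones. -/
theorem toP_add_toP {a b c : G.H} (hD : G.IsDiagram Y r st) (hD' : G.IsDiagram Y r' st)
    (ha : a ∈ Y) (hv : IsVertex r a b c) (hv' : IsVertex r' a c b)
    (hrr : ∀ h ∉ ({a, b, c} : Set G.H), r h = r' h) : G.toP Y r st + G.toP Y r' st = 0 := by
  induction hk : Y.ncard using Nat.strong_induction_on generalizing Y r r' st with
  | _ k ih =>
  obtain ⟨i, L, R, s, p, x, y, hi, h⟩ := hD.exists_stem ha (by rw [hv.left]; exact hv.ne)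
  obtain ⟨st, rfl⟩ : ∃ st' : Fin n → List G.H, st = Function.update st' i (L ++ s :: R) :=
    ⟨st, by rw [← hi, Function.update_eq_self]⟩
  clear hi
  have hsi : s ∈ Function.update st i (L ++ s :: R) i := by simp
  have hs := hD.mem hsi
  have hrs := hD.rot_eq hsi
  by_cases hp : p ∈ ({a, b, c} : Set G.H)
  · rcases hp with rfl | rfl | rfl
    · exact toP_add_toP_of_stem hD hD' (hv.isStem h.opp_eq) hv' hrr
    · refine toP_add_toP_of_stem hD hD' (hv.rotate.isStem h.opp_eq) hv'.rotate.rotate fun k hk => ?_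
      exact hrr k fun hk' => hk (by simp only [Set.mem_insert_iff, Set.mem_singleton_iff] at hk' ⊢; tauto)
    · refine toP_add_toP_of_stem hD hD' (hv.rotate.rotate.isStem h.opp_eq) hv'.rotate fun k hk => ?_
      exact hrr k fun hk' => hk (by simp only [Set.mem_insert_iff, Set.mem_singleton_iff] at hk' ⊢; tauto)
  · obtain ⟨hx, hy⟩ := h.notMem (fun k hk => hv.rot_mem hk) hp
    have h' := h.congr (hrr p hp).symm (hrr x hx).symm (hrr y hy).symm
    simp only [Set.mem_insert_iff, Set.mem_singleton_iff, not_or] at hp hx hy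
    have hcut : a ∉ ({p, x, y} : Set G.H) ∧ b ∉ ({p, x, y} : Set G.H) ∧
        c ∉ ({p, x, y} : Set G.H) := by
      simp only [Set.mem_insert_iff, Set.mem_singleton_iff, not_or]
      tauto
    have ha' : a ∈ Y \ {s, p} := by
      refine ⟨ha, ?_⟩
      rintro (h1 | h1)
      · exact hv.ne (by rw [← hv.left, h1, hrs])
      · exact hp.1 h1.symm
    have step := fun w hw => ih _ (hk ▸ IsStem.ncard_lt hs) (h.isDiagram (w := w) hD hw)
      (h'.isDiagram hD' hw) ha' (hv.cut hcut.1 hcut.2.1 hcut.2.2)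
      (hv'.cut hcut.1 hcut.2.2 hcut.2.1) (fun k hk => by
        by_cases hA : k ∈ ({p, x, y} : Set G.H)
        · rw [cut_of_mem hA, cut_of_mem hA]
        · rw [cut_of_notMem hA, cut_of_notMem hA, hrr k hk]) rfl
    have h1 := step _ (perm_stem L R).1
    have h2 := step _ (perm_stem L R).2
    rw [toP_stem hD h, toP_stem hD' h', sub_add_sub_comm, h1, h2, sub_zero]

/-- Two successive resolutions, first of the stem and then of the vertex reached through `x`, give
the four terms of an iterated commutator. In `toP_stem_stem'` the second vertex is reached through
`y`. The forms of `Z` and `q` are left open so that different expansions end in literally equal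
terms. -/
theorem toP_stem_stem {s p x y z u v : G.H} {i : Fin n} {L R : List G.H}
    (hD : G.IsDiagram Y r (Function.update st i (L ++ s :: R))) (h : G.IsStem r s p x y)
    (hx : G.opp x = z) (hv : IsVertex r z u v)
    (hd : z ∉ ({p, x, y} : Set G.H) ∧ u ∉ ({p, x, y} : Set G.H) ∧ v ∉ ({p, x, y} : Set G.H))
    {Z : Set G.H} (hZ : (Y \ {s, p}) \ {x, z} = Z) {q : G.H → G.H}
    (hq : cut ({z, u, v} ∪ {p, x, y}) r = q) :
    G.toP Y r (Function.update st i (L ++ s :: R)) =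
      G.toP Z q (Function.update st i (L ++ [y, v, u] ++ R)) -
      G.toP Z q (Function.update st i (L ++ [y, u, v] ++ R)) -
      G.toP Z q (Function.update st i (L ++ [v, u, y] ++ R)) +
      G.toP Z q (Function.update st i (L ++ [u, v, y] ++ R)) := by
  have h' := (hv.cut hd.1 hd.2.1 hd.2.2).isStem hx
  have h1 := h.isDiagram hD (perm_stem L R).1
  have h2 := h.isDiagram hD (perm_stem L R).2
  rw [show L ++ y :: x :: R = (L ++ [y]) ++ x :: R by simp] at h1
  rw [toP_stem hD h, toP_stem h2 h', show L ++ y :: x :: R = (L ++ [y]) ++ x :: R by simp,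
    toP_stem h1 h', cut_cut, hq, hZ]
  simp only [List.append_assoc, List.cons_append, List.nil_append]
  abel

theorem toP_stem_stem' {s p x y z u v : G.H} {i : Fin n} {L R : List G.H}
    (hD : G.IsDiagram Y r (Function.update st i (L ++ s :: R))) (h : G.IsStem r s p x y)
    (hy : G.opp y = z) (hv : IsVertex r z u v)
    (hd : z ∉ ({p, x, y} : Set G.H) ∧ u ∉ ({p, x, y} : Set G.H) ∧ v ∉ ({p, x, y} : Set G.H))
    {Z : Set G.H} (hZ : (Y \ {s, p}) \ {y, z} = Z) {q : G.H → G.H}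
    (hq : cut ({z, u, v} ∪ {p, x, y}) r = q) :
    G.toP Y r (Function.update st i (L ++ s :: R)) =
      G.toP Z q (Function.update st i (L ++ [v, u, x] ++ R)) -
      G.toP Z q (Function.update st i (L ++ [u, v, x] ++ R)) -
      G.toP Z q (Function.update st i (L ++ [x, v, u] ++ R)) +
      G.toP Z q (Function.update st i (L ++ [x, u, v] ++ R)) := by
  have h' := (hv.cut hd.1 hd.2.1 hd.2.2).isStem hy
  have h1 := h.isDiagram hD (perm_stem L R).1
  have h2 := h.isDiagram hD (perm_stem L R).2
  rw [show L ++ x :: y :: R = (L ++ [x]) ++ y :: R by simp] at h2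
  rw [toP_stem hD h, toP_stem h1 h', show L ++ x :: y :: R = (L ++ [x]) ++ y :: R by simp,
    toP_stem h2 h', cut_cut, hq, hZ]
  simp only [List.append_assoc, List.cons_append, List.nil_append]
  abel

/-- The cyclic orders are related as in the Jacobi relation at the edge `{a, a'}`. -/
structure IsJacobi (r₁ r₂ r₃ : G.H → G.H) (a a' b c d e : G.H) : Prop where
  opp_eq : G.opp a = a'
  nodup : [a, a', b, c, d, e].Nodup
  vertex : IsVertex r₁ a b c
  vertex' : IsVertex r₁ a' d e
  vertex₂ : IsVertex r₂ a c d
  vertex₂' : IsVertex r₂ a' b e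
  vertex₃ : IsVertex r₃ a d b
  vertex₃' : IsVertex r₃ a' c e
  eq₂ : ∀ h ∉ ({a, a', b, c, d, e} : Set G.H), r₁ h = r₂ h
  eq₃ : ∀ h ∉ ({a, a', b, c, d, e} : Set G.H), r₁ h = r₃ h

namespace IsJacobi

variable {a a' b c d e : G.H}

theorem rotate (h : IsJacobi r₁ r₂ r₃ a a' b c d e) : IsJacobi r₂ r₃ r₁ a a' c d b e := by
  have hS : ({a, a', c, d, b, e} : Set G.H) = {a, a', b, c, d, e} := by
    ext; simp only [Set.mem_insert_iff, Set.mem_singleton_iff]; tauto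
  refine ⟨h.opp_eq, ?_, h.vertex₂, h.vertex₂', h.vertex₃, h.vertex₃', h.vertex, h.vertex',
    fun k hk => ?_, fun k hk => ?_⟩
  · refine (List.Perm.nodup_iff ?_).1 h.nodup
    refine ((List.Perm.cons _ (List.Perm.cons _ ?_)))
    exact (List.perm_append_comm (l₁ := [b]) (l₂ := [c, d])).append_right [e]
  · rw [hS] at hk
    rw [← h.eq₂ k hk, h.eq₃ k hk]
  · rw [hS] at hk
    exact (h.eq₂ k hk).symm

theorem opp_eq' (h : IsJacobi r₁ r₂ r₃ a a' b c d e) : G.opp a' = a := by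
  rw [← h.opp_eq, G.opp_opp]

/-- After expansion into iterated commutators, the twelve terms cancel as in the Jacobi identity for
an associative product. -/
theorem toP_of_stem_last (h : IsJacobi r₁ r₂ r₃ a a' b c d e) {s : G.H} (hs : G.opp s = e)
    {i : Fin n} {L R : List G.H}
    (h₁ : G.IsDiagram Y r₁ (Function.update st i (L ++ s :: R)))
    (h₂ : G.IsDiagram Y r₂ (Function.update st i (L ++ s :: R)))
    (h₃ : G.IsDiagram Y r₃ (Function.update st i (L ++ s :: R))) :
    G.toP Y r₁ (Function.update st i (L ++ s :: R)) +
      G.toP Y r₂ (Function.update st i (L ++ s :: R)) +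
      G.toP Y r₃ (Function.update st i (L ++ s :: R)) = 0 := by
  have hn := h.nodup
  simp only [List.nodup_cons, List.mem_cons, List.not_mem_nil, or_false, not_or, List.nodup_nil,
    not_false_eq_true, and_true] at hn
  rw [toP_stem_stem h₁ (h.vertex'.rotate.rotate.isStem hs) h.opp_eq' h.vertex
      (by simp only [Set.mem_insert_iff, Set.mem_singleton_iff]; tauto) rfl
      (q := cut {a, a', b, c, d, e} r₁)
      (by congr 1; ext; simp only [Set.mem_insert_iff, Set.mem_singleton_iff, Set.mem_union]; tauto),
    toP_stem_stem h₂ (h.vertex₂'.rotate.rotate.isStem hs) h.opp_eq' h.vertex₂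
      (by simp only [Set.mem_insert_iff, Set.mem_singleton_iff]; tauto) rfl
      (q := cut {a, a', b, c, d, e} r₁)
      (by rw [cut_congr h.eq₂]; congr 1; ext; simp only [Set.mem_insert_iff, Set.mem_singleton_iff, Set.mem_union]; tauto),
    toP_stem_stem h₃ (h.vertex₃'.rotate.rotate.isStem hs) h.opp_eq' h.vertex₃
      (by simp only [Set.mem_insert_iff, Set.mem_singleton_iff]; tauto) rfl
      (q := cut {a, a', b, c, d, e} r₁)
      (by rw [cut_congr h.eq₃]; congr 1; ext; simp only [Set.mem_insert_iff, Set.mem_singleton_iff, Set.mem_union]; tauto)]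
  abel

theorem toP_of_stem (h : IsJacobi r₁ r₂ r₃ a a' b c d e) {s : G.H} (hs : G.opp s = d)
    {i : Fin n} {L R : List G.H}
    (h₁ : G.IsDiagram Y r₁ (Function.update st i (L ++ s :: R)))
    (h₂ : G.IsDiagram Y r₂ (Function.update st i (L ++ s :: R)))
    (h₃ : G.IsDiagram Y r₃ (Function.update st i (L ++ s :: R))) :
    G.toP Y r₁ (Function.update st i (L ++ s :: R)) +
      G.toP Y r₂ (Function.update st i (L ++ s :: R)) +
      G.toP Y r₃ (Function.update st i (L ++ s :: R)) = 0 := by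
  have hn := h.nodup
  simp only [List.nodup_cons, List.mem_cons, List.not_mem_nil, or_false, not_or, List.nodup_nil,
    not_false_eq_true, and_true] at hn
  rw [toP_stem_stem' h₁ (h.vertex'.rotate.isStem hs) h.opp_eq' h.vertex
      (by simp only [Set.mem_insert_iff, Set.mem_singleton_iff]; tauto) (Z := (Y \ {s, d}) \ {a, a'})
      (by rw [Set.pair_comm a a']) (q := cut {a, a', b, c, d, e} r₁)
      (by congr 1; ext; simp only [Set.mem_insert_iff, Set.mem_singleton_iff, Set.mem_union]; tauto),
    toP_stem_stem h₂ (h.vertex₂.rotate.rotate.isStem hs) h.opp_eq h.vertex₂'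
      (by simp only [Set.mem_insert_iff, Set.mem_singleton_iff]; tauto) rfl
      (q := cut {a, a', b, c, d, e} r₁)
      (by rw [cut_congr h.eq₂]; congr 1; ext; simp only [Set.mem_insert_iff, Set.mem_singleton_iff, Set.mem_union]; tauto),
    toP_stem_stem' h₃ (h.vertex₃.rotate.isStem hs) h.opp_eq h.vertex₃'
      (by simp only [Set.mem_insert_iff, Set.mem_singleton_iff]; tauto) rfl
      (q := cut {a, a', b, c, d, e} r₁)
      (by rw [cut_congr h.eq₃]; congr 1; ext; simp only [Set.mem_insert_iff, Set.mem_singleton_iff, Set.mem_union]; tauto)]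
  abel

/-- The induction of `toP_add_toP`, for the two vertices of the edge `{a, a'}`. A stem at one of
them ends at `b`, `c`, `d` or `e`; the first three cases are equivalent by the cyclic symmetry of
the relation. -/
theorem toP_eq_zero (h : IsJacobi r₁ r₂ r₃ a a' b c d e) (ha : a ∈ Y) (h₁ : G.IsDiagram Y r₁ st)
    (h₂ : G.IsDiagram Y r₂ st) (h₃ : G.IsDiagram Y r₃ st) :
    G.toP Y r₁ st + G.toP Y r₂ st + G.toP Y r₃ st = 0 := by
  induction hk : Y.ncard using Nat.strong_induction_on generalizing Y r₁ r₂ r₃ st with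
  | _ k ih =>
  obtain ⟨i, L, R, s, p, x, y, hi, hst⟩ :=
    h₁.exists_stem ha (by rw [h.vertex.left]; exact h.vertex.ne)
  obtain ⟨st, rfl⟩ : ∃ st' : Fin n → List G.H, st = Function.update st' i (L ++ s :: R) :=
    ⟨st, by rw [← hi, Function.update_eq_self]⟩
  clear hi
  have hsi : s ∈ Function.update st i (L ++ s :: R) i := by simp
  have hs := h₁.mem hsi
  have hrs := h₁.rot_eq hsi
  by_cases hp : p ∈ ({a, a', b, c, d, e} : Set G.H)
  · have hsne : ∀ {u v w}, IsVertex r₁ u v w → s ≠ u := fun hv h' =>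
      hv.ne (by rw [← hv.left, ← h', hrs])
    rcases hp with rfl | rfl | rfl | rfl | rfl | rfl
    -- A stem cannot end at `a` or `a'`: the other end of this edge lies at a trivalent vertex and
    -- is not a leg.
    · refine absurd ?_ (hsne h.vertex')
      rw [← h.opp_eq, ← hst.opp_eq, G.opp_opp]
    · refine absurd ?_ (hsne h.vertex)
      rw [← h.opp_eq', ← hst.opp_eq, G.opp_opp]
    · rw [add_assoc, add_comm]
      exact h.rotate.toP_of_stem hst.opp_eq h₂ h₃ h₁
    · rw [add_comm, ← add_assoc]
      exact h.rotate.rotate.toP_of_stem hst.opp_eq h₃ h₁ h₂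
    · exact h.toP_of_stem hst.opp_eq h₁ h₂ h₃
    · exact h.toP_of_stem_last hst.opp_eq h₁ h₂ h₃
  · have hS : ({a, a', b, c, d, e} : Set G.H) = {a, b, c} ∪ {a', d, e} := by
      ext; simp only [Set.mem_insert_iff, Set.mem_singleton_iff, Set.mem_union]; tauto
    obtain ⟨hx, hy⟩ := hst.notMem (S := {a, a', b, c, d, e}) (fun k hk => by
      rw [hS] at hk ⊢
      exact hk.imp h.vertex.rot_mem h.vertex'.rot_mem) hp
    have hst₂ := hst.congr (h.eq₂ p hp).symm (h.eq₂ x hx).symm (h.eq₂ y hy).symm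
    have hst₃ := hst.congr (h.eq₃ p hp).symm (h.eq₃ x hx).symm (h.eq₃ y hy).symm
    have hcut : ∀ k ∈ ({a, a', b, c, d, e} : Set G.H), k ∉ ({p, x, y} : Set G.H) := by
      rintro k hk (rfl | rfl | rfl)
      · exact hp hk
      · exact hx hk
      · exact hy hk
    have ha' : a ∈ Y \ {s, p} := by
      refine ⟨ha, ?_⟩
      rintro (h1 | h1)
      · exact h.vertex.ne (by rw [← h.vertex.left, h1, hrs])
      · exact hp (Or.inl h1.symm)
    have ma := hcut a (by simp)
    have ma' := hcut a' (by simp)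
    have mb := hcut b (by simp)
    have mc := hcut c (by simp)
    have md := hcut d (by simp)
    have me := hcut e (by simp)
    have hJ : IsJacobi (cut {p, x, y} r₁) (cut {p, x, y} r₂) (cut {p, x, y} r₃) a a' b c d e := by
      refine ⟨h.opp_eq, h.nodup, h.vertex.cut ma mb mc, h.vertex'.cut ma' md me,
        h.vertex₂.cut ma mc md, h.vertex₂'.cut ma' mb me, h.vertex₃.cut ma md mb,
        h.vertex₃'.cut ma' mc me, fun k hk => ?_, fun k hk => ?_⟩ <;>
      by_cases hA : k ∈ ({p, x, y} : Set G.H)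
      · rw [cut_of_mem hA, cut_of_mem hA]
      · rw [cut_of_notMem hA, cut_of_notMem hA, h.eq₂ k hk]
      · rw [cut_of_mem hA, cut_of_mem hA]
      · rw [cut_of_notMem hA, cut_of_notMem hA, h.eq₃ k hk]
    have step := fun w hw => ih _ (hk ▸ IsStem.ncard_lt hs) hJ ha' (hst.isDiagram (w := w) h₁ hw)
      (hst₂.isDiagram h₂ hw) (hst₃.isDiagram h₃ hw) rfl
    have e1 := step _ (perm_stem L R).1
    have e2 := step _ (perm_stem L R).2
    rw [toP_stem h₁ hst, toP_stem h₂ hst₂, toP_stem h₃ hst₃, sub_add_sub_comm, sub_add_sub_comm,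
      e1, e2, sub_zero]

end IsJacobi

end ChineseCharacter

/-! ### The symmetrization map -/

namespace MarkedCharacter

variable {n : ℕ} {ξ ξ' : MarkedCharacter n}

section arrangementMap

variable (e : ξ.H ≃ ξ'.H) (hext : ∀ h, ξ.rot h = h ↔ ξ'.rot (e h) = e h)
  (hcol : ∀ (h : ξ.External) (h' : ξ'.External), e h.1 = h'.1 → ξ'.color h' = ξ.color h)

/-- The arrangements that correspond to each other under a bijection of the half-edges. -/
def arrangementMap : ξ.Arrangement ≃ ξ'.Arrangement where
  toFun s := ⟨fun i => (s.1 i).map e, fun i => ⟨(s.2 i).1.map e.injective, fun h => by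
    obtain ⟨h, rfl⟩ := e.surjective h
    rw [List.mem_map_of_injective e.injective, (s.2 i).2]
    constructor
    · rintro ⟨hh, hi⟩
      exact ⟨(hext h).1 hh, (hcol ⟨h, hh⟩ _ rfl).trans hi⟩
    · rintro ⟨hh, hi⟩
      exact ⟨(hext h).2 hh, (hcol ⟨h, (hext h).2 hh⟩ _ rfl).symm.trans hi⟩⟩⟩
  invFun s := ⟨fun i => (s.1 i).map e.symm, fun i => ⟨(s.2 i).1.map e.symm.injective, fun h => by
    have : h ∈ (s.1 i).map e.symm ↔ e h ∈ s.1 i := by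
      conv_lhs => rw [← e.symm_apply_apply h]
      exact List.mem_map_of_injective e.symm.injective
    rw [this, (s.2 i).2]
    constructor
    · rintro ⟨hh, hi⟩
      exact ⟨(hext h).2 hh, (hcol ⟨h, (hext h).2 hh⟩ _ rfl).symm.trans hi⟩
    · rintro ⟨hh, hi⟩
      exact ⟨(hext h).1 hh, (hcol ⟨h, hh⟩ _ rfl).trans hi⟩⟩⟩
  left_inv s := Subtype.ext (funext fun i => by simp)
  right_inv s := Subtype.ext (funext fun i => by simp)

include hext hcol in
theorem numColor_eq (i : Fin n) : ξ'.numColor i = ξ.numColor i :=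
  (Nat.card_congr ((e.subtypeEquiv hext).subtypeEquiv fun h => by
    rw [hcol h (e.subtypeEquiv hext h) rfl])).symm

end arrangementMap

/-- The average of the diagrams obtained from the arrangements of the legs of `ξ` on the strings,
after the cyclic orders have been changed to `r`. -/
def averageOf (ξ : MarkedCharacter n) (r : ξ.H → ξ.H) : SpaceP n :=
  (∏ i, ((ξ.numColor i)! : ℚ))⁻¹ • ∑ s : ξ.Arrangement, ξ.toChineseCharacter.toP Set.univ r s.1

/-- The average of `ξ'` is transported to the half-edges and arrangements of `ξ`; only the cyclic
orders `r` remember the difference. In this way all terms of a relation are diagrams on one fixed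
set. -/
theorem Reattach.average_eq {ρ : Equiv.Perm ξ.H} (h : ξ.Reattach ρ ξ')
    (hρ : ∀ h, ξ.rot h = h → ρ h = h) : ∃ r : ξ.H → ξ.H, (∀ h, r (ρ h) = ρ (ξ.rot h)) ∧
      (∀ s : ξ.Arrangement, ξ.toChineseCharacter.IsDiagram Set.univ r s.1) ∧
      ξ'.average = ξ.averageOf r := by
  obtain ⟨e, hopp, hrot, hcol⟩ := h
  have hr : ∀ h, ξ'.rot (e h) = e (e.symm (ξ'.rot (e h))) := fun h => (e.apply_symm_apply _).symm
  have hext := reattach_rot_eq_self hρ hrot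
  have hst : ∀ (s : ξ.Arrangement) i,
    (ξ'.arrange (arrangementMap e hext hcol s)).strand i = (s.1 i).map e := fun s i => rfl
  refine ⟨fun h => e.symm (ξ'.rot (e h)), fun h => by
    change e.symm (ξ'.rot (e (ρ h))) = _
    rw [hrot, e.symm_apply_apply], fun s =>
    isDiagram_of_equiv (ξ'.arrange (arrangementMap e hext hcol s)) e hopp hr (hst s), ?_⟩
  rw [average, averageOf, ← (arrangementMap e hext hcol).sum_comp]
  simp only [numColor_eq e hext hcol]
  congr 1
  refine Finset.sum_congr rfl fun s _ => ?_
  exact (toP_univ (ξ'.arrange (arrangementMap e hext hcol s)) e hopp hr (hst s)).symm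

theorem average_eq (ξ : MarkedCharacter n) :
    (∀ s : ξ.Arrangement, ξ.toChineseCharacter.IsDiagram Set.univ ξ.rot s.1) ∧
      ξ.average = ξ.averageOf ξ.rot := by
  have h : ξ.Reattach 1 ξ := ⟨Equiv.refl _, fun _ => rfl, fun _ => rfl, fun h h' hh => by
    rw [Subtype.ext (a1 := h) (a2 := h') hh]⟩
  obtain ⟨r, hr, hs, h⟩ := h.average_eq fun _ _ => rfl
  obtain rfl : r = ξ.rot := funext hr
  exact ⟨hs, h⟩

theorem averageOf_add (r r' : ξ.H → ξ.H) : ξ.averageOf r + ξ.averageOf r' =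
    (∏ i, ((ξ.numColor i)! : ℚ))⁻¹ • ∑ s : ξ.Arrangement,
      (ξ.toChineseCharacter.toP Set.univ r s.1 + ξ.toChineseCharacter.toP Set.univ r' s.1) := by
  rw [averageOf, averageOf, ← smul_add, Finset.sum_add_distrib]

/-- The relations hold for each arrangement of the legs separately, by the antisymmetry and Jacobi
relations for diagrams. -/
theorem respectsB_average : RespectsB (average (n := n)) where
  homeo ξ ξ' h := by
    obtain ⟨r, hr, -, h⟩ := h.average_eq fun _ _ => rfl
    obtain rfl : r = ξ.rot := funext hr
    rw [h, ξ.average_eq.2]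
  antisymm ξ₁ ξ₂ a ha h := by
    classical
    obtain ⟨r, hr, hs, h⟩ := h.average_eq (swap_fixes_external ha)
    rw [h, ξ₁.average_eq.2, averageOf_add, Finset.sum_eq_zero, smul_zero]
    intro s _
    have hac := ne_rot_rot ha
    have hbc := rot_ne_rot_rot ha
    have hra : Equiv.swap (ξ₁.rot a) (ξ₁.rot (ξ₁.rot a)) a = a :=
      Equiv.swap_apply_of_ne_of_ne ha.symm hac
    refine toP_add_toP (ξ₁.average_eq.1 s) (hs s) (Set.mem_univ a)
      ⟨rfl, rfl, ξ₁.rot_rot_rot a, ha⟩ ⟨?_, ?_, ?_, hac.symm⟩ fun h hh => ?_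
    · have := hr a
      rwa [hra, Equiv.swap_apply_left] at this
    · have := hr (ξ₁.rot a)
      rwa [Equiv.swap_apply_left, Equiv.swap_apply_right] at this
    · have := hr (ξ₁.rot (ξ₁.rot a))
      rwa [ξ₁.rot_rot_rot, Equiv.swap_apply_right, hra] at this
    · simp only [Set.mem_insert_iff, Set.mem_singleton_iff, not_or] at hh
      have := hr h
      rw [Equiv.swap_apply_of_ne_of_ne hh.2.1 hh.2.2, Equiv.swap_apply_of_ne_of_ne] at this
      · exact this.symm
      · exact fun h' => hh.1 (ξ₁.rot.injective h')
      · exact fun h' => hh.2.1 (ξ₁.rot.injective h')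
  jacobi ξ₁ ξ₂ ξ₃ a b c d hb hc hd ha ha' hab hac h₂ h₃ := by
    classical
    have hfix : ∀ h, ξ₁.rot h = h → (Equiv.swap b c * Equiv.swap c d) h = h := by
      intro h hh
      have h1 : ξ₁.rot (ξ₁.opp a) ≠ ξ₁.opp a := hd ▸ ha'
      have h2 : ξ₁.rot a ≠ a := hb ▸ ha
      subst hc hd hb
      exact cycle_fixes_external h2 h1 h hh
    obtain ⟨r₂, hr₂, hs₂, e₂⟩ := h₂.average_eq hfix
    obtain ⟨r₃, hr₃, hs₃, e₃⟩ := h₃.average_eq fun h hh => by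
      rw [Equiv.Perm.inv_eq_iff_eq, hfix h hh]
    rw [e₂, e₃, ξ₁.average_eq.2, averageOf_add, averageOf, ← smul_add, ← Finset.sum_add_distrib,
      Finset.sum_eq_zero, smul_zero]
    intro s _
    have hinj := ξ₁.rot.injective
    rw [hd] at ha'
    obtain ⟨a', haa⟩ : ∃ a', ξ₁.opp a = a' := ⟨_, rfl⟩
    obtain ⟨g, hg⟩ : ∃ g, ξ₁.rot d = g := ⟨_, rfl⟩
    rw [haa] at hd ha' hab hac
    rw [← hd] at ha'
    obtain ⟨hnd, hca, hga, ρ, hρ, p1, p2, p3, p4, p5, p6, p7⟩ :=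
      jacobi_perm haa hb.symm hc.symm hd.symm hg ha ha' hab hac
    rw [← hρ] at hr₂ hr₃
    have i1 : ρ⁻¹ a = a := Equiv.Perm.inv_eq_iff_eq.2 p1.symm
    have i2 : ρ⁻¹ c = b := Equiv.Perm.inv_eq_iff_eq.2 p2.symm
    have i3 : ρ⁻¹ d = c := Equiv.Perm.inv_eq_iff_eq.2 p3.symm
    have i4 : ρ⁻¹ b = d := Equiv.Perm.inv_eq_iff_eq.2 p4.symm
    have i5 : ρ⁻¹ a' = a' := Equiv.Perm.inv_eq_iff_eq.2 p5.symm
    have i6 : ρ⁻¹ g = g := Equiv.Perm.inv_eq_iff_eq.2 p6.symm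
    have i7 : ∀ h, h ≠ b → h ≠ c → h ≠ d → ρ⁻¹ h = h := fun h h1 h2 h3 =>
      Equiv.Perm.inv_eq_iff_eq.2 (p7 h h1 h2 h3).symm
    have hne := hnd
    simp only [List.nodup_cons, List.mem_cons, List.not_mem_nil, or_false, not_or, List.nodup_nil,
      not_false_eq_true, and_true] at hne
    have hout : ∀ h ∉ ({a, a', b, c, d, g} : Set ξ₁.H), (h ≠ b ∧ h ≠ c ∧ h ≠ d) ∧
        ξ₁.rot h ≠ b ∧ ξ₁.rot h ≠ c ∧ ξ₁.rot h ≠ d := by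
      intro h hh
      simp only [Set.mem_insert_iff, Set.mem_singleton_iff, not_or] at hh
      refine ⟨by tauto, fun h' => hh.1 (hinj (h'.trans hb)), fun h' => hh.2.2.1 (hinj (h'.trans hc)),
        fun h' => hh.2.1 (hinj (h'.trans hd))⟩
    refine IsJacobi.toP_eq_zero (a := a) (a' := a') (b := b) (c := c) (d := d) (e := g)
      ⟨haa, hnd, ⟨hb.symm, hc.symm, hca, ha⟩, ⟨hd.symm, hg, hga, ha'⟩, ⟨?_, ?_, ?_, ?_⟩,
        ⟨?_, ?_, ?_, hab.symm⟩, ⟨?_, ?_, ?_, ?_⟩, ⟨?_, ?_, ?_, hac.symm⟩, fun h hh => ?_,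
        fun h hh => ?_⟩ (Set.mem_univ a) (ξ₁.average_eq.1 s) (hs₂ s) (hs₃ s)
    · rw [← p1, hr₂, ← hb, p2]
    · rw [← p2, hr₂, ← hc, p3]
    · rw [← p3, hr₂, hca, p1]
    · tauto
    · rw [← p5, hr₂, ← hd, p4]
    · rw [← p4, hr₂, hg, p6]
    · rw [← p6, hr₂, hga, p5]
    · rw [← i1, hr₃, ← hb, i4]
    · rw [← i4, hr₃, ← hc, i2]
    · rw [← i2, hr₃, hca, i1]
    · tauto
    · rw [← i5, hr₃, ← hd, i3]
    · rw [← i3, hr₃, hg, i6]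
    · rw [← i6, hr₃, hga, i5]
    · obtain ⟨⟨h1, h2, h3⟩, h4, h5, h6⟩ := hout h hh
      have := hr₂ h
      rwa [p7 h h1 h2 h3, p7 _ h4 h5 h6, eq_comm] at this
    · obtain ⟨⟨h1, h2, h3⟩, h4, h5, h6⟩ := hout h hh
      have := hr₃ h
      rwa [i7 h h1 h2 h3, i7 _ h4 h5 h6, eq_comm] at this

end MarkedCharacter

/-- The symmetrization map. -/
def symmetrization (n : ℕ) : SpaceB n →ₗ[ℚ] SpaceP n := liftB average respectsB_average

theorem symmetrization_toB {n : ℕ} (ξ : MarkedCharacter n) : symmetrization n ξ.toB = ξ.average := liftB_toB _ _ _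

/-! ### The number of arrangements -/

theorem card_orderings {α : Type*} (S : Set α) [Finite S] :
    Nat.card {L : List α // L.Nodup ∧ ∀ x, x ∈ L ↔ x ∈ S} = (Nat.card S)! := by
  classical
  obtain ⟨T, rfl⟩ := Set.Finite.exists_finset_coe (Set.toFinite S)
  have h : ∀ L : List α, (L.Nodup ∧ ∀ x, x ∈ L ↔ x ∈ (T : Set α)) ↔
      L ∈ T.toList.permutations.toFinset := by
    intro L
    rw [List.mem_toFinset, List.mem_permutations]
    constructor
    · rintro ⟨h1, h2⟩
      exact (List.perm_ext_iff_of_nodup h1 T.nodup_toList).2 fun x => by simp [h2]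
    · intro h
      exact ⟨h.nodup_iff.2 T.nodup_toList, fun x => by rw [h.mem_iff]; simp⟩
  rw [Nat.card_congr (Equiv.subtypeEquivRight h)]
  rw [Nat.card_eq_fintype_card, Fintype.card_coe, List.toFinset_card_of_nodup
    (List.nodup_permutations _ T.nodup_toList), List.length_permutations]
  simp

namespace MarkedCharacter

variable {n : ℕ} (ξ : MarkedCharacter n)

theorem card_arrangement : Fintype.card ξ.Arrangement = ∏ i, (ξ.numColor i)! := by
  have := ξ.finite_H
  let S : Fin n → Set ξ.H := fun i => {h | ∃ hh : ξ.rot h = h, ξ.color ⟨h, hh⟩ = i}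
  have e : ξ.Arrangement ≃ ∀ i, {L : List ξ.H // L.Nodup ∧ ∀ x, x ∈ L ↔ x ∈ S i} :=
    { toFun := fun s i => ⟨s.1 i, s.2 i⟩
      invFun := fun s => ⟨fun i => (s i).1, fun i => (s i).2⟩
      left_inv := fun _ => rfl
      right_inv := fun _ => rfl }
  rw [← Nat.card_eq_fintype_card, Nat.card_congr e, Nat.card_pi]
  refine Finset.prod_congr rfl fun i _ => ?_
  rw [card_orderings]
  congr 1
  exact Nat.card_congr
    { toFun := fun h => ⟨⟨h.1, h.2.1⟩, h.2.2⟩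
      invFun := fun h => ⟨h.1.1, h.1.2, h.2⟩
      left_inv := fun _ => rfl
      right_inv := fun _ => rfl }

theorem card_arrangement_smul_average :
    (Fintype.card ξ.Arrangement : ℚ) • ξ.average = ∑ s : ξ.Arrangement, (ξ.arrange s).toP := by
  rw [card_arrangement, average, smul_smul, Nat.cast_prod, mul_inv_cancel₀, one_smul]
  exact Finset.prod_ne_zero_iff.2 fun i _ => Nat.cast_ne_zero.2 (Nat.factorial_ne_zero _)

theorem card_arrangement_ne_zero : (Fintype.card ξ.Arrangement : ℚ) ≠ 0 := by
  rw [card_arrangement]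
  exact Nat.cast_ne_zero.2 (Finset.prod_ne_zero_iff.2 fun i _ => Nat.factorial_ne_zero _)

theorem sum_numColor : ∑ i, ξ.numColor i = ξ.numExternal := by
  have := ξ.finite_H
  have h : ξ.External ≃ Σ i, {h // ξ.color h = i} := (Equiv.sigmaFiberEquiv ξ.color).symm
  rw [numExternal, Nat.card_congr h, Nat.card_sigma]
  rfl

end MarkedCharacter

/-! ### Surjectivity of the symmetrization map -/

namespace ChineseCharacter

variable (G : ChineseCharacter) {n : ℕ}

/-- The legs of `G` are placed on strings. -/
structure IsStrands (st : Fin n → List G.H) : Prop where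
  nodup : ∀ i, (st i).Nodup
  disjoint : ∀ i j h, h ∈ st i → h ∈ st j → i = j
  mem_iff : ∀ h, (∃ i, h ∈ st i) ↔ G.rot h = h

variable {G} {st st' : Fin n → List G.H}

/-- The diagram given by placing the legs on strings. -/
def IsStrands.diagram (h : G.IsStrands st) : CharacterDiagram n :=
  { G with strand := st, nodup := h.nodup, disjoint := h.disjoint, mem_iff := h.mem_iff }

theorem IsStrands.of_perm (h : G.IsStrands st) (hp : ∀ i, (st' i).Perm (st i)) :
    G.IsStrands st' where
  nodup i := (hp i).nodup_iff.2 (h.nodup i)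
  disjoint i j x hi hj := h.disjoint i j x ((hp i).mem_iff.1 hi) ((hp j).mem_iff.1 hj)
  mem_iff x := by simp only [(hp _).mem_iff, h.mem_iff]

end ChineseCharacter

namespace CharacterDiagram

variable {n : ℕ}

/-- The number of legs. -/
def length (D : CharacterDiagram n) : ℕ := ∑ i, (D.strand i).length

theorem isStrands (D : CharacterDiagram n) : D.IsStrands D.strand := ⟨D.nodup, D.disjoint, D.mem_iff⟩

end CharacterDiagram

namespace ChineseCharacter

variable {G : ChineseCharacter} {n : ℕ} {st st' : Fin n → List G.H}

/-- The third diagram of STU is obtained by joining the neighbours `b` and `c`; one leg is lost,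
which drives the induction for surjectivity. -/
theorem IsStrands.exists_stu (h : G.IsStrands st) {i : Fin n} {L R : List G.H} {b c : G.H}
    (hi : st i = L ++ b :: c :: R)
    (h' : G.IsStrands (Function.update st i (L ++ c :: b :: R))) :
    ∃ S : CharacterDiagram n, CharacterDiagram.STU S h.diagram h'.diagram ∧
      S.length < h.diagram.length := by
  have hbi : b ∈ st i := by rw [hi]; simp
  have hci : c ∈ st i := by rw [hi]; simp
  have hb : G.rot b = b := (h.mem_iff b).1 ⟨i, hbi⟩
  have hc : G.rot c = c := (h.mem_iff c).1 ⟨i, hci⟩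
  have hnd := h.nodup i
  rw [hi] at hnd
  have hp : (L ++ b :: c :: R).Perm (b :: c :: (L ++ R)) :=
    List.perm_middle.trans (List.perm_middle.cons _)
  have hnd' := hp.nodup_iff.1 hnd
  simp only [List.nodup_cons, List.mem_cons, not_or] at hnd'
  obtain ⟨⟨hbc, hbLR⟩, hcLR, hLR⟩ := hnd'
  have hbc' : (⟨b, hb⟩ : G.External) ≠ ⟨c, hc⟩ := fun h => hbc (congrArg Subtype.val h)
  let w : List (G.H ⊕ Bool) := L.map Sum.inl ++ Sum.inr false :: R.map Sum.inl
  have hw : w.Perm (Sum.inr false :: (L ++ R).map Sum.inl) := by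
    rw [List.map_append]; exact List.perm_middle
  let str : Fin n → List (G.H ⊕ Bool) := Function.update (fun j => (st j).map Sum.inl) i w
  have hstri : str i = w := Function.update_self ..
  have hstrj : ∀ j, j ≠ i → str j = (st j).map Sum.inl := fun j hj => Function.update_of_ne hj ..
  have hstr : ∀ j y, y ∈ str j ↔
      (j = i ∧ y = Sum.inr false) ∨ ∃ x, y = Sum.inl x ∧ x ∈ st j ∧ x ≠ b ∧ x ≠ c := by
    intro j y
    by_cases hj : j = i
    · subst hj
      simp only [hstri, hw.mem_iff, List.mem_cons, List.mem_map, true_and]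
      refine or_congr Iff.rfl ⟨?_, ?_⟩
      · rintro ⟨x, hx, rfl⟩
        refine ⟨x, rfl, ?_, fun h => hbLR (h ▸ hx), fun h => hcLR (h ▸ hx)⟩
        rw [hi, hp.mem_iff]
        simp [List.mem_append.1 hx]
      · rintro ⟨x, rfl, hx, h1, h2⟩
        rw [hi, hp.mem_iff] at hx
        simp only [List.mem_cons, h1, h2, false_or] at hx
        exact ⟨x, hx, rfl⟩
    · simp only [hstrj j hj, List.mem_map, hj, false_and, false_or]
      constructor
      · rintro ⟨x, hx, rfl⟩
        exact ⟨x, rfl, hx, fun h' => hj (h.disjoint _ _ _ hx (h' ▸ hbi)),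
          fun h' => hj (h.disjoint _ _ _ hx (h' ▸ hci))⟩
      · rintro ⟨x, rfl, hx, -⟩
        exact ⟨x, hx, rfl⟩
  have hS : (G.glue ⟨b, hb⟩ ⟨c, hc⟩ hbc').IsStrands str := by
    refine ⟨fun j => ?_, fun j k y hj hk => ?_, fun y => ?_⟩
    · by_cases hj : j = i
      · subst hj
        rw [hstri]
        refine hw.nodup_iff.2 (List.nodup_cons.2 ⟨by simp, hLR.map Sum.inl_injective⟩)
      · rw [hstrj j hj]
        exact (h.nodup j).map Sum.inl_injective
    · rcases (hstr j y).1 hj with ⟨rfl, rfl⟩ | ⟨x, rfl, hx, -⟩ <;>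
        rcases (hstr k _).1 hk with ⟨rfl, h2⟩ | ⟨x', h2, hx', -⟩
      · rfl
      · exact absurd h2 (by simp)
      · exact absurd h2 (by simp)
      · obtain rfl := Sum.inl_injective h2
        exact h.disjoint _ _ _ hx hx'
    · constructor
      · rintro ⟨j, hj⟩
        rcases (hstr j y).1 hj with ⟨rfl, rfl⟩ | ⟨x, rfl, hx, h1, h2⟩
        · exact glueRot_false
        · exact (glue_rot_inl_eq_self hbc').2 ⟨(h.mem_iff x).1 ⟨j, hx⟩, h1, h2⟩
      · intro hy
        obtain x | _ | _ := y
        · obtain ⟨h1, h2, h3⟩ := (glue_rot_inl_eq_self hbc').1 hy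
          obtain ⟨j, hj⟩ := (h.mem_iff x).2 h1
          exact ⟨j, (hstr _ _).2 (Or.inr ⟨x, rfl, hj, h2, h3⟩)⟩
        · exact ⟨i, (hstr _ _).2 (Or.inl ⟨rfl, rfl⟩)⟩
        · exact absurd hy (glue_rot_true_ne hbc')
  refine ⟨hS.diagram, ⟨Equiv.refl _, Equiv.refl _, i, L, R, b, c, hi, fun _ => rfl, fun _ => rfl,
    ?_, fun j hj => ?_, fun _ => rfl, rfl, fun x h1 h2 => glueRot_of_ne h1 h2, glueRot_false,
    glueRot_true, glueRot_right hbc', glueRot_left hbc', ?_, fun j hj => ?_⟩, ?_⟩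
  · change Function.update st i _ i = _
    rw [Function.update_self]
    exact (List.map_id _).symm
  · change Function.update st i _ j = _
    rw [Function.update_of_ne hj]
    exact (List.map_id _).symm
  · exact hstri
  · exact hstrj j hj
  · refine Finset.sum_lt_sum (fun j _ => ?_) ⟨i, Finset.mem_univ i, ?_⟩
    · change List.length (str j) ≤ (st j).length
      by_cases hj : j = i
      · subst hj
        rw [hstri, hi]
        simp [w]
      · rw [hstrj j hj]; simp
    · change List.length (str i) < (st i).length
      rw [hstri, hi]
      simp [w]

/-- A permutation of the legs on one string is generated by interchanges of neighbours, each of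
which costs a diagram with fewer legs. The prefix `p` collects the legs already passed. -/
theorem IsStrands.sub_mem_of_perm {M : Submodule ℚ (SpaceP n)} {k : ℕ}
    (hM : ∀ D : CharacterDiagram n, D.length < k → D.toP ∈ M) {i : Fin n} {u v : List G.H}
    (huv : u.Perm v) : ∀ (p : List G.H) (st : Fin n → List G.H)
      (h : G.IsStrands (Function.update st i (p ++ u)))
      (h' : G.IsStrands (Function.update st i (p ++ v))), h.diagram.length ≤ k →
      h.diagram.toP - h'.diagram.toP ∈ M := by
  induction huv with
  | nil => intro p st h h' _; rw [sub_self]; exact M.zero_mem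
  | @cons x u v huv ih =>
    intro p st h h' hk
    have := ih (p ++ [x]) st (by simpa using h) (by simpa using h') (by simpa using hk)
    simpa using this
  | swap x y u =>
    intro p st h h' hk
    obtain ⟨S, hS, hlt⟩ := h.exists_stu (i := i) (L := p) (b := y) (c := x) (R := u) (by simp)
      (by simpa using h')
    have := hM S (hlt.trans_le hk)
    rw [toP_eq_sub hS] at this
    simpa using this
  | @trans u v w huv hvw ih1 ih2 =>
    intro p st h h' hk
    have hm : G.IsStrands (Function.update st i (p ++ v)) := h.of_perm fun j => by
      by_cases hj : j = i
      · subst hj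
        rw [Function.update_self, Function.update_self]
        exact huv.symm.append_left p
      · simp [Function.update_of_ne hj]
    have hlen : hm.diagram.length = h.diagram.length := by
      refine Finset.sum_congr rfl fun j _ => ?_
      change (Function.update st i (p ++ v) j).length = (Function.update st i (p ++ u) j).length
      by_cases hj : j = i
      · subst hj; simp [huv.length_eq]
      · simp [Function.update_of_ne hj]
    rw [← sub_add_sub_cancel _ hm.diagram.toP]
    exact M.add_mem (ih1 p st h hm hk) (ih2 p st hm h' (hlen.trans_le hk))

theorem IsStrands.sub_mem {M : Submodule ℚ (SpaceP n)} {k : ℕ}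
    (hM : ∀ D : CharacterDiagram n, D.length < k → D.toP ∈ M) (h : G.IsStrands st)
    (h' : G.IsStrands st') (hp : ∀ i, (st i).Perm (st' i)) (hk : h.diagram.length ≤ k) :
    h.diagram.toP - h'.diagram.toP ∈ M := by
  classical
  -- The strings are rearranged one after the other; those in `T` are done.
  have key : ∀ T : Finset (Fin n),
      ∃ hT : G.IsStrands (fun i => if i ∈ T then st' i else st i),
        h.diagram.toP - hT.diagram.toP ∈ M := by
    intro T
    induction T using Finset.induction_on with
    | empty =>
      refine ⟨by simpa using h, ?_⟩
      simp
    | insert i T hi ih =>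
      obtain ⟨hT, ih⟩ := ih
      have hperm : ∀ T : Finset (Fin n), ∀ j,
          (if j ∈ T then st' j else st j).Perm (st j) := fun T j => by
        split_ifs
        · exact (hp j).symm
        · rfl
      have hI : G.IsStrands (fun j => if j ∈ insert i T then st' j else st j) :=
        h.of_perm (hperm _)
      refine ⟨hI, ?_⟩
      have e1 : (fun j => if j ∈ T then st' j else st j) =
          Function.update (fun j => if j ∈ T then st' j else st j) i ([] ++ st i) := by
        rw [List.nil_append, eq_comm, Function.update_eq_self_iff, if_neg hi]
      have e2 : (fun j => if j ∈ insert i T then st' j else st j) =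
          Function.update (fun j => if j ∈ T then st' j else st j) i ([] ++ st' i) := by
        funext j
        by_cases hj : j = i
        · subst hj; simp
        · simp [hj]
      have hlen : hT.diagram.length = h.diagram.length :=
        Finset.sum_congr rfl fun j _ => (hperm T j).length_eq
      have hstep : hT.diagram.toP - hI.diagram.toP ∈ M := by
        have := IsStrands.sub_mem_of_perm (G := G) hM (hp i) []
          (fun j => if j ∈ T then st' j else st j) (e1 ▸ hT) (e2 ▸ hI)
        simp only [← e1, ← e2] at this
        exact this (hlen.trans_le hk)
      rw [← sub_add_sub_cancel _ hT.diagram.toP]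
      exact M.add_mem ih hstep
  obtain ⟨hT, hmem⟩ := key Finset.univ
  simpa using hmem

end ChineseCharacter

namespace CharacterDiagram

variable {n : ℕ}

/-- The graph of a diagram, where the legs have the colours of their strings. -/
def marked (D : CharacterDiagram n) : MarkedCharacter n where
  toChineseCharacter := D.toChineseCharacter
  color h := ((D.mem_iff h.1).2 h.2).choose

theorem marked_color (D : CharacterDiagram n) (h : D.External) {i : Fin n} :
    D.marked.color h = i ↔ h.1 ∈ D.strand i := by
  have := ((D.mem_iff h.1).2 h.2).choose_spec
  constructor
  · rintro rfl; exact this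
  · intro hi; exact D.disjoint _ _ _ this hi

theorem perm_marked (D : CharacterDiagram n) (s : D.marked.Arrangement) (i : Fin n) :
    (D.strand i).Perm (s.1 i) := by
  refine (List.perm_ext_iff_of_nodup (D.nodup i) (s.2 i).1).2 fun h => ?_
  refine Iff.trans ?_ ((s.2 i).2 h).symm
  constructor
  · intro hi
    exact ⟨rot_of_mem hi, (D.marked_color ⟨h, rot_of_mem hi⟩).2 hi⟩
  · rintro ⟨hh, hi⟩
    exact (D.marked_color ⟨h, hh⟩).1 hi

/-- All arrangements of the legs of `D` on their strings agree with `D` up to diagrams with fewer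
legs, which are in the range by induction. Hence so does their average, which is a value of the map.
-/
theorem toP_mem_range (D : CharacterDiagram n) : D.toP ∈ LinearMap.range (symmetrization n) := by
  induction hk : D.length using Nat.strong_induction_on generalizing D with
  | _ k ih =>
  have hM : ∀ D : CharacterDiagram n, D.length < k → D.toP ∈ LinearMap.range (symmetrization n) :=
    fun D hD => ih _ hD D rfl
  have h1 : ∑ s : D.marked.Arrangement, (D.toP - (D.marked.arrange s).toP) ∈
      LinearMap.range (symmetrization n) := by
    refine Submodule.sum_mem _ fun s _ => ?_
    exact IsStrands.sub_mem hM D.isStrands (D.marked.arrange s).isStrands (D.perm_marked s) hk.le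
  rw [Finset.sum_sub_distrib, ← card_arrangement_smul_average, ← symmetrization_toB,
    Finset.sum_const, Finset.card_univ, ← Nat.cast_smul_eq_nsmul ℚ] at h1
  have h2 := Submodule.add_mem _ h1
    (Submodule.smul_mem _ (Fintype.card D.marked.Arrangement : ℚ)
      (LinearMap.mem_range_self (symmetrization n) D.marked.toB))
  rw [sub_add_cancel] at h2
  exact (Submodule.smul_mem_iff _ D.marked.card_arrangement_ne_zero).1 h2

end CharacterDiagram

theorem symmetrization_surjective (n : ℕ) : Function.Surjective (symmetrization n) := by
  rw [← LinearMap.range_eq_top, eq_top_iff, ← span_toP, Submodule.span_le]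
  rintro _ ⟨D, rfl⟩
  exact D.toP_mem_range

/-! ### The inverse of the symmetrization map -/

namespace MarkedCharacter

open CharacterDiagram

variable {l : ℕ} (ξ : MarkedCharacter l)

theorem nonempty_arrangement : Nonempty ξ.Arrangement := by
  rw [← Fintype.card_pos_iff, card_arrangement]
  exact Finset.prod_pos fun i _ => Nat.factorial_pos _

theorem mem_strand_arrange (s : ξ.Arrangement) {h : ξ.H} {i : Fin l} :
    h ∈ (ξ.arrange s).strand i ↔ ∃ hh : ξ.rot h = h, ξ.color ⟨h, hh⟩ = i := (s.2 i).2 h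

/-- A labelling of the legs, and places of the labels on the strings for each arrangement. -/
theorem exists_labelling : ∃ (N : ℕ) (lab : ξ.H → Fin N) (κ : Fin N → Fin l)
    (pos : ξ.Arrangement → Fin N → ℕ),
    (∀ s, (ξ.arrange s).IsLabelling lab κ (pos s)) ∧
    (∀ x, ∃ h, ξ.rot h = h ∧ lab h = x) ∧ ∀ h : ξ.External, κ (lab h.1) = ξ.color h := by
  classical
  obtain ⟨s₀⟩ := ξ.nonempty_arrangement
  obtain ⟨N, lab, κ, pos, hL, hsurj⟩ := (ξ.arrange s₀).exists_labelling
  have hκ : ∀ h : ξ.External, κ (lab h.1) = ξ.color h := fun h =>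
    ((ξ.mem_strand_arrange s₀).1 (hL.mem h.1 h.2)).2.symm
  -- Labels and colours come from one arrangement and serve all of them, so that the values at all
  -- arrangements are totals of one labelled graph.
  refine ⟨N, lab, κ, fun s x => (s.1 (κ x)).idxOf (hsurj x).choose, fun s => ?_, hsurj, hκ⟩
  have hr : ∀ h, ξ.rot h = h → (hsurj (lab h)).choose = h := fun h hh =>
    hL.inj _ _ (hsurj _).choose_spec.1 hh (hsurj _).choose_spec.2
  have hmem : ∀ h (hh : ξ.rot h = h), h ∈ (ξ.arrange s).strand (κ (lab h)) := fun h hh =>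
    (ξ.mem_strand_arrange s).2 ⟨hh, (hκ ⟨h, hh⟩).symm⟩
  refine ⟨hL.inj, hmem, fun i => ?_, fun x y hxy h => ?_⟩
  · have : (s.1 i).Pairwise fun x y => (s.1 i).idxOf x < (s.1 i).idxOf y := by
      rw [List.pairwise_iff_getElem]
      intro a b ha hb hab
      rwa [List.Nodup.idxOf_getElem (s.2 i).1, List.Nodup.idxOf_getElem (s.2 i).1]
    refine List.Pairwise.imp_of_mem (fun {x y} hx hy hxy => ?_) this
    obtain ⟨hx, hxi⟩ := ((s.2 i).2 x).1 hx
    obtain ⟨hy, hyi⟩ := ((s.2 i).2 y).1 hy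
    change (s.1 (κ (lab x))).idxOf (hsurj (lab x)).choose <
      (s.1 (κ (lab y))).idxOf (hsurj (lab y)).choose
    rwa [hr x hx, hr y hy, hκ ⟨x, hx⟩, hκ ⟨y, hy⟩, hxi, hyi]
  · change κ x = κ y at hxy
    have h1 := hmem _ (hsurj x).choose_spec.1
    rw [(hsurj x).choose_spec.2] at h1
    simp only [hxy] at h h1
    rw [← (hsurj x).choose_spec.2, ← (hsurj y).choose_spec.2, (List.idxOf_inj h1).1 h]

/-- Colour-preserving permutations of the labels permute the arrangements. So the sum over
arrangements may also be averaged over these permutations, and `sum_colorPerms_total` leaves only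
the graph without brackets. -/
theorem desymm_average : desymm l ξ.average = ξ.toB := by
  classical
  obtain ⟨N, lab, κ, pos, hL, hsurj, hκ⟩ := ξ.exists_labelling
  obtain ⟨s₀⟩ := ξ.nonempty_arrangement
  let X : SpaceB N := ((ξ.arrange s₀).labelled lab).toB
  let S : Finset (Fin N) := (ξ.arrange s₀).labels lab
  have hval : ∀ s, desymm l (ξ.arrange s).toP = (graphSystem κ).total (pos s) S X := fun s => by
    rw [desymm_toP, desymmetrize_eq (hL s)]
    rfl
  have hout : (graphSystem κ).out X = ξ.toB := by
    change recolorB κ X = _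
    rw [recolorB_toB]
    congr 1
    change MarkedCharacter.mk _ _ = ξ
    have : κ ∘ (fun h : ξ.External => lab h.1) = ξ.color := funext hκ
    exact congrArg (MarkedCharacter.mk ξ.toChineseCharacter) this
  -- colour-preserving permutations of the labels permute the arrangements
  have hbij : Function.Bijective fun h : ξ.External => lab h.1 :=
    ⟨fun h h' hh => Subtype.ext ((hL s₀).inj _ _ h.2 h'.2 hh), fun x => by
      obtain ⟨h, hh, hx⟩ := hsurj x
      exact ⟨⟨h, hh⟩, hx⟩⟩
  let E : ξ.External ≃ Fin N := Equiv.ofBijective _ hbij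
  have hperm : ∀ σ ∈ (graphSystem κ).colorPerms,
      ∑ s, (graphSystem κ).total (pos s ∘ σ) S X = ∑ s, (graphSystem κ).total (pos s) S X := by
    intro σ hσ
    rw [GlueSystem.mem_colorPerms] at hσ
    let σ' : Equiv.Perm ξ.External := E.permCongr.symm σ
    -- The inverse of `σ`, moved to the legs and extended by the identity: carrying an arrangement
    -- along `e` has the same effect on orders as composing its positions with `σ`.
    let e : Equiv.Perm ξ.H := Equiv.Perm.ofSubtype σ'.symm
    have he : ∀ h : ξ.External, e h.1 = (σ'.symm h).1 := fun h =>
      Equiv.Perm.ofSubtype_apply_coe _ h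
    have hσ' : ∀ h : ξ.External, lab (σ' h).1 = σ (lab h.1) := fun h => by
      change E (E.symm (σ (E h))) = _
      rw [E.apply_symm_apply]
      rfl
    have hlab : ∀ h : ξ.External, σ (lab (e h.1)) = lab h.1 := fun h => by
      rw [he, ← hσ', σ'.apply_symm_apply]
    have hext : ∀ h, ξ.rot h = h ↔ ξ.rot (e h) = e h := by
      intro h
      constructor
      · intro hh
        rw [he ⟨h, hh⟩]
        exact (σ'.symm ⟨h, hh⟩).2
      · intro hh
        by_contra hne
        have : e h = h := Equiv.Perm.ofSubtype_apply_of_not_mem _ hne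
        rw [this] at hh
        exact hne hh
    have hcol : ∀ (h h' : ξ.External), e h.1 = h'.1 → ξ.color h' = ξ.color h := by
      intro h h' hh
      rw [← hκ, ← hκ, ← hh, ← hlab h]
      exact (hσ _).symm
    refine Fintype.sum_equiv (arrangementMap e hext hcol) _ _ fun s => ?_
    have hsorted : ∀ i, ((s.1 i).map e).Pairwise fun x y => (pos s ∘ σ) (lab x) < (pos s ∘ σ) (lab y) := by
      intro i
      rw [List.pairwise_map]
      refine List.Pairwise.imp_of_mem (fun {x y} hx hy hxy => ?_) ((hL s).sorted i)
      obtain ⟨hx, -⟩ := (ξ.mem_strand_arrange s).1 hx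
      obtain ⟨hy, -⟩ := (ξ.mem_strand_arrange s).1 hy
      change pos s (σ (lab (e x))) < pos s (σ (lab (e y)))
      rwa [hlab ⟨x, hx⟩, hlab ⟨y, hy⟩]
    have hsame : (graphSystem κ).SameOrder (pos (arrangementMap e hext hcol s)) (pos s ∘ σ) S :=
      (hL (arrangementMap e hext hcol s)).sameOrder hsorted
    rw [GlueSystem.total_congr hsame]
  -- The double sum over arrangements and permutations is evaluated in both orders.
  have h1 : ((graphSystem κ).colorPerms.card : ℚ) •
      ∑ s, (graphSystem κ).total (pos s) S X =
      ((graphSystem κ).colorPerms.card : ℚ) • (Fintype.card ξ.Arrangement : ℚ) • ξ.toB := by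
    rw [Nat.cast_smul_eq_nsmul, Nat.cast_smul_eq_nsmul, Nat.cast_smul_eq_nsmul, ← Finset.sum_const,
      ← Finset.sum_congr rfl hperm, Finset.sum_comm, Finset.sum_congr rfl fun s _ =>
        ((graphSystem κ).sum_colorPerms_total (hL s).injOn S X).1, Finset.sum_const, hout,
      Finset.card_univ, smul_comm]
  have hK : ((graphSystem κ).colorPerms.card : ℚ) ≠ 0 := by
    refine Nat.cast_ne_zero.2 (Finset.card_ne_zero.2 ⟨1, ?_⟩)
    rw [GlueSystem.mem_colorPerms]
    exact fun _ => rfl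
  have h2 := smul_right_injective _ hK h1
  rw [← Finset.sum_congr rfl fun s _ => hval s, ← map_sum, ← card_arrangement_smul_average,
    map_smul] at h2
  exact smul_right_injective _ ξ.card_arrangement_ne_zero h2

end MarkedCharacter

/-- The symmetrization map is an isomorphism with inverse `desymm`. -/
def symmetrizationEquiv (l : ℕ) : SpaceB l ≃ₗ[ℚ] SpaceP l :=
  LinearEquiv.ofLinearMap (symmetrization l) (desymm l)
    (by
      refine LinearMap.ext fun x => ?_
      obtain ⟨x, rfl⟩ := symmetrization_surjective l x
      have : desymm l ∘ₗ symmetrization l = LinearMap.id := linearMapB_ext fun ξ => by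
        simp [symmetrization_toB, desymm_average]
      exact congrArg (symmetrization l) (LinearMap.congr_fun this x))
    (linearMapB_ext fun ξ => by simp [symmetrization_toB, desymm_average])

theorem symmetrizationEquiv_toB {l : ℕ} (ξ : MarkedCharacter l) :
    symmetrizationEquiv l ξ.toB = ξ.average := symmetrization_toB ξ

theorem symmetrizationEquiv_symm_toP {l : ℕ} (D : CharacterDiagram l) :
    (symmetrizationEquiv l).symm D.toP = D.desymmetrize := desymm_toP D

/-! ### Denominators of the symmetrization map -/

/-- The first colour has at most `m - 1` legs because a second one occurs, and all other colours
together have at most `m - 1` because the first occurs. Each group contributes a divisor of `(m -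
1)!`. -/
theorem prod_factorial_dvd_sq {l : ℕ} (hl : 2 ≤ l) (k : Fin l → ℕ) (hk : ∀ i, k i ≠ 0) :
    ∏ i, (k i)! ∣ (∑ i, k i - 1)! ^ 2 := by
  let i₀ : Fin l := ⟨0, by omega⟩
  let i₁ : Fin l := ⟨1, by omega⟩
  have hi : i₁ ∈ Finset.univ.erase i₀ := by simp [i₀, i₁]
  have hsum := Finset.add_sum_erase Finset.univ k (Finset.mem_univ i₀)
  have h0 := hk i₀
  have h1 : k i₁ ≤ ∑ i ∈ Finset.univ.erase i₀, k i :=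
    Finset.single_le_sum (fun _ _ => Nat.zero_le _) hi
  have h2 := hk i₁
  rw [← Finset.mul_prod_erase Finset.univ _ (Finset.mem_univ i₀), sq]
  exact Nat.mul_dvd_mul (Nat.factorial_dvd_factorial (by omega))
    ((Nat.prod_factorial_dvd_factorial_sum _ _).trans (Nat.factorial_dvd_factorial (by omega)))

namespace MarkedCharacter

variable {n : ℕ} (ξ : MarkedCharacter n)

theorem prod_factorial_smul_average_mem {Y : Submodule ℤ (SpaceP n)}
    (hY : ∀ s : ξ.Arrangement, (ξ.arrange s).toP ∈ Y) :
    (∏ i, (ξ.numColor i)!) • ξ.average ∈ Y := by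
  rw [← card_arrangement, ← Nat.cast_smul_eq_nsmul ℚ, card_arrangement_smul_average]
  exact Y.sum_mem fun s _ => hY s

theorem factorial_smul_average_mem : (ξ.numExternal)! • ξ.average ∈ latticeP n := by
  obtain ⟨m, hm⟩ := Nat.prod_factorial_dvd_factorial_sum Finset.univ ξ.numColor
  rw [sum_numColor] at hm
  rw [hm, mul_comm, mul_smul]
  exact (latticeP n).smul_of_tower_mem m
    (ξ.prod_factorial_smul_average_mem fun s => Submodule.subset_span ⟨_, rfl⟩)

theorem numColor_ne_zero (h : ξ.IsNondegenerate) (i : Fin n) : ξ.numColor i ≠ 0 := by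
  have := ξ.finite_H
  obtain ⟨x, hx⟩ := h i
  exact Nat.card_ne_zero.2 ⟨⟨⟨x, hx⟩⟩, inferInstance⟩

theorem factorial_sq_smul_average_mem (hn : 2 ≤ n) (hc : ξ.IsConnected) (h : ξ.IsNondegenerate) :
    ((ξ.numExternal - 1)! ^ 2) • ξ.average ∈ latticeQ n := by
  obtain ⟨m, hm⟩ := prod_factorial_dvd_sq hn _ (ξ.numColor_ne_zero h)
  rw [sum_numColor] at hm
  rw [hm, mul_comm, mul_smul]
  refine (latticeQ n).smul_of_tower_mem m (ξ.prod_factorial_smul_average_mem fun s =>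
    Submodule.subset_span ⟨_, hc, fun i hi => ?_, rfl⟩)
  obtain ⟨x, hx⟩ := h i
  have := (ξ.mem_strand_arrange s (h := x.1) (i := i)).2 ⟨x.2, hx⟩
  rw [hi] at this
  exact List.not_mem_nil this

end MarkedCharacter

/-! ### Denominators of the inverse -/

namespace CharacterDiagram

variable {l N : ℕ} (D : CharacterDiagram l)

theorem numColor_marked (i : Fin l) : D.marked.numColor i = (D.strand i).length := by
  classical
  have e : {h // D.marked.color h = i} ≃ {h // h ∈ (D.strand i).toFinset} :=
    { toFun := fun h => ⟨h.1.1, List.mem_toFinset.2 ((D.marked_color h.1).1 h.2)⟩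
      invFun := fun h => ⟨⟨h.1, rot_of_mem (List.mem_toFinset.1 h.2)⟩,
        (D.marked_color _).2 (List.mem_toFinset.1 h.2)⟩
      left_inv := fun _ => rfl
      right_inv := fun _ => rfl }
  rw [← List.toFinset_card_of_nodup (D.nodup i), numColor, Nat.card_congr e,
    Nat.card_eq_fintype_card, Fintype.card_coe]

theorem colorCard_labels {lab : D.H → Fin N} {κ : Fin N → Fin l} {pos : Fin N → ℕ}
    (hL : D.IsLabelling lab κ pos) (i : Fin l) :
    (graphSystem κ).colorCard (D.labels lab) i = (D.strand i).length := by
  classical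
  have hcard : (graphSystem κ).colorCard (D.labels lab) i =
      ((D.labels lab).filter fun x => κ x = i).card := by
    unfold GlueSystem.colorCard
    congr!
  rw [← List.toFinset_card_of_nodup (D.nodup i), hcard]
  symm
  refine Finset.card_bij (fun h _ => lab h) ?_ ?_ ?_
  · intro h hh
    rw [List.mem_toFinset] at hh
    rw [Finset.mem_filter]
    exact ⟨mem_labels.2 ⟨h, rot_of_mem hh, rfl⟩, hL.color_eq hh⟩
  · intro h hh h' hh' heq
    rw [List.mem_toFinset] at hh hh'
    exact hL.inj _ _ (rot_of_mem hh) (rot_of_mem hh') heq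
  · intro x hx
    rw [Finset.mem_filter] at hx
    obtain ⟨hx, hxi⟩ := hx
    obtain ⟨h, hh, rfl⟩ := mem_labels.1 hx
    exact ⟨h, List.mem_toFinset.2 (hxi ▸ hL.mem h hh), rfl⟩

/-- A property of characters that is preserved by gluing legs gives control of the inverse
symmetrization. -/
theorem prod_factorial_smul_desymmetrize_mem {lab : D.H → Fin N} {κ : Fin N → Fin l}
    {pos : Fin N → ℕ} (hL : D.IsLabelling lab κ pos) (P : MarkedCharacter N → Prop)
    (hglue : ∀ (ξ : MarkedCharacter N) (b c : ξ.External) (hbc : b ≠ c), P ξ →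
      κ (ξ.color b) = κ (ξ.color c) → P (ξ.glue b c hbc (ξ.color b)))
    (hP : P (D.labelled lab)) {Y : Submodule ℤ (SpaceB l)}
    (hY : ∀ ξ, P ξ → (ξ.recolor κ).toB ∈ Y) :
    (∏ i, ((D.strand i).length)!) • D.desymmetrize ∈ Y := by
  rw [desymmetrize_eq hL, value]
  simp only [← D.colorCard_labels hL]
  -- The lattice spanned by the characters with property `P` is stable under the gluings that occur,
  -- since `glueB` sends such a character to another one or to zero.
  refine GlueSystem.factorial_smul_total_mem (Submodule.span ℤ (toB '' {ξ | P ξ})) Y ?_ ?_ _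
    (Submodule.subset_span ⟨_, hP, rfl⟩)
  · intro x y hxy hκ v hv
    induction hv using Submodule.span_induction with
    | zero => rw [map_zero]; exact Submodule.zero_mem _
    | add v w _ _ hv hw => rw [map_add]; exact Submodule.add_mem _ hv hw
    | smul r v _ hv => rw [map_zsmul]; exact Submodule.smul_mem _ _ hv
    | mem v hv =>
      obtain ⟨ξ, hξ, rfl⟩ := hv
      by_cases h : (∃ b, ξ.IsOnly x b) ∧ ∃ c, ξ.IsOnly y c
      · obtain ⟨⟨b, hb⟩, c, hc⟩ := h
        change glueB x y ξ.toB ∈ _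
        rw [glueB_toB_eq hxy hb hc]
        obtain rfl := hb.color_eq
        obtain rfl := hc.color_eq
        exact Submodule.subset_span ⟨_, hglue ξ b c _ hξ hκ, rfl⟩
      · change glueB x y ξ.toB ∈ _
        rw [glueB_toB_eq_zero h]
        exact Submodule.zero_mem _
  · intro v hv
    change recolorB κ v ∈ Y
    induction hv using Submodule.span_induction with
    | zero => rw [map_zero]; exact Submodule.zero_mem _
    | add v w _ _ hv hw => rw [map_add]; exact Submodule.add_mem _ hv hw
    | smul r v _ hv => rw [map_zsmul]; exact Submodule.smul_mem _ _ hv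
    | mem v hv =>
      obtain ⟨ξ, hξ, rfl⟩ := hv
      rw [recolorB_toB]
      exact hY ξ hξ

theorem prod_factorial_smul_desymmetrize_mem_latticeB :
    (∏ i, ((D.strand i).length)!) • D.desymmetrize ∈ latticeB l := by
  obtain ⟨N, lab, κ, pos, hL, -⟩ := D.exists_labelling
  exact D.prod_factorial_smul_desymmetrize_mem hL (fun _ => True) (fun _ _ _ _ _ _ => trivial)
    trivial fun ξ _ => Submodule.subset_span ⟨_, rfl⟩

theorem sum_length : ∑ i, (D.strand i).length = D.numExternal := by
  simp only [← numColor_marked]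
  exact D.marked.sum_numColor

theorem factorial_smul_desymmetrize_mem : (D.numExternal)! • D.desymmetrize ∈ latticeB l := by
  obtain ⟨m, hm⟩ := Nat.prod_factorial_dvd_factorial_sum Finset.univ fun i => (D.strand i).length
  rw [sum_length] at hm
  rw [hm, mul_comm, mul_smul]
  exact (latticeB l).smul_of_tower_mem m D.prod_factorial_smul_desymmetrize_mem_latticeB

/-- Joining two legs of one colour keeps a graph connected and loses no colour. The factorials are
harmless, since `spaceF` is a rational subspace. -/
theorem desymmetrize_mem_spaceF (hc : D.IsConnected) (h : D.IsNondegenerate) :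
    D.desymmetrize ∈ spaceF l := by
  obtain ⟨N, lab, κ, pos, hL, -⟩ := D.exists_labelling
  have := D.prod_factorial_smul_desymmetrize_mem hL
    (fun ξ => ξ.IsConnected ∧ ∀ i, ∃ h, κ (ξ.color h) = i) ?_ ⟨hc, fun i => ?_⟩
    (Y := (spaceF l).restrictScalars ℤ)
    (fun ξ hξ => Submodule.subset_span ⟨ξ.recolor κ, hξ.1, hξ.2, rfl⟩)
  · rw [Submodule.restrictScalars_mem, ← Nat.cast_smul_eq_nsmul ℚ] at this
    exact ((spaceF l).smul_mem_iff (Nat.cast_ne_zero.2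
      (Finset.prod_ne_zero_iff.2 fun i _ => Nat.factorial_ne_zero _))).1 this
  · rintro ξ b c hbc ⟨hc, hcol⟩ hκ
    refine ⟨hc.glue hbc, fun i => ?_⟩
    obtain ⟨h, rfl⟩ := hcol i
    by_cases h1 : h = b
    · exact ⟨newLeg hbc, by rw [h1]; rfl⟩
    by_cases h2 : h = c
    · exact ⟨newLeg hbc, by rw [h2, ← hκ]; rfl⟩
    · exact ⟨glueLeg hbc h h1 h2, rfl⟩
  · obtain ⟨x, hx⟩ := List.exists_mem_of_ne_nil _ (h i)
    exact ⟨⟨x, rot_of_mem hx⟩, hL.color_eq hx⟩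

end CharacterDiagram

/-! ### The projection to the connected non-degenerate part -/

namespace MarkedCharacter

variable {n : ℕ} {ξ ξ' : MarkedCharacter n}

theorem Reattach.isConnected_iff {ρ : Equiv.Perm ξ.H} {e : ξ.H ≃ ξ'.H}
    (hopp : ∀ h, ξ'.opp (e h) = e (ξ.opp h))
    (hrot : ∀ h, ξ'.rot (e (ρ h)) = e (ρ (ξ.rot h))) (hρ : ∀ h, ξ.Joined h (ρ h))
    (hρ' : ∀ h, ξ'.Joined (e h) (e (ρ h))) : ξ.IsConnected ↔ ξ'.IsConnected := by
  constructor
  · rintro ⟨⟨x⟩, hx⟩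
    refine ⟨⟨e x⟩, fun y z => ?_⟩
    obtain ⟨y, rfl⟩ := e.surjective y
    obtain ⟨z, rfl⟩ := e.surjective z
    refine ChineseCharacter.Joined.map (f := e) (fun h => ?_) (fun h => ?_) (hx y z)
    · refine (hρ' h).trans _ _ _ (Relation.EqvGen.trans _ _ _ ?_ (hρ' _).symm)
      rw [← hrot]
      exact joined_rot _
    · rw [← hopp]
      exact joined_opp _
  · rintro ⟨⟨x⟩, hx⟩
    refine ⟨⟨e.symm x⟩, fun y z => ?_⟩
    have := ChineseCharacter.Joined.map (f := e.symm) (fun h => ?_) (fun h => ?_) (hx (e y) (e z))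
    · simpa using this
    · obtain ⟨h, rfl⟩ := e.surjective h
      obtain ⟨h, rfl⟩ := ρ.surjective h
      rw [hrot, e.symm_apply_apply, e.symm_apply_apply]
      exact (hρ h).symm.trans _ _ _ ((joined_rot h).trans _ _ _ (hρ _))
    · obtain ⟨h, rfl⟩ := e.surjective h
      rw [hopp, e.symm_apply_apply, e.symm_apply_apply]
      exact joined_opp _

/-- The half-edges moved in an antisymmetry or Jacobi relation are at the vertex of `a` or at the
other end of its edge. They lie in the component of `a` before and after the reattachment, so
connectedness does not change. -/
theorem Reattach.joined {ρ : Equiv.Perm ξ.H} {e : ξ.H ≃ ξ'.H}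
    (hopp : ∀ h, ξ'.opp (e h) = e (ξ.opp h))
    (hrot : ∀ h, ξ'.rot (e (ρ h)) = e (ρ (ξ.rot h))) {a : ξ.H} (ha : ρ a = a)
    (hρ : ∀ h, ρ h ≠ h → h = ξ.rot a ∨ h = ξ.rot (ξ.rot a) ∨
      (ρ (ξ.opp a) = ξ.opp a ∧ h = ξ.rot (ξ.opp a))) :
    (∀ h, ξ.Joined h (ρ h)) ∧ ∀ h, ξ'.Joined (e h) (e (ρ h)) := by
  have h1 : ∀ h, ρ h ≠ h → ξ.Joined a h := by
    intro h hh
    rcases hρ h hh with rfl | rfl | ⟨-, rfl⟩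
    · exact joined_rot a
    · exact (joined_rot a).trans _ _ _ (joined_rot _)
    · exact (joined_opp a).trans _ _ _ (joined_rot _)
  have h2 : ∀ h, ρ h ≠ h → ξ'.Joined (e a) (e (ρ h)) := by
    have h3 : ξ'.Joined (e a) (e (ρ (ξ.rot a))) := by
      rw [← hrot, ha]
      exact joined_rot _
    intro h hh
    rcases hρ h hh with rfl | rfl | ⟨h4, rfl⟩
    · exact h3
    · refine h3.trans _ _ _ ?_
      rw [← hrot (ξ.rot a)]
      exact joined_rot _
    · rw [← hrot, h4, ← hopp]
      exact (joined_opp _).trans _ _ _ (joined_rot _)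
  constructor
  · intro h
    by_cases hh : ρ h = h
    · rw [hh]; exact .refl _
    · exact (h1 h hh).symm.trans _ _ _ (h1 _ fun h' => hh (ρ.injective h'))
  · intro h
    by_cases hh : ρ h = h
    · rw [hh]; exact .refl _
    · refine Relation.EqvGen.trans _ _ _ ?_ (h2 h hh)
      obtain ⟨k, rfl⟩ := ρ.surjective h
      exact (h2 k fun h' => hh (by rw [h', h'])).symm

theorem Reattach.isNondegenerate_iff {ρ : Equiv.Perm ξ.H} (h : ξ.Reattach ρ ξ')
    (hρ : ∀ h, ξ.rot h = h → ρ h = h) : ξ.IsNondegenerate ↔ ξ'.IsNondegenerate := by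
  obtain ⟨e, hopp, hrot, hcol⟩ := h
  refine forall_congr' fun i => ?_
  constructor
  · rintro ⟨h, rfl⟩
    exact ⟨reattachEquiv hρ hrot h, hcol _ _ rfl⟩
  · rintro ⟨h, rfl⟩
    obtain ⟨h, rfl⟩ := (reattachEquiv hρ hrot).surjective h
    exact ⟨h, (hcol _ _ rfl).symm⟩

open Classical in
/-- The class of `ξ` if `ξ` is connected and non-degenerate, and otherwise `0`. -/
def projTerm (ξ : MarkedCharacter n) : SpaceB n :=
  if ξ.IsConnected ∧ ξ.IsNondegenerate then ξ.toB else 0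

theorem projTerm_of (h : ξ.IsConnected ∧ ξ.IsNondegenerate) : ξ.projTerm = ξ.toB := if_pos h

theorem projTerm_of_not (h : ¬ (ξ.IsConnected ∧ ξ.IsNondegenerate)) : ξ.projTerm = 0 := if_neg h

theorem Reattach.good_iff {ρ : Equiv.Perm ξ.H} (h : ξ.Reattach ρ ξ') {a : ξ.H} (ha : ρ a = a)
    (hρ : ∀ h, ρ h ≠ h → h = ξ.rot a ∨ h = ξ.rot (ξ.rot a) ∨
      (ρ (ξ.opp a) = ξ.opp a ∧ h = ξ.rot (ξ.opp a))) (hfix : ∀ h, ξ.rot h = h → ρ h = h) :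
    ξ.IsConnected ∧ ξ.IsNondegenerate ↔ ξ'.IsConnected ∧ ξ'.IsNondegenerate := by
  refine and_congr ?_ (h.isNondegenerate_iff hfix)
  obtain ⟨e, hopp, hrot, hcol⟩ := h
  obtain ⟨h1, h2⟩ := Reattach.joined hopp hrot ha hρ
  exact Reattach.isConnected_iff hopp hrot h1 h2

/-- In each relation either all terms are connected and non-degenerate or none is, so the bad
characters can be set to zero consistently. -/
theorem respectsB_projTerm : RespectsB (projTerm (n := n)) where
  homeo ξ ξ' h := by
    have hiff : ξ.IsConnected ∧ ξ.IsNondegenerate ↔ ξ'.IsConnected ∧ ξ'.IsNondegenerate := by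
      refine and_congr ?_ (h.isNondegenerate_iff fun _ _ => rfl)
      obtain ⟨e, hopp, hrot, hcol⟩ := h
      exact Reattach.isConnected_iff hopp hrot (fun _ => .refl _) fun _ => .refl _
    by_cases hg : ξ.IsConnected ∧ ξ.IsNondegenerate
    · rw [projTerm_of hg, projTerm_of (hiff.1 hg), toB_eq h]
    · rw [projTerm_of_not hg, projTerm_of_not (mt hiff.2 hg)]
  antisymm ξ₁ ξ₂ a ha h := by
    classical
    have hiff := h.good_iff (a := a)
      (Equiv.swap_apply_of_ne_of_ne ha.symm (ne_rot_rot ha)) (fun h hh => by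
        by_contra! hne
        exact hh (Equiv.swap_apply_of_ne_of_ne hne.1 hne.2.1)) (swap_fixes_external ha)
    by_cases hg : ξ₁.IsConnected ∧ ξ₁.IsNondegenerate
    · rw [projTerm_of hg, projTerm_of (hiff.1 hg)]
      exact toB_add_toB a ha h
    · rw [projTerm_of_not hg, projTerm_of_not (mt hiff.2 hg), add_zero]
  jacobi ξ₁ ξ₂ ξ₃ a b c d hb hc hd ha ha' hab hac h₂ h₃ := by
    classical
    have h1 : ξ₁.rot (ξ₁.opp a) ≠ ξ₁.opp a := hd ▸ ha'
    have h2 : ξ₁.rot a ≠ a := hb ▸ ha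
    have hfix : ∀ h, ξ₁.rot h = h → (Equiv.swap b c * Equiv.swap c d) h = h := by
      intro h hh
      subst hc hd hb
      exact cycle_fixes_external h2 h1 h hh
    obtain ⟨-, -, -, ρ, hρ, p1, p2, p3, p4, p5, -, p7⟩ :=
      jacobi_perm rfl hb.symm hc.symm hd.symm rfl ha ha' hab hac
    have hmove : ∀ h, ρ h ≠ h → h = b ∨ h = c ∨ h = d := fun h hh => by
      by_contra! hne
      exact hh (p7 h hne.1 hne.2.1 hne.2.2)
    have hinv : ∀ h, ρ⁻¹ h = h ↔ ρ h = h := fun h => by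
      rw [Equiv.Perm.inv_eq_iff_eq, eq_comm]
    have hmove' : ∀ h, ρ h ≠ h → h = ξ₁.rot a ∨ h = ξ₁.rot (ξ₁.rot a) ∨ h = ξ₁.rot (ξ₁.opp a) := by
      intro h hh
      have := hmove h hh
      rwa [hd, hc, hb] at this
    rw [← hρ] at hfix
    have hiff₂ := h₂.good_iff (a := a) (by rw [← hρ, p1]) (fun h hh => by
      rw [← hρ] at hh ⊢
      exact (hmove' h hh).imp_right (Or.imp_right fun h' => ⟨p5, h'⟩)) (by rwa [← hρ])
    have hiff₃ := h₃.good_iff (a := a) (by rw [← hρ, hinv, p1]) (fun h hh => by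
      rw [← hρ] at hh ⊢
      exact (hmove' h (mt (hinv h).2 hh)).imp_right (Or.imp_right fun h' => ⟨(hinv _).2 p5, h'⟩))
      (fun h hh => by rw [← hρ, hinv, hfix h hh])
    by_cases hg : ξ₁.IsConnected ∧ ξ₁.IsNondegenerate
    · rw [projTerm_of hg, projTerm_of (hiff₂.1 hg), projTerm_of (hiff₃.1 hg)]
      exact toB_add_toB_add_toB a b c d hb hc hd ha ha' hab hac h₂ h₃
    · rw [projTerm_of_not hg, projTerm_of_not (mt hiff₂.2 hg), projTerm_of_not (mt hiff₃.2 hg),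
        add_zero, add_zero]

end MarkedCharacter

/-- The projection of `SpaceB` to the span of the connected non-degenerate characters. -/
def projF (n : ℕ) : SpaceB n →ₗ[ℚ] SpaceB n := liftB projTerm respectsB_projTerm

section projF

variable {n : ℕ}

theorem projF_toB (ξ : MarkedCharacter n) : projF n ξ.toB = ξ.projTerm := liftB_toB _ _ _

theorem projF_of_mem {x : SpaceB n} (hx : x ∈ spaceF n) : projF n x = x := by
  induction hx using Submodule.span_induction with
  | zero => exact map_zero _
  | add x y _ _ hx hy => rw [map_add, hx, hy]
  | smul r x _ hx => rw [map_smul, hx]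
  | mem x hx =>
    obtain ⟨ξ, h1, h2, rfl⟩ := hx
    rw [projF_toB, projTerm_of ⟨h1, h2⟩]

theorem projF_mem_latticeF {x : SpaceB n} (hx : x ∈ latticeB n) : projF n x ∈ latticeF n := by
  induction hx using Submodule.span_induction with
  | zero => rw [map_zero]; exact Submodule.zero_mem _
  | add x y _ _ hx hy => rw [map_add]; exact Submodule.add_mem _ hx hy
  | smul r x _ hx => rw [map_zsmul]; exact Submodule.smul_mem _ _ hx
  | mem x hx =>
    obtain ⟨ξ, rfl⟩ := hx
    rw [projF_toB]
    by_cases hg : ξ.IsConnected ∧ ξ.IsNondegenerate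
    · rw [projTerm_of hg]
      exact Submodule.subset_span ⟨ξ, hg.1, hg.2, rfl⟩
    · rw [projTerm_of_not hg]
      exact Submodule.zero_mem _

end projF

/-! ### Denominators of the inverse for classes in `spaceQ` -/

namespace CharacterDiagram

variable {l : ℕ} (D : CharacterDiagram l)

/-- Gluing equally coloured legs creates no new colour, so every character in the inverse
symmetrization still misses the colour `i` and is killed by the projection. -/
theorem projF_desymmetrize_eq_zero {i : Fin l} (hi : D.strand i = []) :
    projF l D.desymmetrize = 0 := by
  obtain ⟨N, lab, κ, pos, hL, -⟩ := D.exists_labelling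
  have := D.prod_factorial_smul_desymmetrize_mem hL (fun ξ => ∀ h, κ (ξ.color h) ≠ i) ?_ ?_
    (Y := (LinearMap.ker (projF l)).restrictScalars ℤ) (fun ξ hξ => ?_)
  · rw [Submodule.restrictScalars_mem, ← Nat.cast_smul_eq_nsmul ℚ] at this
    exact ((LinearMap.ker (projF l)).smul_mem_iff (Nat.cast_ne_zero.2
      (Finset.prod_ne_zero_iff.2 fun i _ => Nat.factorial_ne_zero _))).1 this
  · intro ξ b c hbc hξ _
    exact glue_external_cases hbc (hξ b) fun h _ _ => hξ h
  · intro h h'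
    have := hL.mem h.1 h.2
    rw [show κ (lab h.1) = i from h', hi] at this
    exact List.not_mem_nil this
  · rw [Submodule.restrictScalars_mem, LinearMap.mem_ker, projF_toB, projTerm_of_not]
    rintro ⟨-, h⟩
    obtain ⟨x, hx⟩ := h i
    exact hξ x hx

theorem desymm_mem_spaceF {x : SpaceP l} (hx : x ∈ spaceQ l) : desymm l x ∈ spaceF l := by
  induction hx using Submodule.span_induction with
  | zero => rw [map_zero]; exact Submodule.zero_mem _
  | add x y _ _ hx hy => rw [map_add]; exact Submodule.add_mem _ hx hy
  | smul r x _ hx => rw [map_smul]; exact Submodule.smul_mem _ _ hx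
  | mem x hx =>
    obtain ⟨D, h1, h2, rfl⟩ := hx
    rw [desymm_toP]
    exact D.desymmetrize_mem_spaceF h1 h2

/-- The inverse maps `𝓠` to `𝓕`, where `projF` is the identity. So `projF` may be applied to the
integral expression of the inverse image without changing its class; it carries `latticeB` to
`latticeF`. `D` itself need not be connected. If some string is empty, the inverse image is zero. -/
theorem factorial_sq_smul_desymmetrize_mem (hl : 2 ≤ l) (h : D.toP ∈ spaceQ l) :
    ((D.numExternal - 1)! ^ 2) • D.desymmetrize ∈ latticeF l := by
  have hF := desymm_mem_spaceF h
  rw [desymm_toP] at hF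
  have hproj := projF_of_mem hF
  by_cases hD : D.IsNondegenerate
  · obtain ⟨m, hm⟩ := prod_factorial_dvd_sq hl _ fun i => mt List.length_eq_zero_iff.1 (hD i)
    rw [sum_length] at hm
    rw [hm, mul_comm, mul_smul, ← hproj, ← map_nsmul]
    exact (latticeF l).smul_of_tower_mem m
      (projF_mem_latticeF D.prod_factorial_smul_desymmetrize_mem_latticeB)
  · simp only [IsNondegenerate, not_forall, not_not] at hD
    obtain ⟨i, hi⟩ := hD
    rw [← hproj, D.projF_desymmetrize_eq_zero hi, smul_zero]
    exact Submodule.zero_mem _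

end CharacterDiagram

theorem mainTheorem5 (l : ℕ) :
    ∃ χ : SpaceB l ≃ₗ[ℚ] SpaceP l, IsChi χ.toLinearMap ∧
      (∀ ξ : MarkedCharacter l,
        HasDenominator (latticeP l) (ξ.numExternal)! (χ ξ.toB)) ∧
      (∀ D : CharacterDiagram l,
        HasDenominator (latticeB l) (D.numExternal)! (χ.symm D.toP)) ∧
      (2 ≤ l → ∀ ξ : MarkedCharacter l, ξ.toB ∈ spaceF l →
        HasDenominator (latticeQ l) ((ξ.numExternal - 1)! ^ 2) (χ ξ.toB)) ∧
      (2 ≤ l → ∀ D : CharacterDiagram l, D.toP ∈ spaceQ l →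
        HasDenominator (latticeF l) ((D.numExternal - 1)! ^ 2) (χ.symm D.toP)) := by
  refine ⟨symmetrizationEquiv l, symmetrizationEquiv_toB, fun ξ => ?_, fun D => ?_,
    fun hl ξ hξ => ?_, fun hl D hD => ?_⟩
  · rw [symmetrizationEquiv_toB]
    exact ξ.factorial_smul_average_mem
  · rw [symmetrizationEquiv_symm_toP]
    exact D.factorial_smul_desymmetrize_mem
  · by_cases hg : ξ.IsConnected ∧ ξ.IsNondegenerate
    · rw [symmetrizationEquiv_toB]
      exact ξ.factorial_sq_smul_average_mem hl hg.1 hg.2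
    -- The projection fixes the class, being the identity on `𝓕`, and kills it, being zero on bad
    -- characters. So the class is zero, which also covers the case of no external vertices.
    · have h0 := projF_of_mem hξ
      rw [projF_toB, projTerm_of_not hg] at h0
      rw [HasDenominator, ← h0, map_zero, smul_zero]
      exact Submodule.zero_mem _
  · rw [symmetrizationEquiv_symm_toP]
    exact D.factorial_sq_smul_desymmetrize_mem hl hD

end
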